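/- Theorem (Circular law for the Ginibre ensemble). For each $N\ge 1$ let $A_N=(a_{ij})_{i,j=1}^N$ be an (unnormalized) complex Ginibre random matrix, i.e. a random complex $N\times N$ matrix whose entries have joint distribution $$\frac1{\pi^{N^2}}\exp\Big(-\sum_{i,j=1}^N|a_{ij}|^2\Big)\prod_{i,j=1}^N \mathrm d^2a_{ij},$$ where $\mathrm d^2 a$ is Lebesgue measure on $\mathbb C\cong\mathbb R^2$. For a complex $N\times N$ matrix $B$ with eigenvalues $z_1,\dots,z_N$, counted with algebraic multiplicity, let $\mu_B=\frac1N(\delta_{z_1}+\cdots+\delta_{z_N})$. Let $\mu_N=\mathbb E\big[\mu_{N^{-1/2}A_N}\big]$ be the averaged eigenvalue distribution of $N^{-1/2}A_N$. Then $\mu_N$ (a probability measure on $\mathbb C$) converges weakly, as $N\to\infty$, to the uniform distribution on the unit disc, i.e. the probability measure with density $\frac1\pi 1_{\{z\in\mathbb C:\,|z|\le1\}}$: for every bounded continuous $f:\mathbb C\to\mathbb R$, $$\lim_{N\to\infty}\int_{\mathbb C} f\,\mathrm d\mu_N=\frac1\pi\int_{\{|z|\le 1\}} f(z)\,\mathrm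 d^2z.$$ -/

import Mathlib

open MeasureTheory ProbabilityTheory Filter Topology
open scoped ENNReal BoundedContinuousFunction

noncomputable section

/-- The product (equivalently, Borel) σ-algebra on complex `N × N` matrices. -/
instance instMeasurableSpaceComplexMatrix (N : ℕ) : MeasurableSpace (Matrix (Fin N) (Fin N) ℂ) :=
  inferInstanceAs (MeasurableSpace (Fin N → Fin N → ℂ))

/-- The eigenvalue distribution `(1/N) (δ_{z₁} + ⋯ + δ_{z_N})` of a complex `N × N` matrix, where
`z₁, …, z_N` are its eigenvalues, counted with algebraic multiplicity (the roots of the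
characteristic polynomial). -/
def eigenvalueDistribution {N : ℕ} (A : Matrix (Fin N) (Fin N) ℂ) : Measure ℂ :=
  (N : ℝ≥0∞)⁻¹ • (A.charpoly.roots.map (fun z => Measure.dirac z)).sum

/-- The law of the (complex, unnormalized) Ginibre ensemble: the measure on complex `N × N`
matrices with density `π^(-N²) exp (-∑ |a_ij|²)` with respect to the product of the Lebesgue
measures (of the real and imaginary part) of the entries. -/
def ginibreMeasure (N : ℕ) : Measure (Matrix (Fin N) (Fin N) ℂ) :=
  ((Measure.pi fun _ : Fin N => Measure.pi fun _ : Fin N => (volume : Measure ℂ)).withDensity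
    fun a => ENNReal.ofReal
      ((1 / Real.pi ^ (N ^ 2)) * Real.exp (-∑ i, ∑ j, ‖a i j‖ ^ 2))).map
    fun a => Matrix.of a

/-- The averaged eigenvalue distribution `𝔼[μ_A] = ∫ μ_{A(ω)} dP(ω)` of a random matrix `A`. -/
def averagedEigenvalueDistribution {Ω : Type*} [MeasurableSpace Ω] (P : Measure Ω) {N : ℕ}
    (A : Ω → Matrix (Fin N) (Fin N) ℂ) : Measure ℂ :=
  P.bind fun ω => eigenvalueDistribution (A ω)

/-- The uniform distribution on the unit disc, with density `(1/π) 1_{|z| ≤ 1}` with respect to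
the Lebesgue measure on `ℂ`. -/
def uniformUnitDisc : Measure ℂ :=
  (volume : Measure ℂ).withDensity
    ({z : ℂ | ‖z‖ ≤ 1}.indicator fun _ => ENNReal.ofReal (1 / Real.pi))

/-- Weak convergence of a sequence of measures on `ℂ`: convergence of the integrals of all bounded
continuous functions. -/
def WeaklyConverges (μ : ℕ → Measure ℂ) (ν : Measure ℂ) : Prop :=
  ∀ f : ℂ →ᵇ ℝ, Tendsto (fun N => ∫ z, f z ∂(μ N)) atTop (𝓝 (∫ z, f z ∂ν))

end

/-! ### Products of measures with densities -/

/-! The mean resolvent of a Ginibre matrix can be computed exactly at finite N, and the limit law is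
read off from its Cauchy transform.

Schur complement: let D be A without its first row and column, c the rest of the first column, y =
(z - D)⁻¹ c and v = (1, y). The corner entry of (z - A)⁻¹ is 1 / (z - ∑ v_j A_{0j})
(`inv_smul_one_sub_zero_zero`). The first row is independent of y, so given y the sum is √(1 + |y|²)
times a standard Gaussian. Cauchy's formula on circles then gives z times this entry the conditional
mean 1 - exp(-|z|² / (1 + |y|²)) (`integral_gaussianVec_resolvent`).

To average this exponential, substitute c = (z - D) y, with Jacobian |det (z - D)|². For fixed y the
integral over D depends only on |y|, by unitary invariance, so y may be taken along the first basis
vector. Completing the square leaves independent Gaussian entries, centred off the diagonal, and the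
second moment of the determinant becomes a permanent (`integral_normSq_det_mul`,
`sum_perm_prod_one_add_ite`). The exponentials in y combine to exp(-|z|²), only powers of 1 + |y|²
remain, and the average is E (1 - X/N)₊ with X Poisson of mean |z|²
(`lintegral_exp_eq_poissonDefect`). All diagonal entries agree by permutation symmetry. After
scaling, z times the mean normalized trace is 1 - E (1 - X/N)₊ with X Poisson of mean N|z|². The
Poisson variance shows that this tends to min(|z|², 1) (`abs_poissonDefect_sub_le`), which is z
times the Cauchy transform of the uniform law on the disc (`setIntegral_unitDisc_div_sub`).

Passage to measures: integrating (z - w)/(z - v) over the disc |z - w| < r gives π (r² - |v - w|²)₊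
(`setIntegral_ball_div_sub`). Hence the resolvent trace, integrated against z - w over a disc, is a
linear statistic of the eigenvalues with a continuous, compactly supported test function. These
paraboloid bumps form an approximate identity, which yields first compactly supported test functions
and then, the limit being a probability measure, all bounded continuous ones. The same formula gives
measurability of eigenvalue statistics. -/

theorem lintegral_fin_prod_eq_prod {n : ℕ} {E : Type*} [MeasurableSpace E]
    (μ : Fin n → Measure E) [∀ i, SigmaFinite (μ i)] (f : Fin n → E → ℝ≥0∞)
    (hf : ∀ i, Measurable (f i)) :
    ∫⁻ x : Fin n → E, ∏ i, f i (x i) ∂(Measure.pi μ) = ∏ i, ∫⁻ x, f i x ∂(μ i) := by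
  induction n with
  | zero => simp
  | succ n ih =>
    have h := (measurePreserving_piFinSuccAbove μ 0).symm
    rw [← h.lintegral_comp_emb (MeasurableEquiv.measurableEmbedding _)]
    simp_rw [MeasurableEquiv.piFinSuccAbove_symm_apply, Fin.insertNthEquiv,
      Fin.prod_univ_succ, Fin.insertNth_zero, Equiv.coe_fn_mk, Fin.cons_succ,
      Fin.zero_succAbove, cast_eq, Fin.cons_zero]
    rw [← ih (fun i => μ i.succ) (fun i => f i.succ) (fun i => hf _)]
    exact lintegral_prod_mul (μ := μ 0) (ν := Measure.pi fun j => μ j.succ) (f := f 0) (g := fun x : Fin n → E => ∏ i, f i.succ (x i))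
      (hf 0).aemeasurable (Finset.measurable_fun_prod _ fun i _ =>
        (hf _).comp (measurable_pi_apply i)).aemeasurable

theorem pi_withDensity_eq {n : ℕ} {E : Type*} [MeasurableSpace E]
    (μ : Fin n → Measure E) [∀ i, SigmaFinite (μ i)] (f : Fin n → E → ℝ≥0∞)
    (hf : ∀ i, Measurable (f i)) [∀ i, SigmaFinite ((μ i).withDensity (f i))] :
    Measure.pi (fun i => (μ i).withDensity (f i)) =
      (Measure.pi μ).withDensity fun x => ∏ i, f i (x i) := by
  refine Measure.pi_eq fun s hs => ?_
  rw [withDensity_apply _ (MeasurableSet.univ_pi hs), ← lintegral_indicator (MeasurableSet.univ_pi hs)]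
  have : ∀ x : Fin n → E, (Set.univ.pi s).indicator (fun x => ∏ i, f i (x i)) x
      = ∏ i, (s i).indicator (f i) (x i) := by
    intro x
    by_cases hx : x ∈ Set.univ.pi s
    · rw [Set.indicator_of_mem hx]
      exact Finset.prod_congr rfl fun i _ => (Set.indicator_of_mem (hx i trivial) _).symm
    · rw [Set.indicator_of_notMem hx]
      simp only [Set.mem_pi, Set.mem_univ, true_imp_iff, not_forall] at hx
      obtain ⟨i, hi⟩ := hx
      exact (Finset.prod_eq_zero (Finset.mem_univ i) (Set.indicator_of_notMem hi _)).symm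
  simp_rw [this]
  rw [lintegral_fin_prod_eq_prod μ _ fun i => (hf i).indicator (hs i)]
  refine Finset.prod_congr rfl fun i _ => ?_
  rw [withDensity_apply _ (hs i), lintegral_indicator (hs i)]

/-! ### Gaussian integrals on the plane -/

theorem integral_exp_neg_mul_norm_sq {a : ℝ} (ha : 0 < a) :
    ∫ z : ℂ, Real.exp (-a * ‖z‖ ^ 2) = Real.pi / a := by
  rw [GaussianFourier.integral_rexp_neg_mul_sq_norm ha]
  simp

theorem integrable_exp_neg_mul_norm_sq {a : ℝ} (ha : 0 < a) :
    Integrable fun z : ℂ => Real.exp (-a * ‖z‖ ^ 2) := by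
  by_contra h
  have := integral_exp_neg_mul_norm_sq ha
  rw [integral_undef h] at this
  have : 0 < Real.pi / a := by positivity
  linarith

theorem integral_norm_sq_mul_exp_neg_mul_norm_sq {a : ℝ} (ha : 0 < a) :
    ∫ z : ℂ, ‖z‖ ^ 2 * Real.exp (-a * ‖z‖ ^ 2) = Real.pi / a ^ 2 := by
  have h := Complex.integral_rpow_mul_exp_neg_mul_rpow (p := 2) (q := 2) (b := a) (by norm_num)
    (by norm_num) ha
  have e : (-(2 + 2) / 2 : ℝ) = -(2 : ℕ) := by norm_num
  rw [e, Real.rpow_neg ha.le, Real.rpow_natCast] at h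
  simp only [Real.rpow_ofNat] at h
  rw [h]
  have : Real.Gamma ((2 + 2) / 2) = 1 := by
    rw [show ((2 + 2) / 2 : ℝ) = 2 by norm_num, Real.Gamma_two]
  rw [this]; field_simp

theorem integrable_norm_sq_mul_exp_neg_mul_norm_sq {a : ℝ} (ha : 0 < a) :
    Integrable fun z : ℂ => ‖z‖ ^ 2 * Real.exp (-a * ‖z‖ ^ 2) := by
  by_contra h
  have := integral_norm_sq_mul_exp_neg_mul_norm_sq ha
  rw [integral_undef h] at this
  have : 0 < Real.pi / a ^ 2 := by positivity
  linarith

theorem integrable_ofReal_exp_neg_mul_norm_sq_mul {a : ℝ} (ha : 0 < a) :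
    Integrable fun z : ℂ => z * (Real.exp (-a * ‖z‖ ^ 2) : ℂ) := by
  refine ((integrable_exp_neg_mul_norm_sq ha).add
    (integrable_norm_sq_mul_exp_neg_mul_norm_sq ha)).mono' (by fun_prop) (ae_of_all _ fun z => ?_)
  rw [norm_mul, Complex.norm_real, Real.norm_of_nonneg (Real.exp_pos _).le, Pi.add_apply]
  nlinarith [sq_nonneg (‖z‖ - 1), Real.exp_pos (-a * ‖z‖ ^ 2), norm_nonneg z,
    mul_nonneg (sq_nonneg (‖z‖ - 1)) (Real.exp_pos (-a * ‖z‖ ^ 2)).le]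

theorem integral_mul_exp_neg_mul_norm_sq (a : ℝ) :
    ∫ z : ℂ, z * (Real.exp (-a * ‖z‖ ^ 2) : ℂ) = 0 := by
  have h := integral_neg_eq_self (fun z : ℂ => z * (Real.exp (-a * ‖z‖ ^ 2) : ℂ)) volume
  simp only [norm_neg, neg_mul] at h
  rw [integral_neg] at h
  have := neg_eq_self.mp h
  simpa using this

/-- The weight `exp (-a |z - m|²)`. -/
noncomputable def gaussWeight (a : ℝ) (m z : ℂ) : ℝ := Real.exp (-a * ‖z - m‖ ^ 2)

theorem gaussWeight_pos (a : ℝ) (m z : ℂ) : 0 < gaussWeight a m z := Real.exp_pos _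

theorem integrable_gaussWeight {a : ℝ} (ha : 0 < a) (m : ℂ) : Integrable (gaussWeight a m) :=
  (integrable_exp_neg_mul_norm_sq ha).comp_sub_right m

theorem integral_gaussWeight {a : ℝ} (ha : 0 < a) (m : ℂ) :
    ∫ z, gaussWeight a m z = Real.pi / a := by
  unfold gaussWeight
  rw [integral_sub_right_eq_self (fun z : ℂ => Real.exp (-a * ‖z‖ ^ 2)) m,
    integral_exp_neg_mul_norm_sq ha]

theorem integrable_ofReal_gaussWeight {a : ℝ} (ha : 0 < a) (m : ℂ) :
    Integrable fun z => (gaussWeight a m z : ℂ) :=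
  (integrable_gaussWeight ha m).ofReal

theorem integrable_mul_gaussWeight {a : ℝ} (ha : 0 < a) (m : ℂ) :
    Integrable fun z => z * (gaussWeight a m z : ℂ) := by
  have h := ((integrable_ofReal_exp_neg_mul_norm_sq_mul ha).comp_sub_right m).add
    ((integrable_ofReal_gaussWeight ha m).const_mul m)
  refine h.congr (ae_of_all _ fun z => ?_)
  simp only [Pi.add_apply, gaussWeight]
  ring

theorem integral_mul_gaussWeight {a : ℝ} (ha : 0 < a) (m : ℂ) :
    ∫ z, z * (gaussWeight a m z : ℂ) = m * (Real.pi / a : ℝ) := by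
  have : ∀ z, z * (gaussWeight a m z : ℂ) = (z - m) * (Real.exp (-a * ‖z - m‖ ^ 2) : ℂ)
      + m * (gaussWeight a m z : ℂ) := by
    intro z; unfold gaussWeight; ring
  simp_rw [this]
  rw [integral_add ((integrable_ofReal_exp_neg_mul_norm_sq_mul ha).comp_sub_right m)
    ((integrable_ofReal_gaussWeight ha m).const_mul m),
    integral_sub_right_eq_self (fun z : ℂ => z * (Real.exp (-a * ‖z‖ ^ 2) : ℂ)) m,
    integral_mul_exp_neg_mul_norm_sq, zero_add, integral_const_mul, integral_complex_ofReal,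
    integral_gaussWeight ha]

/-- Expanding |z|² about m isolates a cross term that is odd in z - m and so integrates to zero. -/
theorem normSq_mul_gaussWeight (a : ℝ) (m z : ℂ) :
    ‖z‖ ^ 2 * gaussWeight a m z = ‖z - m‖ ^ 2 * Real.exp (-a * ‖z - m‖ ^ 2)
      + 2 * (starRingEnd ℂ m * ((z - m) * (Real.exp (-a * ‖z - m‖ ^ 2) : ℂ))).re
      + ‖m‖ ^ 2 * gaussWeight a m z := by
  unfold gaussWeight
  have : (starRingEnd ℂ m * ((z - m) * (Real.exp (-a * ‖z - m‖ ^ 2) : ℂ))).re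
      = (starRingEnd ℂ m * (z - m)).re * Real.exp (-a * ‖z - m‖ ^ 2) := by
    rw [← mul_assoc, Complex.re_mul_ofReal]
  rw [this, ← Complex.normSq_eq_norm_sq, ← Complex.normSq_eq_norm_sq,← Complex.normSq_eq_norm_sq]
  simp only [Complex.normSq_apply, Complex.mul_re, Complex.conj_re, Complex.conj_im,
    Complex.sub_re, Complex.sub_im]
  ring

theorem integrable_normSq_mul_gaussWeight {a : ℝ} (ha : 0 < a) (m : ℂ) :
    Integrable fun z => ‖z‖ ^ 2 * gaussWeight a m z := by
  simp_rw [normSq_mul_gaussWeight]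
  exact (((integrable_norm_sq_mul_exp_neg_mul_norm_sq ha).comp_sub_right m).add
    ((((integrable_ofReal_exp_neg_mul_norm_sq_mul ha).comp_sub_right m).const_mul
      (starRingEnd ℂ m)).re.const_mul 2)).add ((integrable_gaussWeight ha m).const_mul _)

theorem integral_normSq_mul_gaussWeight {a : ℝ} (ha : 0 < a) (m : ℂ) :
    ∫ z, ‖z‖ ^ 2 * gaussWeight a m z = Real.pi / a * (1 / a + ‖m‖ ^ 2) := by
  have i1 := (integrable_norm_sq_mul_exp_neg_mul_norm_sq ha).comp_sub_right m
  have i2' := (((integrable_ofReal_exp_neg_mul_norm_sq_mul ha).comp_sub_right m).const_mul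
      (starRingEnd ℂ m))
  have i2 : Integrable fun z : ℂ =>
      2 * (starRingEnd ℂ m * ((z - m) * (Real.exp (-a * ‖z - m‖ ^ 2) : ℂ))).re := i2'.re.const_mul 2
  have i3 := (integrable_gaussWeight ha m).const_mul (‖m‖ ^ 2)
  simp_rw [normSq_mul_gaussWeight]
  rw [integral_add (by exact i1.add i2) i3, integral_add i1 i2, integral_const_mul, integral_const_mul,
    integral_gaussWeight ha,
    integral_sub_right_eq_self (fun z : ℂ => ‖z‖ ^ 2 * Real.exp (-a * ‖z‖ ^ 2)) m,
    integral_norm_sq_mul_exp_neg_mul_norm_sq ha]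
  have e : ∫ z, (starRingEnd ℂ m * ((z - m) * (Real.exp (-a * ‖z - m‖ ^ 2) : ℂ))).re = 0 := by
    have h := integral_re i2'
    simp only [RCLike.re_eq_complex_re] at h
    rw [h, integral_const_mul,
      integral_sub_right_eq_self (fun z : ℂ => z * (Real.exp (-a * ‖z‖ ^ 2) : ℂ)) m,
      integral_mul_exp_neg_mul_norm_sq]
    simp
  rw [e]
  field_simp
  ring

/-! ### The Cauchy kernel and radial integrals -/

theorem circleMap_zero_eq_polarCoord_symm (r θ : ℝ) :
    Complex.polarCoord.symm (r, θ) = circleMap 0 r θ := by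
  simp [circleMap, Complex.exp_mul_I]

/-- Integration over the plane, in terms of averages over circles. -/
theorem integral_eq_integral_circleAverage {f : ℂ → ℂ} (hm : Measurable f) (hf : Integrable f) :
    ∫ z, f z = ∫ r in Set.Ioi (0 : ℝ), (2 * Real.pi * r) • Real.circleAverage f 0 r := by
  have hmeas : Measurable fun p : ℝ × ℝ => p.1 • f (Complex.polarCoord.symm p) := by
    simp only [Complex.polarCoord_symm_apply]
    exact measurable_fst.smul (hm.comp (by fun_prop))
  have hint : IntegrableOn (fun p : ℝ × ℝ => p.1 • f (Complex.polarCoord.symm p))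
      (Set.Ioi (0 : ℝ) ×ˢ Set.Ioo (-Real.pi) Real.pi) (volume.prod volume) := by
    refine ⟨hmeas.aestronglyMeasurable, ?_⟩
    have h := Complex.lintegral_comp_polarCoord_symm fun z => ‖f z‖ₑ
    have h2 : ∫⁻ z, ‖f z‖ₑ < ∞ := hf.2
    rw [← h] at h2
    rw [HasFiniteIntegral]
    refine lt_of_eq_of_lt ?_ h2
    refine setLIntegral_congr_fun (measurableSet_Ioi.prod measurableSet_Ioo) fun p hp => ?_
    have hp1 : 0 < p.1 := hp.1
    simp only [enorm_smul, smul_eq_mul]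
    rw [Real.enorm_of_nonneg hp1.le]
  rw [← Complex.integral_comp_polarCoord_symm]
  change ∫ p in Set.Ioi (0 : ℝ) ×ˢ Set.Ioo (-Real.pi) Real.pi,
    p.1 • f (Complex.polarCoord.symm p) ∂(volume.prod volume) = _
  rw [setIntegral_prod _ hint]
  refine setIntegral_congr_fun measurableSet_Ioi fun r _ => ?_
  simp only [circleMap_zero_eq_polarCoord_symm]
  rw [integral_smul, Real.circleAverage_eq_integral_add (-Real.pi), ← integral_Ioc_eq_integral_Ioo,
    ← intervalIntegral.integral_of_le (by linarith [Real.pi_pos]),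
    intervalIntegral.integral_comp_add_right (fun θ => f (circleMap 0 r θ)), smul_smul]
  have e : 2 * Real.pi + -Real.pi = Real.pi := by ring
  rw [zero_add, e]
  congr 1
  field_simp

/-- The average of z / (z - w) over the circle is (2πi)⁻¹ ∮ dz / (z - w), the winding number about
w: it is 1 here, and 0 when w lies outside. -/
theorem circleAverage_div_sub_of_lt {r : ℝ} {w : ℂ} (h : ‖w‖ < r) :
    Real.circleAverage (fun z => z / (z - w)) 0 r = 1 := by
  have hr : |r| = r := abs_of_pos ((norm_nonneg w).trans_lt h)
  have := DiffContOnCl.circleAverage_smul_div (f := fun _ : ℂ => (1 : ℂ)) (c := 0) (R := r)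
    (w := w) diffContOnCl_const (by rw [hr]; simpa using h)
  simpa using this

theorem circleAverage_div_sub_of_gt {r : ℝ} (hr : 0 < r) {w : ℂ} (h : r < ‖w‖) :
    Real.circleAverage (fun z => z / (z - w)) 0 r = 0 := by
  have hr' : |r| = r := abs_of_pos hr
  have hne : ∀ z ∈ Metric.closedBall (0 : ℂ) r, z - w ≠ 0 := by
    intro z hz h0
    rw [sub_eq_zero] at h0
    subst h0
    rw [mem_closedBall_zero_iff] at hz
    linarith
  have := circleAverage_of_differentiable_on_off_countable (f := fun z : ℂ => z / (z - w))
    (c := 0) (R := r) Set.countable_empty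
    (by rw [hr']; exact continuousOn_id.div (by fun_prop) hne)
    (by
      rw [hr']
      intro z hz
      exact differentiableAt_id.div (by fun_prop) (hne z (Metric.ball_subset_closedBall hz.1)))
  simpa using this

/-- Radial averages of the Cauchy kernel. -/
theorem integral_radial_mul_div_sub {k : ℝ → ℂ} (hk : Measurable k) (w : ℂ)
    (h1 : Integrable fun z : ℂ => k ‖z‖ * (z / (z - w))) (h2 : Integrable fun z : ℂ => k ‖z‖) :
    ∫ z : ℂ, k ‖z‖ * (z / (z - w)) = ∫ z : ℂ in {z | ‖w‖ < ‖z‖}, k ‖z‖ := by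
  have hS : MeasurableSet {z : ℂ | ‖w‖ < ‖z‖} := measurableSet_lt measurable_const measurable_norm
  rw [← integral_indicator hS,
    integral_eq_integral_circleAverage (by fun_prop) h1,
    integral_eq_integral_circleAverage (f := {z : ℂ | ‖w‖ < ‖z‖}.indicator fun z => k ‖z‖)
      ((hk.comp measurable_norm).indicator hS) (h2.indicator hS)]
  refine integral_congr_ae ?_
  -- On the circle through w neither Cauchy average applies; this single radius is a null set.
  have hne : ∀ᵐ r : ℝ ∂volume.restrict (Set.Ioi 0), r ≠ ‖w‖ :=
    ae_restrict_of_ae (by simp [ae_iff])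
  filter_upwards [hne, ae_restrict_mem measurableSet_Ioi] with r hr hr0
  have hr0 : 0 < r := hr0
  have hsph : ∀ z ∈ Metric.sphere (0 : ℂ) |r|, ‖z‖ = r := by
    intro z hz
    rw [mem_sphere_zero_iff_norm, abs_of_pos hr0] at hz
    exact hz
  congr 1
  rw [Real.circleAverage_congr_sphere (f₂ := fun z => k r • (z / (z - w)))
    (fun z hz => by simp [hsph z hz]), Real.circleAverage_fun_smul]
  rcases lt_or_gt_of_ne hr with h | h
  · rw [circleAverage_div_sub_of_gt hr0 h, Real.circleAverage_congr_sphere (f₂ := fun z => 0)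
      (fun z hz => by
        rw [Set.indicator_of_notMem]
        simp [hsph z hz, h.le]), Real.circleAverage_const]
    simp
  · rw [circleAverage_div_sub_of_lt h, Real.circleAverage_congr_sphere (f₂ := fun z => k r)
      (fun z hz => by
        rw [Set.indicator_of_mem, hsph z hz]
        simp [hsph z hz, h]), Real.circleAverage_const]
    simp

/-- The singularity has order 1, below the real dimension 2. -/
theorem locallyIntegrable_inv : LocallyIntegrable (fun z : ℂ => z⁻¹) := by
  refine locallyIntegrable_of_norm_le_rpow (C := 1) (α := 1) (by simp) (by simp)
    (ae_of_all _ fun z => ?_) measurable_inv.aestronglyMeasurable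
  rw [Real.rpow_neg_one, one_mul, norm_inv]

theorem integrableOn_inv_sub (w c : ℂ) (r : ℝ) :
    IntegrableOn (fun z : ℂ => (z - w)⁻¹) (Metric.closedBall c r) := by
  have h := locallyIntegrable_inv.integrableOn_isCompact (isCompact_closedBall (c - w) r)
  rw [← integrable_indicator_iff Metric.isClosed_closedBall.measurableSet] at h ⊢
  refine (h.comp_sub_right w).congr (ae_of_all _ fun z => ?_)
  simp only [Set.indicator, Metric.mem_closedBall, dist_sub_right]

theorem ae_ne_complex (w : ℂ) : ∀ᵐ z : ℂ, z ≠ w := by simp [ae_iff]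

/-- Complementary form of `integral_radial_mul_div_sub`, from z / (z - v) = 1 - v / (v - z). It
expresses Newton's theorem: only the mass inside radius |z| is felt at z. -/
theorem integral_radial_mul_div_sub' {k : ℝ → ℂ} (hk : Measurable k) (z : ℂ)
    (h1 : Integrable fun v : ℂ => k ‖v‖ * (v / (v - z))) (h2 : Integrable fun v : ℂ => k ‖v‖) :
    ∫ v : ℂ, k ‖v‖ * (z / (z - v)) = ∫ v : ℂ in {v | ‖v‖ ≤ ‖z‖}, k ‖v‖ := by
  have hS : MeasurableSet {v : ℂ | ‖z‖ < ‖v‖} := measurableSet_lt measurable_const measurable_norm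
  have hc : {v : ℂ | ‖v‖ ≤ ‖z‖} = {v : ℂ | ‖z‖ < ‖v‖}ᶜ := by ext; simp
  rw [hc, setIntegral_compl hS h2, ← integral_radial_mul_div_sub hk z h1 h2, ← integral_sub h2 h1]
  refine integral_congr_ae ?_
  filter_upwards [ae_ne_complex z] with v hv
  have h3 : v - z ≠ 0 := sub_ne_zero.mpr hv
  have h4 : z - v ≠ 0 := sub_ne_zero.mpr hv.symm
  field_simp
  ring

theorem volume_real_ball_complex (c : ℂ) {r : ℝ} (hr : 0 ≤ r) :
    volume.real (Metric.ball c r) = Real.pi * r ^ 2 := by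
  rw [Measure.real, Complex.volume_ball]
  simp [hr, mul_comm]

theorem volume_real_closedBall_complex (c : ℂ) {r : ℝ} (hr : 0 ≤ r) :
    volume.real (Metric.closedBall c r) = Real.pi * r ^ 2 := by
  rw [Measure.real, Complex.volume_closedBall]
  simp [hr, mul_comm]

theorem integrableOn_div_sub (c v w : ℂ) (r : ℝ) :
    IntegrableOn (fun z : ℂ => (z - w) / (z - v)) (Metric.ball c r) := by
  have h := (integrableOn_inv_sub v c r).mono_set Metric.ball_subset_closedBall
  have h2 : IntegrableOn (fun z : ℂ => (z - w) * (z - v)⁻¹) (Metric.closedBall c r) :=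
    (integrableOn_inv_sub v c r).continuousOn_mul (by fun_prop) (isCompact_closedBall c r)
  exact (h2.mono_set Metric.ball_subset_closedBall).congr_fun (fun z _ => (div_eq_mul_inv _ _).symm)
    Metric.isOpen_ball.measurableSet

/-- With w moved to the origin, circles of radius below |v - w| contribute nothing and the others
their full length, so the value is the area of an annulus. This turns a simple pole at an eigenvalue
into a continuous bump around it. -/
theorem setIntegral_ball_div_sub (v w : ℂ) {r : ℝ} (hr : 0 ≤ r) :
    ∫ z in Metric.ball w r, (z - w) / (z - v) = (Real.pi * max (r ^ 2 - ‖v - w‖ ^ 2) 0 : ℝ) := by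
  set k : ℝ → ℂ := (Set.Iio r).indicator 1 with hkdef
  have hk : Measurable k := measurable_one.indicator measurableSet_Iio
  have hkz : ∀ z : ℂ, k ‖z‖ = (Metric.ball (0 : ℂ) r).indicator 1 z := by
    intro z; simp [hkdef, Set.indicator]
  have h2 : Integrable fun z : ℂ => k ‖z‖ := by
    simp_rw [hkz]
    exact (integrable_indicator_iff Metric.isOpen_ball.measurableSet).mpr
      (integrableOn_const measure_ball_lt_top.ne (by simp))
  have h1 : Integrable fun z : ℂ => k ‖z‖ * (z / (z - (v - w))) := by
    have := integrableOn_div_sub 0 (v - w) 0 r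
    rw [← integrable_indicator_iff Metric.isOpen_ball.measurableSet] at this
    refine this.congr (ae_of_all _ fun z => ?_)
    simp [hkz, Set.indicator]
  have h := integral_radial_mul_div_sub hk (v - w) h1 h2
  rw [← integral_sub_right_eq_self _ w] at h
  rw [← integral_indicator Metric.isOpen_ball.measurableSet]
  have e : ∀ z : ℂ, (Metric.ball w r).indicator (fun z => (z - w) / (z - v)) z
      = k ‖z - w‖ * ((z - w) / (z - w - (v - w))) := by
    intro z
    simp [hkz, Set.indicator, dist_eq_norm]
  simp_rw [e, h, hkz]
  rw [setIntegral_indicator Metric.isOpen_ball.measurableSet]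
  have hset : {z : ℂ | ‖v - w‖ < ‖z‖} ∩ Metric.ball 0 r
      = Metric.ball 0 r \ Metric.closedBall 0 ‖v - w‖ := by
    ext z; simp [and_comm]
  rw [hset]
  simp only [Pi.one_apply, integral_const, MeasurableSet.univ, measureReal_restrict_apply,
    Set.univ_inter, Complex.real_smul, mul_one, Complex.ofReal_inj]
  rcases le_or_gt r ‖v - w‖ with hle | hlt
  · have : Metric.ball (0 : ℂ) r \ Metric.closedBall 0 ‖v - w‖ = ∅ := by
      ext z; simp; intro hz; linarith
    rw [this, max_eq_right (by nlinarith [norm_nonneg (v - w)])]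
    simp
  · rw [measureReal_sdiff (Metric.closedBall_subset_ball hlt) Metric.isClosed_closedBall.measurableSet
      measure_ball_lt_top.ne, volume_real_ball_complex _ hr, volume_real_closedBall_complex _ (norm_nonneg _),
      max_eq_left (by nlinarith [norm_nonneg (v - w)])]
    ring

/-- The Cauchy transform of the uniform distribution on the unit disc. -/
theorem setIntegral_unitDisc_div_sub (z : ℂ) :
    ∫ v in Metric.closedBall (0 : ℂ) 1, z / (z - v) = (Real.pi * min (‖z‖ ^ 2) 1 : ℝ) := by
  set k : ℝ → ℂ := (Set.Iic 1).indicator 1 with hkdef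
  have hk : Measurable k := measurable_one.indicator measurableSet_Iic
  have hkz : ∀ z : ℂ, k ‖z‖ = (Metric.closedBall (0 : ℂ) 1).indicator 1 z := by
    intro z; simp [hkdef, Set.indicator]
  have hB := (Metric.isClosed_closedBall (x := (0 : ℂ)) (ε := 1)).measurableSet
  have h2 : Integrable fun z : ℂ => k ‖z‖ := by
    simp_rw [hkz]
    exact (integrable_indicator_iff hB).mpr (integrableOn_const measure_closedBall_lt_top.ne (by simp))
  have h1 : Integrable fun v : ℂ => k ‖v‖ * (v / (v - z)) := by
    have := (integrableOn_div_sub 0 z 0 2).mono_set (Metric.closedBall_subset_ball (one_lt_two))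
    rw [← integrable_indicator_iff hB] at this
    refine this.congr (ae_of_all _ fun v => ?_)
    simp [hkz, Set.indicator]
  have h := integral_radial_mul_div_sub' hk z h1 h2
  rw [← integral_indicator hB]
  have e : ∀ v : ℂ, (Metric.closedBall 0 1).indicator (fun v => z / (z - v)) v
      = k ‖v‖ * (z / (z - v)) := by
    intro z
    simp [hkz, Set.indicator]
  simp_rw [e, h, hkz]
  rw [setIntegral_indicator hB]
  have hset : {v : ℂ | ‖v‖ ≤ ‖z‖} ∩ Metric.closedBall 0 1 = Metric.closedBall 0 (min ‖z‖ 1) := by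
    ext z; simp
  rw [hset]
  simp only [Pi.one_apply, integral_const, MeasurableSet.univ, measureReal_restrict_apply,
    Set.univ_inter, Complex.real_smul, mul_one, Complex.ofReal_inj]
  rw [volume_real_closedBall_complex _ (by positivity)]
  congr 1
  rcases le_total ‖z‖ 1 with hz | hz
  · rw [min_eq_left hz, min_eq_left (by nlinarith [norm_nonneg z])]
  · rw [min_eq_right hz, min_eq_right (by nlinarith [norm_nonneg z]), one_pow]

/-! ### The standard complex Gaussian distribution -/

/-- The standard complex Gaussian distribution, with density `π⁻¹ exp (-|z|²)`. -/
noncomputable def stdComplexGaussian : Measure ℂ :=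
  volume.withDensity fun z => ENNReal.ofReal (Real.pi⁻¹ * Real.exp (-‖z‖ ^ 2))

theorem measurable_stdComplexGaussian_density :
    Measurable fun z : ℂ => ENNReal.ofReal (Real.pi⁻¹ * Real.exp (-‖z‖ ^ 2)) := by fun_prop

theorem integrable_exp_neg_norm_sq : Integrable fun z : ℂ => Real.exp (-‖z‖ ^ 2) := by
  simpa using integrable_exp_neg_mul_norm_sq one_pos

theorem integral_exp_neg_norm_sq : ∫ z : ℂ, Real.exp (-‖z‖ ^ 2) = Real.pi := by
  simpa using integral_exp_neg_mul_norm_sq one_pos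

instance : IsProbabilityMeasure stdComplexGaussian := by
  constructor
  rw [stdComplexGaussian, withDensity_apply _ MeasurableSet.univ, Measure.restrict_univ,
    ← ofReal_integral_eq_lintegral_ofReal (integrable_exp_neg_norm_sq.const_mul _)
      (ae_of_all _ fun z => by positivity), integral_const_mul, integral_exp_neg_norm_sq,
    inv_mul_cancel₀ Real.pi_ne_zero, ENNReal.ofReal_one]

theorem integral_stdComplexGaussian {E : Type*} [NormedAddCommGroup E] [NormedSpace ℝ E]
    (f : ℂ → E) :
    ∫ z, f z ∂stdComplexGaussian = ∫ z, (Real.pi⁻¹ * Real.exp (-‖z‖ ^ 2)) • f z := by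
  rw [stdComplexGaussian, integral_withDensity_eq_integral_toReal_smul
    measurable_stdComplexGaussian_density (by simp)]
  refine integral_congr_ae (ae_of_all _ fun z => ?_)
  simp only
  rw [ENNReal.toReal_ofReal (by positivity)]

theorem stdComplexGaussian_le_volume : stdComplexGaussian ≤ volume := by
  refine (withDensity_mono (ae_of_all _ fun g => ?_)).trans_eq withDensity_one
  rw [Pi.one_apply, ← ENNReal.ofReal_one]
  refine ENNReal.ofReal_le_ofReal (mul_le_one₀ (inv_le_one_of_one_le₀ ?_) (Real.exp_pos _).le ?_)
  · linarith [Real.pi_gt_three]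
  · exact Real.exp_le_one_iff.mpr (by nlinarith [sq_nonneg ‖g‖])

/-- 1/|u| is at most 1 plus its restriction to the unit disc, and the Gaussian is dominated by
Lebesgue measure, so translating by z does not affect the bound. The uniformity in z is what later
justifies every use of Fubini for the resolvent. -/
theorem exists_lintegral_enorm_inv_sub_le :
    ∃ C : ℝ≥0∞, C ≠ ∞ ∧ ∀ z : ℂ, ∫⁻ g, ‖(z - g)⁻¹‖ₑ ∂stdComplexGaussian ≤ C := by
  refine ⟨1 + ∫⁻ u : ℂ in Metric.closedBall 0 1, ‖u⁻¹‖ₑ, ?_, fun z => ?_⟩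
  · refine ENNReal.add_ne_top.mpr ⟨ENNReal.one_ne_top, ?_⟩
    exact (locallyIntegrable_inv.integrableOn_isCompact (isCompact_closedBall (0 : ℂ) 1)).2.ne
  have hB := (Metric.isClosed_closedBall (x := (0 : ℂ)) (ε := 1)).measurableSet
  set F : ℂ → ℝ≥0∞ := (Metric.closedBall 0 1).indicator fun u => ‖u⁻¹‖ₑ with hF
  have hFm : Measurable F := (by fun_prop : Measurable fun u : ℂ => ‖u⁻¹‖ₑ).indicator hB
  have hb : ∀ u : ℂ, ‖u⁻¹‖ₑ ≤ 1 + F u := by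
    intro u
    by_cases hu : u ∈ Metric.closedBall (0 : ℂ) 1
    · rw [hF, Set.indicator_of_mem hu]; exact le_add_self
    · refine le_trans ?_ le_self_add
      rw [mem_closedBall_zero_iff, not_le] at hu
      rw [← ofReal_norm, norm_inv, ← ENNReal.ofReal_one]
      exact ENNReal.ofReal_le_ofReal (inv_le_one_of_one_le₀ hu.le)
  calc ∫⁻ g, ‖(z - g)⁻¹‖ₑ ∂stdComplexGaussian
      ≤ ∫⁻ g, (1 + F (z - g)) ∂stdComplexGaussian := lintegral_mono fun g => hb _
    _ = 1 + ∫⁻ g, F (z - g) ∂stdComplexGaussian := by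
        rw [lintegral_add_left measurable_const]; simp
    _ ≤ 1 + ∫⁻ g, F (z - g) := by
        gcongr
        exact stdComplexGaussian_le_volume
    _ = 1 + ∫⁻ u, F u := by rw [lintegral_sub_left_eq_self F z]
    _ = _ := by rw [hF, lintegral_indicator hB]

theorem integrable_inv_sub_stdComplexGaussian (z : ℂ) :
    Integrable (fun g => (z - g)⁻¹) stdComplexGaussian := by
  obtain ⟨C, hC, h⟩ := exists_lintegral_enorm_inv_sub_le
  exact ⟨by fun_prop, (h z).trans_lt hC.lt_top⟩

theorem setIntegral_norm_le_exp_neg_norm_sq {R : ℝ} (hR : 0 ≤ R) :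
    ∫ v : ℂ in {v | ‖v‖ ≤ R}, Real.exp (-‖v‖ ^ 2) = Real.pi * (1 - Real.exp (-R ^ 2)) := by
  have hS : MeasurableSet {v : ℂ | ‖v‖ ≤ R} := measurableSet_le measurable_norm measurable_const
  have e : ∀ v : ℂ, {v : ℂ | ‖v‖ ≤ R}.indicator (fun v => Real.exp (-‖v‖ ^ 2)) v
      = (Set.Iic R).indicator (fun r => Real.exp (-r ^ 2)) ‖v‖ := by
    intro v; simp [Set.indicator]
  rw [← integral_indicator hS]
  simp_rw [e]
  rw [integral_fun_norm_addHaar volume ((Set.Iic R).indicator fun r => Real.exp (-r ^ 2)),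
    volume_real_ball_complex _ zero_le_one]
  have e2 : ∫ y in Set.Ioi (0 : ℝ), y ^ (Module.finrank ℝ ℂ - 1) •
      (Set.Iic R).indicator (fun r => Real.exp (-r ^ 2)) y
      = ∫ y in (0 : ℝ)..R, y * Real.exp (-y ^ 2) := by
    have e3 : ∀ y : ℝ, y ^ (Module.finrank ℝ ℂ - 1) •
        (Set.Iic R).indicator (fun r => Real.exp (-r ^ 2)) y
        = (Set.Iic R).indicator (fun y => y * Real.exp (-y ^ 2)) y := by
      intro y; simp [Set.indicator]
    simp_rw [e3]
    rw [setIntegral_indicator measurableSet_Iic, Set.Ioi_inter_Iic,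
      intervalIntegral.integral_of_le hR]
  have hd : ∀ y ∈ Set.uIcc 0 R, HasDerivAt (fun y => -(Real.exp (-y ^ 2)) / 2)
      (y * Real.exp (-y ^ 2)) y := by
    intro y _
    have h : HasDerivAt (fun y : ℝ => Real.exp (-y ^ 2))
        (Real.exp (-y ^ 2) * (-(2 * y))) y := by
      simpa using ((hasDerivAt_pow 2 y).neg).exp
    exact (h.neg.div_const 2).congr_deriv (by ring)
  rw [e2, intervalIntegral.integral_eq_sub_of_hasDerivAt hd
    (Continuous.intervalIntegrable (by fun_prop) _ _)]
  simp
  ring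

/-- Only the Gaussian mass of the disc of radius |z| contributes. -/
theorem integral_div_sub_stdComplexGaussian (z : ℂ) :
    ∫ g, z / (z - g) ∂stdComplexGaussian = (1 - Real.exp (-‖z‖ ^ 2) : ℝ) := by
  set k : ℝ → ℂ := fun r => ((Real.pi⁻¹ * Real.exp (-r ^ 2) : ℝ) : ℂ) with hk
  have h2 : Integrable fun v : ℂ => k ‖v‖ := (integrable_exp_neg_norm_sq.const_mul _).ofReal
  have h0 := integrable_inv_sub_stdComplexGaussian z
  rw [stdComplexGaussian, integrable_withDensity_iff_integrable_smul'
    measurable_stdComplexGaussian_density (by simp)] at h0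
  have h1 : Integrable fun v : ℂ => k ‖v‖ * (v / (v - z)) := by
    have h3 := h2.sub (h0.const_mul z)
    refine h3.congr ?_
    filter_upwards [ae_ne_complex z] with v hv
    have h3 : v - z ≠ 0 := sub_ne_zero.mpr hv
    have h4 : z - v ≠ 0 := sub_ne_zero.mpr hv.symm
    rw [Pi.sub_apply, ENNReal.toReal_ofReal (by positivity), Complex.real_smul]
    simp only [hk]
    field_simp
    ring
  rw [integral_stdComplexGaussian]
  have h := integral_radial_mul_div_sub' (k := k) (by fun_prop) z h1 h2
  simp only [hk] at h
  simp_rw [Complex.real_smul]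
  rw [h, integral_complex_ofReal, integral_const_mul,
    setIntegral_norm_le_exp_neg_norm_sq (norm_nonneg z)]
  congr 1
  field_simp

/-! ### Second moments of determinants of matrices with independent entries -/

theorem prod_prod_ite_perm_eq {n : ℕ} {R : Type*} [CommMonoid R] (σ : Equiv.Perm (Fin n))
    (f : Fin n → Fin n → R) :
    ∏ r, ∏ c, (if r = σ c then f r c else 1) = ∏ c, f (σ c) c := by
  rw [Finset.prod_comm]
  simp

/-- The factor in the `(r, c)` entry of the `(σ, τ)` term of `|det B|²`. -/
noncomputable def detTermFactor {n : ℕ} (w : Fin n → Fin n → ℂ → ℝ) (σ τ : Equiv.Perm (Fin n))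
    (r c : Fin n) (b : ℂ) : ℂ :=
  (if r = σ c then b else 1) * (if r = τ c then starRingEnd ℂ b else 1) * (w r c b : ℂ)

/-- The Leibniz formula for det B and for its conjugate; each (σ, τ) term is a product of functions
of single entries, so it integrates factor by factor. -/
theorem ofReal_normSq_det_mul_eq_sum {n : ℕ} (w : Fin n → Fin n → ℂ → ℝ)
    (B : Fin n → Fin n → ℂ) :
    ((‖(Matrix.of B).det‖ ^ 2 * ∏ r, ∏ c, w r c (B r c) : ℝ) : ℂ) =
      ∑ σ : Equiv.Perm (Fin n), ∑ τ : Equiv.Perm (Fin n),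
        ((Equiv.Perm.sign σ : ℤ) : ℂ) * ((Equiv.Perm.sign τ : ℤ) : ℂ) *
          ∏ r, ∏ c, detTermFactor w σ τ r c (B r c) := by
  have h1 : ((‖(Matrix.of B).det‖ ^ 2 : ℝ) : ℂ)
      = (Matrix.of B).det * starRingEnd ℂ (Matrix.of B).det := by
    rw [Complex.mul_conj, Complex.normSq_eq_norm_sq]
  rw [Complex.ofReal_mul, h1, Matrix.det_apply', map_sum, Finset.sum_mul_sum, Finset.sum_mul]
  refine Finset.sum_congr rfl fun σ _ => ?_
  rw [Finset.sum_mul]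
  refine Finset.sum_congr rfl fun τ _ => ?_
  simp only [detTermFactor, Finset.prod_mul_distrib]
  rw [prod_prod_ite_perm_eq σ, prod_prod_ite_perm_eq τ fun r c => starRingEnd ℂ (B r c)]
  simp only [Matrix.of_apply, map_mul, map_prod, map_intCast]
  push_cast
  ring

section

variable {n : ℕ} {w : Fin n → Fin n → ℂ → ℝ}

theorem integrable_detTermFactor
    (h0 : ∀ r c, Integrable (w r c)) (h1 : ∀ r c, Integrable fun z => z * (w r c z : ℂ))
    (h2 : ∀ r c, Integrable fun z => ‖z‖ ^ 2 * w r c z) (σ τ : Equiv.Perm (Fin n)) (r c : Fin n) :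
    Integrable (detTermFactor w σ τ r c) := by
  unfold detTermFactor
  split_ifs
  · refine (h2 r c).ofReal (𝕜 := ℂ) |>.congr (ae_of_all _ fun z => ?_)
    simp [Complex.mul_conj, Complex.normSq_eq_norm_sq]
  · simpa using h1 r c
  · have : Integrable fun z => starRingEnd ℂ (z * (w r c z : ℂ)) :=
      (Complex.conjCLE.toContinuousLinearMap.integrable_comp (h1 r c))
    simpa using this
  · simpa using (h0 r c).ofReal (𝕜 := ℂ)

/-- In a column c where σ and τ differ, the entries (σ c, c) and (τ c, c) are distinct, so at least
one is off the diagonal. That entry occurs only once, plain or conjugated, and has mean zero. -/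
theorem integral_prod_detTermFactor_eq_zero
    (hz : ∀ r c, r ≠ c → ∫ z, z * (w r c z : ℂ) = 0) {σ τ : Equiv.Perm (Fin n)} (h : σ ≠ τ) :
    ∏ r, ∏ c, ∫ b, detTermFactor w σ τ r c b = 0 := by
  obtain ⟨c, hc⟩ := Equiv.ext_iff.not.mp h |> not_forall.mp
  by_cases hs : σ c = c
  · refine Finset.prod_eq_zero (Finset.mem_univ (τ c)) (Finset.prod_eq_zero (Finset.mem_univ c) ?_)
    have ht : τ c ≠ c := fun h => hc (hs.trans h.symm)
    simp only [detTermFactor, if_neg (Ne.symm hc), if_true, one_mul]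
    have : ∀ b, starRingEnd ℂ b * (w (τ c) c b : ℂ) = starRingEnd ℂ (b * (w (τ c) c b : ℂ)) := by
      simp
    simp_rw [this]
    rw [integral_conj, hz _ _ ht, map_zero]
  · refine Finset.prod_eq_zero (Finset.mem_univ (σ c)) (Finset.prod_eq_zero (Finset.mem_univ c) ?_)
    simp only [detTermFactor, if_neg hc, if_true, mul_one]
    exact hz _ _ hs

theorem integral_prod_detTermFactor_self (σ : Equiv.Perm (Fin n)) :
    ∏ r, ∏ c, ∫ b, detTermFactor w σ σ r c b =
      ((∏ r, ∏ c, if r = σ c then ∫ z, ‖z‖ ^ 2 * w r c z else ∫ z, w r c z : ℝ) : ℂ) := by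
  push_cast
  refine Finset.prod_congr rfl fun r _ => Finset.prod_congr rfl fun c _ => ?_
  simp only [detTermFactor]
  split_ifs
  · rw [← integral_complex_ofReal]
    congr 1; ext b
    simp [Complex.mul_conj, Complex.normSq_eq_norm_sq]
  · simp only [one_mul]
    exact integral_complex_ofReal

/-- Only the terms σ = τ survive and their signs square to 1, which leaves a permanent of second
moments. Means on the diagonal are allowed because two different permutations still differ at an
off-diagonal entry. -/
theorem integral_normSq_det_mul
    (h0 : ∀ r c, Integrable (w r c)) (h1 : ∀ r c, Integrable fun z => z * (w r c z : ℂ))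
    (h2 : ∀ r c, Integrable fun z => ‖z‖ ^ 2 * w r c z)
    (hz : ∀ r c, r ≠ c → ∫ z, z * (w r c z : ℂ) = 0) :
    Integrable (fun B : Fin n → Fin n → ℂ => ‖(Matrix.of B).det‖ ^ 2 * ∏ r, ∏ c, w r c (B r c)) ∧
    ∫ B : Fin n → Fin n → ℂ, ‖(Matrix.of B).det‖ ^ 2 * ∏ r, ∏ c, w r c (B r c) =
      ∑ σ : Equiv.Perm (Fin n),
        ∏ r, ∏ c, if r = σ c then ∫ z, ‖z‖ ^ 2 * w r c z else ∫ z, w r c z := by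
  have hint : ∀ σ τ : Equiv.Perm (Fin n), Integrable fun B : Fin n → Fin n → ℂ =>
      ((Equiv.Perm.sign σ : ℤ) : ℂ) * ((Equiv.Perm.sign τ : ℤ) : ℂ) *
          ∏ r, ∏ c, detTermFactor w σ τ r c (B r c) := by
    intro σ τ
    refine Integrable.const_mul ?_ _
    exact Integrable.fintype_prod_dep (f := fun r (x : Fin n → ℂ) =>
      ∏ c, detTermFactor w σ τ r c (x c)) fun r =>
        Integrable.fintype_prod_dep fun c => integrable_detTermFactor h0 h1 h2 σ τ r c
  have hI : Integrable fun B : Fin n → Fin n → ℂ =>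
      ((‖(Matrix.of B).det‖ ^ 2 * ∏ r, ∏ c, w r c (B r c) : ℝ) : ℂ) := by
    simp_rw [ofReal_normSq_det_mul_eq_sum]
    exact integrable_finsetSum _ fun σ _ => integrable_finsetSum _ fun τ _ => hint σ τ
  refine ⟨hI.re.congr (ae_of_all _ fun B => Complex.ofReal_re _), ?_⟩
  rw [← Complex.ofReal_inj, ← integral_complex_ofReal]
  simp_rw [ofReal_normSq_det_mul_eq_sum]
  rw [integral_finsetSum _ fun σ _ => integrable_finsetSum _ fun τ _ => hint σ τ,
    Complex.ofReal_sum]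
  refine Finset.sum_congr rfl fun σ _ => ?_
  rw [integral_finsetSum _ fun τ _ => hint σ τ]
  have key : ∀ τ : Equiv.Perm (Fin n), ∫ B : Fin n → Fin n → ℂ,
      ∏ r, ∏ c, detTermFactor w σ τ r c (B r c) = ∏ r, ∏ c, ∫ b, detTermFactor w σ τ r c b := by
    intro τ
    rw [integral_fintype_prod_volume_eq_prod fun r (x : Fin n → ℂ) =>
      ∏ c, detTermFactor w σ τ r c (x c)]
    exact Finset.prod_congr rfl fun r _ => integral_fintype_prod_volume_eq_prod _
  simp_rw [integral_const_mul, key]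
  rw [Finset.sum_eq_single σ]
  · rw [integral_prod_detTermFactor_self, ← Int.cast_mul, ← Units.val_mul, Int.units_mul_self]
    simp
  · intro τ _ hne
    rw [integral_prod_detTermFactor_eq_zero hz hne.symm, mul_zero]
  · simp

end

theorem integral_normSq_det_mul_gaussWeight {n : ℕ} {a : Fin n → ℝ} (ha : ∀ c, 0 < a c)
    (m : Fin n → ℂ) :
    Integrable (fun B : Fin n → Fin n → ℂ => ‖(Matrix.of B).det‖ ^ 2 *
      ∏ r, ∏ c, gaussWeight (a c) (if r = c then m c else 0) (B r c)) ∧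
    ∫ B : Fin n → Fin n → ℂ, ‖(Matrix.of B).det‖ ^ 2 *
      ∏ r, ∏ c, gaussWeight (a c) (if r = c then m c else 0) (B r c) =
      (∏ c, Real.pi / a c) ^ n * ∑ σ : Equiv.Perm (Fin n),
        ∏ c, (1 / a c + if σ c = c then ‖m c‖ ^ 2 else 0) := by
  have h := integral_normSq_det_mul
    (w := fun r c => gaussWeight (a c) (if r = c then m c else 0))
    (fun r c => integrable_gaussWeight (ha c) _) (fun r c => integrable_mul_gaussWeight (ha c) _)
    (fun r c => integrable_normSq_mul_gaussWeight (ha c) _)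
    (fun r c hrc => by rw [integral_mul_gaussWeight (ha c), if_neg hrc, zero_mul])
  refine ⟨h.1, h.2.trans ?_⟩
  rw [Finset.mul_sum]
  refine Finset.sum_congr rfl fun σ _ => ?_
  have e : ∀ r c : Fin n, (if r = σ c then
        ∫ z, ‖z‖ ^ 2 * gaussWeight (a c) (if r = c then m c else 0) z
        else ∫ z, gaussWeight (a c) (if r = c then m c else 0) z) =
      Real.pi / a c * (if r = σ c then (1 / a c + if r = c then ‖m c‖ ^ 2 else 0) else 1) := by
    intro r c
    rw [integral_gaussWeight (ha c), integral_normSq_mul_gaussWeight (ha c)]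
    split_ifs <;> simp
  simp_rw [e, Finset.prod_mul_distrib]
  rw [Finset.prod_const, Finset.card_univ, Fintype.card_fin,
    prod_prod_ite_perm_eq σ fun r c => (1 / a c + if r = c then ‖m c‖ ^ 2 else 0)]

/-- A permutation fixing S pointwise is a permutation of the complement of S. -/
theorem card_perm_fixing {n : ℕ} (S : Finset (Fin n)) :
    Fintype.card {σ : Equiv.Perm (Fin n) // ∀ c ∈ S, σ c = c} = (n - S.card).factorial := by
  have e := Equiv.Perm.subtypeEquivSubtypePerm fun c : Fin n => c ∉ S
  have h := Fintype.card_congr e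
  rw [Fintype.card_perm, Fintype.card_subtype_compl, Fintype.card_fin, Fintype.card_coe] at h
  rw [h]
  exact Fintype.card_congr (Equiv.subtypeEquivRight
    (p := fun σ : Equiv.Perm (Fin n) => ∀ c ∈ S, σ c = c)
    (q := fun σ : Equiv.Perm (Fin n) => ∀ c, ¬ c ∉ S → σ c = c) fun σ => by simp)

/-- The permanent of `1 1ᵀ + diag y`. -/
theorem sum_perm_prod_one_add_ite {n : ℕ} (y : Fin n → ℝ) :
    ∑ σ : Equiv.Perm (Fin n), ∏ c, (1 + if σ c = c then y c else 0) =
      ∑ S : Finset (Fin n), (∏ c ∈ S, y c) * ((n - S.card).factorial : ℝ) := by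
  have e : ∀ σ : Equiv.Perm (Fin n), ∏ c, (1 + if σ c = c then y c else 0)
      = ∑ S : Finset (Fin n), if ∀ c ∈ S, σ c = c then ∏ c ∈ S, y c else 0 := by
    intro σ
    -- S is the set of columns from which the diagonal contribution is chosen; σ contributes only if
    -- it fixes all of S.
    rw [Finset.prod_one_add, Finset.powerset_univ]
    refine Finset.sum_congr rfl fun S _ => ?_
    convert Finset.prod_ite_zero (s := S) (p := fun c => σ c = c) (f := y)
  simp_rw [e]
  rw [Finset.sum_comm]
  refine Finset.sum_congr rfl fun S _ => ?_
  rw [← Finset.sum_filter, Finset.sum_const, nsmul_eq_mul, ← card_perm_fixing,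
    Fintype.card_subtype, mul_comm]

/-! ### Gaussian vectors and matrices -/

/-- The law of a vector of independent standard complex Gaussians. -/
noncomputable def gaussianVec (n : ℕ) : Measure (Fin n → ℂ) :=
  Measure.pi fun _ => stdComplexGaussian

/-- The law of a matrix of independent standard complex Gaussians. -/
noncomputable def gaussianMat (m n : ℕ) : Measure (Fin m → Fin n → ℂ) :=
  Measure.pi fun _ => gaussianVec n

instance (n : ℕ) : IsProbabilityMeasure (gaussianVec n) := by
  unfold gaussianVec; infer_instance

instance (m n : ℕ) : IsProbabilityMeasure (gaussianMat m n) := by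
  unfold gaussianMat; infer_instance

theorem measurable_gaussianVec_density (n : ℕ) : Measurable fun x : Fin n → ℂ =>
    ENNReal.ofReal (Real.pi⁻¹ ^ n * Real.exp (-∑ i, ‖x i‖ ^ 2)) := by fun_prop

theorem gaussianVec_eq_withDensity (n : ℕ) :
    gaussianVec n = volume.withDensity fun x : Fin n → ℂ =>
      ENNReal.ofReal (Real.pi⁻¹ ^ n * Real.exp (-∑ i, ‖x i‖ ^ 2)) := by
  unfold gaussianVec stdComplexGaussian
  have : IsProbabilityMeasure (volume.withDensity fun z : ℂ =>
      ENNReal.ofReal (Real.pi⁻¹ * Real.exp (-‖z‖ ^ 2))) :=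
    inferInstanceAs (IsProbabilityMeasure stdComplexGaussian)
  rw [pi_withDensity_eq _ _ fun _ => measurable_stdComplexGaussian_density]
  congr 1
  ext x
  rw [← ENNReal.ofReal_prod_of_nonneg fun i _ => by positivity, Finset.prod_mul_distrib,
    Finset.prod_const, ← Real.exp_sum, Finset.sum_neg_distrib]
  simp

theorem measurable_gaussianMat_density (m n : ℕ) : Measurable fun x : Fin m → Fin n → ℂ =>
    ENNReal.ofReal (Real.pi⁻¹ ^ (n * m) * Real.exp (-∑ i, ∑ j, ‖x i j‖ ^ 2)) := by fun_prop

theorem gaussianMat_eq_withDensity (m n : ℕ) :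
    gaussianMat m n = volume.withDensity fun x : Fin m → Fin n → ℂ =>
      ENNReal.ofReal (Real.pi⁻¹ ^ (n * m) * Real.exp (-∑ i, ∑ j, ‖x i j‖ ^ 2)) := by
  unfold gaussianMat
  have h : IsProbabilityMeasure (volume.withDensity fun x : Fin n → ℂ =>
      ENNReal.ofReal (Real.pi⁻¹ ^ n * Real.exp (-∑ i, ‖x i‖ ^ 2))) := by
    rw [← gaussianVec_eq_withDensity]; infer_instance
  simp_rw [gaussianVec_eq_withDensity]
  rw [pi_withDensity_eq _ _ fun _ => measurable_gaussianVec_density n]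
  congr 1
  ext x
  rw [← ENNReal.ofReal_prod_of_nonneg fun i _ => by positivity, Finset.prod_mul_distrib,
    Finset.prod_const, ← Real.exp_sum, Finset.sum_neg_distrib, ← pow_mul]
  simp

theorem ginibreMeasure_eq_gaussianMat (n : ℕ) :
    ginibreMeasure n = (gaussianMat n n).map fun a => Matrix.of a := by
  unfold ginibreMeasure
  rw [gaussianMat_eq_withDensity]
  congr 2
  ext x
  rw [← sq, inv_pow, one_div]

/-! ### Invariance -/

instance isAddHaarMeasure_volume_pi_pi (m n : ℕ) :
    (volume : Measure (Fin m → Fin n → ℂ)).IsAddHaarMeasure :=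
  Measure.pi.isAddHaarMeasure _

/-- A linear map scales Haar measure by a constant. A single L-invariant function with finite
nonzero integral forces the constant to be 1; Gaussian densities play this role below, so no
determinant has to be computed. -/
theorem measurePreserving_of_comp_eq {E : Type*} [NormedAddCommGroup E] [NormedSpace ℝ E]
    [MeasurableSpace E] [BorelSpace E] [FiniteDimensional ℝ E] (μ : Measure E) [μ.IsAddHaarMeasure]
    (L : E ≃ₗ[ℝ] E) {φ : E → ℝ≥0∞} (hφ : Measurable φ) (h0 : ∫⁻ x, φ x ∂μ ≠ 0)
    (ht : ∫⁻ x, φ x ∂μ ≠ ∞) (h : ∀ x, φ (L x) = φ x) : MeasurePreserving L μ μ := by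
  have hL : Measurable L := L.toContinuousLinearEquiv.continuous.measurable
  refine ⟨hL, ?_⟩
  have hd : LinearMap.det (L : E →ₗ[ℝ] E) ≠ 0 := L.isUnit_det'.ne_zero
  have h1 := Measure.map_linearMap_addHaar_eq_smul_addHaar μ hd
  have h2 : ∫⁻ x, φ x ∂(μ.map L) = ∫⁻ x, φ x ∂μ := by
    rw [lintegral_map hφ hL]
    simp_rw [h]
  have h1' : μ.map L = ENNReal.ofReal |(LinearMap.det (L : E →ₗ[ℝ] E))⁻¹| • μ := h1
  rw [h1'] at h2 ⊢
  rw [lintegral_smul_measure, smul_eq_mul] at h2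
  have : ENNReal.ofReal |(LinearMap.det (L : E →ₗ[ℝ] E))⁻¹| = 1 := by
    conv_rhs at h2 => rw [← one_mul (∫⁻ x, φ x ∂μ)]
    exact (ENNReal.mul_left_inj h0 ht).mp h2
  rw [this, one_smul]

theorem measurePreserving_withDensity_of_comp_eq {E : Type*} [NormedAddCommGroup E]
    [NormedSpace ℝ E]
    [MeasurableSpace E] [BorelSpace E] [FiniteDimensional ℝ E] (μ : Measure E) [μ.IsAddHaarMeasure]
    (L : E ≃ₗ[ℝ] E) {φ : E → ℝ≥0∞} (hφ : Measurable φ) (h0 : ∫⁻ x, φ x ∂μ ≠ 0)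
    (ht : ∫⁻ x, φ x ∂μ ≠ ∞) (h : ∀ x, φ (L x) = φ x) :
    MeasurePreserving L (μ.withDensity φ) (μ.withDensity φ) := by
  have hL := measurePreserving_of_comp_eq μ L hφ h0 ht h
  refine ⟨hL.measurable, ?_⟩
  ext s hs
  rw [Measure.map_apply hL.measurable hs, withDensity_apply _ hs,
    withDensity_apply _ (hL.measurable hs), ← lintegral_indicator hs,
    ← lintegral_indicator (hL.measurable hs), ← hL.lintegral_comp (hφ.indicator hs)]
  refine lintegral_congr fun x => ?_
  by_cases hx : L x ∈ s
  · rw [Set.indicator_of_mem hx, Set.indicator_of_mem (by exact hx), h]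
  · rw [Set.indicator_of_notMem hx, Set.indicator_of_notMem (by exact hx)]

theorem lintegral_gaussianVec_density (n : ℕ) : ∫⁻ x : Fin n → ℂ,
    ENNReal.ofReal (Real.pi⁻¹ ^ n * Real.exp (-∑ i, ‖x i‖ ^ 2)) = 1 := by
  rw [← setLIntegral_univ, ← withDensity_apply _ MeasurableSet.univ, ← gaussianVec_eq_withDensity,
    measure_univ]

theorem lintegral_gaussianMat_density (m n : ℕ) : ∫⁻ x : Fin m → Fin n → ℂ,
    ENNReal.ofReal (Real.pi⁻¹ ^ (n * m) * Real.exp (-∑ i, ∑ j, ‖x i j‖ ^ 2)) = 1 := by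
  rw [← setLIntegral_univ, ← withDensity_apply _ MeasurableSet.univ, ← gaussianMat_eq_withDensity,
    measure_univ]

theorem measurePreserving_gaussianVec {n : ℕ} (L : (Fin n → ℂ) ≃ₗ[ℝ] (Fin n → ℂ))
    (h : ∀ x, ∑ i, ‖L x i‖ ^ 2 = ∑ i, ‖x i‖ ^ 2) :
    MeasurePreserving L (gaussianVec n) (gaussianVec n) := by
  rw [gaussianVec_eq_withDensity]
  exact measurePreserving_withDensity_of_comp_eq volume L (measurable_gaussianVec_density n)
    (by rw [lintegral_gaussianVec_density]; simp) (by rw [lintegral_gaussianVec_density]; simp)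
    fun x => by rw [h]

theorem measurePreserving_gaussianMat {m n : ℕ}
    (L : (Fin m → Fin n → ℂ) ≃ₗ[ℝ] (Fin m → Fin n → ℂ))
    (h : ∀ x, ∑ i, ∑ j, ‖L x i j‖ ^ 2 = ∑ i, ∑ j, ‖x i j‖ ^ 2) :
    MeasurePreserving L (gaussianMat m n) (gaussianMat m n) := by
  rw [gaussianMat_eq_withDensity]
  exact measurePreserving_withDensity_of_comp_eq volume L (measurable_gaussianMat_density m n)
    (by rw [lintegral_gaussianMat_density]; simp) (by rw [lintegral_gaussianMat_density]; simp)
    fun x => by rw [h]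

theorem measurePreserving_volume_of_sum_norm_sq_eq {m n : ℕ}
    (L : (Fin m → Fin n → ℂ) ≃ₗ[ℝ] (Fin m → Fin n → ℂ))
    (h : ∀ x, ∑ i, ∑ j, ‖L x i j‖ ^ 2 = ∑ i, ∑ j, ‖x i j‖ ^ 2) :
    MeasurePreserving L volume volume :=
  measurePreserving_of_comp_eq volume L (measurable_gaussianMat_density m n)
    (by rw [lintegral_gaussianMat_density]; simp) (by rw [lintegral_gaussianMat_density]; simp)
    fun x => by rw [h]

/-! ### Unitary matrices -/

theorem ofReal_sum_norm_sq_eq_dotProduct {n : ℕ} (x : Fin n → ℂ) :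
    ((∑ i, ‖x i‖ ^ 2 : ℝ) : ℂ) = star x ⬝ᵥ x := by
  simp only [dotProduct, Complex.ofReal_sum, Pi.star_apply, RCLike.star_def]
  refine Finset.sum_congr rfl fun i _ => ?_
  rw [← Complex.normSq_eq_norm_sq, Complex.normSq_eq_conj_mul_self]

theorem sum_norm_sq_mulVec_unitary {n : ℕ} {U : Matrix (Fin n) (Fin n) ℂ}
    (hU : U.conjTranspose * U = 1) (x : Fin n → ℂ) :
    ∑ i, ‖U.mulVec x i‖ ^ 2 = ∑ i, ‖x i‖ ^ 2 := by
  rw [← Complex.ofReal_inj, ofReal_sum_norm_sq_eq_dotProduct, ofReal_sum_norm_sq_eq_dotProduct,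
    Matrix.star_mulVec, Matrix.dotProduct_mulVec, Matrix.vecMul_vecMul, hU, Matrix.vecMul_one]

theorem ofReal_sum_norm_sq_eq_trace {n : ℕ} (M : Matrix (Fin n) (Fin n) ℂ) :
    ((∑ i, ∑ j, ‖M i j‖ ^ 2 : ℝ) : ℂ) = (M * M.conjTranspose).trace := by
  simp only [Matrix.trace, Matrix.diag, Matrix.mul_apply, Complex.ofReal_sum,
    Matrix.conjTranspose_apply, RCLike.star_def]
  refine Finset.sum_congr rfl fun i _ => Finset.sum_congr rfl fun j _ => ?_
  rw [← Complex.normSq_eq_norm_sq, Complex.mul_conj]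

theorem sum_norm_sq_conj_unitary {n : ℕ} {U : Matrix (Fin n) (Fin n) ℂ}
    (hU : U.conjTranspose * U = 1) (M : Matrix (Fin n) (Fin n) ℂ) :
    ∑ i, ∑ j, ‖(U.conjTranspose * M * U) i j‖ ^ 2 = ∑ i, ∑ j, ‖M i j‖ ^ 2 := by
  have hU' : U * U.conjTranspose = 1 := mul_eq_one_comm.mp hU
  rw [← Complex.ofReal_inj, ofReal_sum_norm_sq_eq_trace, ofReal_sum_norm_sq_eq_trace]
  have : U.conjTranspose * M * U * (U.conjTranspose * M * U).conjTranspose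
      = U.conjTranspose * (M * M.conjTranspose * U) := by
    simp only [Matrix.conjTranspose_mul, Matrix.conjTranspose_conjTranspose]
    calc _ = U.conjTranspose * M * (U * U.conjTranspose) * (M.conjTranspose * U) := by
          simp only [Matrix.mul_assoc]
      _ = _ := by rw [hU']; simp only [Matrix.mul_assoc, Matrix.mul_one]
  rw [this, Matrix.trace_mul_comm, Matrix.mul_assoc, hU', Matrix.mul_one]

/-- Every vector is mapped to a multiple of the first basis vector by a unitary matrix. -/
theorem exists_unitary_mulVec_eq {n : ℕ} (y : Fin (n + 1) → ℂ) :
    ∃ U : Matrix (Fin (n + 1)) (Fin (n + 1)) ℂ, U.conjTranspose * U = 1 ∧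
      U.mulVec y = Pi.single 0 ((Real.sqrt (∑ i, ‖y i‖ ^ 2) : ℝ) : ℂ) := by
  by_cases hy : y = 0
  · exact ⟨1, by simp, by simp [hy]⟩
  set Y : EuclideanSpace ℂ (Fin (n + 1)) := WithLp.toLp 2 y with hY
  have hYn : ‖Y‖ = Real.sqrt (∑ i, ‖y i‖ ^ 2) := EuclideanSpace.norm_eq Y
  have hY0 : ‖Y‖ ≠ 0 := by
    rw [norm_ne_zero_iff]
    intro h
    exact hy (by simpa [hY] using h)
  have hY0' : (‖Y‖ : ℂ) ≠ 0 := by exact_mod_cast hY0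
  -- Only index 0 of this constant family matters: y / |y| is extended to an orthonormal basis,
  -- whose conjugates form the rows of U.
  set v : Fin (n + 1) → EuclideanSpace ℂ (Fin (n + 1)) := fun _ => (‖Y‖ : ℂ)⁻¹ • Y with hv
  have hon : Orthonormal ℂ (({0} : Set (Fin (n + 1))).domRestrict v) := by
    refine ⟨fun i => ?_, fun i j hij => (hij (Subsingleton.elim _ _)).elim⟩
    simp [hv, norm_smul, hY0]
  obtain ⟨b, hb⟩ := hon.exists_orthonormalBasis_extension_of_card_eq (by simp)
  have hb0 : b 0 = (‖Y‖ : ℂ)⁻¹ • Y := hb 0 rfl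
  have hYb : Y = (‖Y‖ : ℂ) • b 0 := by rw [hb0, smul_smul, mul_inv_cancel₀ hY0', one_smul]
  have hin : ∀ i (u : EuclideanSpace ℂ (Fin (n + 1))),
      ∑ j, starRingEnd ℂ (b i j) * u j = inner ℂ (b i) u := by
    intro i u
    rw [PiLp.inner_apply]
    exact Finset.sum_congr rfl fun j _ => by rw [RCLike.inner_apply, mul_comm]
  refine ⟨Matrix.of fun i j => starRingEnd ℂ (b i j), ?_, ?_⟩
  · rw [mul_eq_one_comm]
    ext i k
    rw [Matrix.mul_apply]
    simp only [Matrix.of_apply, Matrix.conjTranspose_apply, RCLike.star_def, Complex.conj_conj]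
    rw [hin, orthonormal_iff_ite.mp b.orthonormal, Matrix.one_apply]
  · ext i
    have : (Matrix.of fun i j => starRingEnd ℂ (b i j)).mulVec y i = inner ℂ (b i) Y := by
      rw [← hin]; rfl
    rw [this, hYb, inner_smul_right, orthonormal_iff_ite.mp b.orthonormal, ← hYn]
    by_cases hi : i = 0
    · subst hi; simp
    · simp [hi]

/-! ### Null sets of singular matrices and linear changes of variables -/

theorem finite_setOf_det_smul_one_sub_eq_zero {n : ℕ} (M : Matrix (Fin n) (Fin n) ℂ) :
    {t : ℂ | (t • (1 : Matrix (Fin n) (Fin n) ℂ) - M).det = 0}.Finite := by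
  refine (M.charpoly.roots.toFinset.finite_toSet).subset fun t ht => ?_
  simp only [Finset.mem_coe, Multiset.mem_toFinset]
  rw [Polynomial.mem_roots M.charpoly_monic.ne_zero, Polynomial.IsRoot, Matrix.eval_charpoly,
    Matrix.scalar_apply, ← Matrix.smul_one_eq_diagonal]
  exact ht

theorem measurable_det_smul_one_sub {n : ℕ} :
    Continuous fun p : ℂ × (Fin n → Fin n → ℂ) =>
      (p.1 • (1 : Matrix (Fin n) (Fin n) ℂ) - Matrix.of p.2).det := by
  refine Continuous.matrix_det ?_
  refine (continuous_fst.smul continuous_const).sub ?_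
  exact continuous_snd

/-- Each D has finitely many eigenvalues, so by Fubini some t is an eigenvalue of almost no D.
Translating D by (t - z) times the identity carries t to the prescribed z. -/
theorem ae_det_smul_one_sub_ne_zero {n : ℕ} (z : ℂ) :
    ∀ᵐ D : Fin n → Fin n → ℂ, (z • (1 : Matrix (Fin n) (Fin n) ℂ) - Matrix.of D).det ≠ 0 := by
  set p : ℂ → (Fin n → Fin n → ℂ) → Prop := fun t D =>
    (t • (1 : Matrix (Fin n) (Fin n) ℂ) - Matrix.of D).det ≠ 0 with hp
  have hm : MeasurableSet {x : ℂ × (Fin n → Fin n → ℂ) | p x.1 x.2} :=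
    (measurable_det_smul_one_sub.measurable (measurableSet_singleton 0)).compl
  have h1 : ∀ᵐ D : Fin n → Fin n → ℂ, ∀ᵐ t : ℂ, p t D := by
    refine ae_of_all _ fun D => ?_
    have := (finite_setOf_det_smul_one_sub_eq_zero (Matrix.of D)).measure_zero volume
    rw [ae_iff]
    simpa [hp] using this
  rw [← Measure.ae_ae_comm hm] at h1
  obtain ⟨t, ht⟩ := h1.exists
  set v : Fin n → Fin n → ℂ := fun i j => ((t - z) • (1 : Matrix (Fin n) (Fin n) ℂ)) i j with hv
  have h2 := (measurePreserving_add_right volume v).quasiMeasurePreserving.ae ht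
  filter_upwards [h2] with D hD
  have : t • (1 : Matrix (Fin n) (Fin n) ℂ) - Matrix.of (D + v) = z • 1 - Matrix.of D := by
    ext i j
    simp [hv]
    ring
  rw [hp] at hD
  simp only [this] at hD
  exact hD

/-- The real Jacobian of a complex linear map is the squared modulus of its complex determinant. -/
theorem lintegral_comp_mulVec {n : ℕ} (M : Matrix (Fin n) (Fin n) ℂ) (hM : M.det ≠ 0)
    {F : (Fin n → ℂ) → ℝ≥0∞} (hF : Measurable F) :
    ∫⁻ c, F c = ∫⁻ y, ENNReal.ofReal (‖M.det‖ ^ 2) * F (M.mulVec y) := by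
  have hdet : LinearMap.det ((Matrix.toLin' M).restrictScalars ℝ) = ‖M.det‖ ^ 2 := by
    have := LinearMap.det_restrictScalars (R := ℝ) (f := Matrix.toLin' M)
    rw [this, LinearMap.det_toLin', Algebra.norm_complex_apply, Complex.normSq_eq_norm_sq]
  have hpos : 0 < ‖M.det‖ ^ 2 := by positivity
  have h := Measure.map_linearMap_addHaar_eq_smul_addHaar (volume : Measure (Fin n → ℂ))
    (f := (Matrix.toLin' M).restrictScalars ℝ) (by rw [hdet]; exact hpos.ne')
  have hmeas : Measurable ((Matrix.toLin' M).restrictScalars ℝ) :=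
    (LinearMap.continuous_of_finiteDimensional _).measurable
  have h2 : ∫⁻ y, F (M.mulVec y) = ENNReal.ofReal (‖M.det‖ ^ 2)⁻¹ * ∫⁻ c, F c := by
    rw [← smul_eq_mul, ← lintegral_smul_measure, ← abs_of_pos (inv_pos.mpr hpos), ← hdet, ← h,
      lintegral_map hF hmeas]
    rfl
  have h3 : Measurable fun y => F (M.mulVec y) := hF.comp hmeas
  rw [lintegral_const_mul _ h3, h2, ← mul_assoc, ← ENNReal.ofReal_mul hpos.le,
    mul_inv_cancel₀ hpos.ne', ENNReal.ofReal_one, one_mul]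

/-! ### Weighted second moments of the characteristic polynomial -/

/-- `π^(n²)` times the expectation of `|det (z - D)|² exp (-|(z - D) y|²)` for Ginibre `D`. -/
noncomputable def weightedDetMoment {n : ℕ} (z : ℂ) (y : Fin n → ℂ) : ℝ≥0∞ :=
  ∫⁻ D : Fin n → Fin n → ℂ, ENNReal.ofReal
    (‖(z • (1 : Matrix (Fin n) (Fin n) ℂ) - Matrix.of D).det‖ ^ 2 *
      Real.exp (-∑ i, ∑ j, ‖D i j‖ ^ 2) *
      Real.exp (-∑ i, ‖(z • (1 : Matrix (Fin n) (Fin n) ℂ) - Matrix.of D).mulVec y i‖ ^ 2))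

/-- Conjugation by a unitary matrix, as a real linear equivalence. -/
noncomputable def conjUnitaryEquiv {n : ℕ} (U : Matrix (Fin n) (Fin n) ℂ)
    (hU : U.conjTranspose * U = 1) : (Fin n → Fin n → ℂ) ≃ₗ[ℝ] (Fin n → Fin n → ℂ) where
  toFun D := U.conjTranspose * Matrix.of D * U
  invFun D := U * Matrix.of D * U.conjTranspose
  map_add' D E := by
    change U.conjTranspose * (Matrix.of D + Matrix.of E) * U = _
    rw [Matrix.mul_add, Matrix.add_mul]; rfl
  map_smul' r D := by
    change U.conjTranspose * (r • Matrix.of D) * U = _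
    rw [Matrix.mul_smul, Matrix.smul_mul]; rfl
  left_inv D := by
    have hU' : U * U.conjTranspose = 1 := mul_eq_one_comm.mp hU
    change U * (U.conjTranspose * Matrix.of D * U) * U.conjTranspose = _
    rw [Matrix.mul_assoc, Matrix.mul_assoc, Matrix.mul_assoc, hU', Matrix.mul_one,
      ← Matrix.mul_assoc, hU', Matrix.one_mul]
    rfl
  right_inv D := by
    change U.conjTranspose * (U * Matrix.of D * U.conjTranspose) * U = _
    rw [Matrix.mul_assoc, Matrix.mul_assoc, Matrix.mul_assoc, hU, Matrix.mul_one,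
      ← Matrix.mul_assoc, hU, Matrix.one_mul]
    rfl

/-- The substitution D ↦ U* D U preserves Lebesgue measure, the Gaussian weight and det (z - D), and
turns (z - D) y into U* (z - D) U y. -/
theorem weightedDetMoment_mulVec_unitary {n : ℕ} (z : ℂ) (y : Fin n → ℂ)
    (U : Matrix (Fin n) (Fin n) ℂ) (hU : U.conjTranspose * U = 1) :
    weightedDetMoment z (U.mulVec y) = weightedDetMoment z y := by
  have hU' : U * U.conjTranspose = 1 := mul_eq_one_comm.mp hU
  have hUU : (U.conjTranspose).conjTranspose * U.conjTranspose = 1 := by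
    rwa [Matrix.conjTranspose_conjTranspose]
  have hmp := measurePreserving_volume_of_sum_norm_sq_eq (conjUnitaryEquiv U hU)
    fun D => sum_norm_sq_conj_unitary hU (Matrix.of D)
  unfold weightedDetMoment
  have hmeas : Measurable fun D : Fin n → Fin n → ℂ => ENNReal.ofReal
    (‖(z • (1 : Matrix (Fin n) (Fin n) ℂ) - Matrix.of D).det‖ ^ 2 *
      Real.exp (-∑ i, ∑ j, ‖D i j‖ ^ 2) *
      Real.exp (-∑ i, ‖(z • (1 : Matrix (Fin n) (Fin n) ℂ) - Matrix.of D).mulVec y i‖ ^ 2)) := by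
    have h1 : Measurable fun D : Fin n → Fin n → ℂ =>
        (z • (1 : Matrix (Fin n) (Fin n) ℂ) - Matrix.of D).det :=
      measurable_det_smul_one_sub.measurable.comp (by fun_prop : Measurable fun D => (z, D))
    have h2 : Measurable fun D : Fin n → Fin n → ℂ =>
        (z • (1 : Matrix (Fin n) (Fin n) ℂ) - Matrix.of D).mulVec y := by
      refine Continuous.measurable ?_
      refine Continuous.matrix_mulVec ?_ continuous_const
      exact continuous_const.sub continuous_id
    fun_prop
  rw [← hmp.lintegral_comp hmeas]
  refine lintegral_congr fun D => ?_
  have hD : z • (1 : Matrix (Fin n) (Fin n) ℂ) - Matrix.of (conjUnitaryEquiv U hU D)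
      = U.conjTranspose * (z • 1 - Matrix.of D) * U := by
    change _ - U.conjTranspose * Matrix.of D * U = _
    rw [Matrix.mul_sub, Matrix.sub_mul, Matrix.mul_smul, Matrix.smul_mul, Matrix.mul_one, hU]
  have h1 : (U.conjTranspose * (z • 1 - Matrix.of D) * U).det
      = (z • 1 - Matrix.of D).det := by
    rw [Matrix.det_mul, Matrix.det_mul, mul_right_comm, ← Matrix.det_mul, hU, Matrix.det_one,
      one_mul]
  have h2 : ∑ i, ∑ j, ‖conjUnitaryEquiv U hU D i j‖ ^ 2 = ∑ i, ∑ j, ‖D i j‖ ^ 2 :=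
    sum_norm_sq_conj_unitary hU (Matrix.of D)
  have h3 : (U.conjTranspose * (z • 1 - Matrix.of D) * U).mulVec y
      = U.conjTranspose.mulVec ((z • 1 - Matrix.of D).mulVec (U.mulVec y)) := by
    simp only [Matrix.mulVec_mulVec, Matrix.mul_assoc]
  rw [hD, h1, h2, h3, sum_norm_sq_mulVec_unitary hUU]

instance isNegInvariant_volume_pi_pi (m n : ℕ) :
    (volume : Measure (Fin m → Fin n → ℂ)).IsNegInvariant :=
  Measure.pi.isNegInvariant _

theorem norm_sub_sq_add_mul_norm_sq {s : ℝ} (hs : 0 ≤ s) (z b : ℂ) :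
    ‖z - b‖ ^ 2 + s * ‖b‖ ^ 2 =
      (1 + s) * ‖b - z / ((1 + s : ℝ) : ℂ)‖ ^ 2 + ‖z‖ ^ 2 * s / (1 + s) := by
  have h : (1 + s) ≠ 0 := by positivity
  simp only [← Complex.normSq_eq_norm_sq, Complex.normSq_apply, Complex.sub_re, Complex.sub_im,
    Complex.div_ofReal_re, Complex.div_ofReal_im]
  field_simp
  ring

/-! ### Permanents with one distinguished diagonal entry -/

/-- The constant coefficient in the expansion of the permanent of `1 1ᵀ + diag (y, x, …, x)`. -/
noncomputable def permCoeffZero (n : ℕ) (x : ℝ) : ℝ :=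
  ∑ k ∈ Finset.range (n + 1), (n.choose k : ℝ) * (x ^ k * ((n + 1 - k).factorial : ℝ))

/-- The coefficient of `y` in the expansion of the permanent of `1 1ᵀ + diag (y, x, …, x)`. -/
noncomputable def permCoeffOne (n : ℕ) (x : ℝ) : ℝ :=
  ∑ k ∈ Finset.range (n + 1), (n.choose k : ℝ) * (x ^ k * ((n - k).factorial : ℝ))

theorem sum_perm_prod_one_add_ite_eq (n : ℕ) (x y : ℝ) :
    ∑ σ : Equiv.Perm (Fin (n + 1)), ∏ c, (1 + if σ c = c then (if c = 0 then y else x) else 0) =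
      permCoeffZero n x + permCoeffOne n x * y := by
  rw [sum_perm_prod_one_add_ite fun c => if c = 0 then y else x]
  have h0 : (Finset.univ : Finset (Finset (Fin (n + 1))))
      = (insert 0 ((Finset.univ : Finset (Fin (n + 1))).erase 0)).powerset := by
    rw [Finset.insert_erase (Finset.mem_univ _), Finset.powerset_univ]
  have hcard : ((Finset.univ : Finset (Fin (n + 1))).erase 0).card = n := by simp
  -- The subsets avoiding 0 give the constant coefficient, those containing 0 the coefficient of y.
  rw [h0, Finset.sum_powerset_insert (Finset.notMem_erase _ _)]
  have hprod : ∀ T ∈ ((Finset.univ : Finset (Fin (n + 1))).erase 0).powerset,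
      ∏ c ∈ T, (if c = 0 then y else x) = x ^ T.card := by
    intro T hT
    rw [← Finset.prod_const]
    refine Finset.prod_congr rfl fun c hc => if_neg ?_
    exact Finset.ne_of_mem_erase (Finset.mem_powerset.mp hT hc)
  have hT0 : ∀ T ∈ ((Finset.univ : Finset (Fin (n + 1))).erase 0).powerset, (0 : Fin (n + 1)) ∉ T :=
    fun T hT h => Finset.notMem_erase _ _ (Finset.mem_powerset.mp hT h)
  congr 1
  · have := Finset.sum_powerset_apply_card
      (fun k => x ^ k * ((n + 1 - k).factorial : ℝ)) (x := (Finset.univ : Finset (Fin (n + 1))).erase 0)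
    rw [hcard] at this
    rw [permCoeffZero]
    simp only [nsmul_eq_mul] at this
    rw [← this]
    exact Finset.sum_congr rfl fun T hT => by rw [hprod T hT]
  · have := Finset.sum_powerset_apply_card
      (fun k => x ^ k * ((n - k).factorial : ℝ)) (x := (Finset.univ : Finset (Fin (n + 1))).erase 0)
    rw [hcard] at this
    rw [permCoeffOne]
    simp only [nsmul_eq_mul] at this
    rw [← this, Finset.sum_mul]
    refine Finset.sum_congr rfl fun T hT => ?_
    rw [Finset.prod_insert (hT0 T hT), hprod T hT, Finset.card_insert_of_notMem (hT0 T hT),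
      if_pos rfl, Nat.add_sub_add_right]
    ring

/-- With B = z - D, the vector ρ e₀ sees only the first column and adds s |B_{r0}|² to the exponent.
Completing the square gives that column weight 1 + s and diagonal mean z / (1 + s); the other
columns keep weight 1 and diagonal mean z. -/
theorem weightedDetMoment_single {n : ℕ} (z : ℂ) {s ρ : ℝ} (hρ : ρ ^ 2 = s) :
    weightedDetMoment z (Pi.single (0 : Fin (n + 1)) (ρ : ℂ)) =
      ENNReal.ofReal (Real.exp (-(‖z‖ ^ 2 * s / (1 + s))) *
        ((Real.pi ^ (n + 1) / (1 + s)) ^ (n + 1) * ((1 + s)⁻¹ *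
          (permCoeffZero n (‖z‖ ^ 2) + permCoeffOne n (‖z‖ ^ 2) * (‖z‖ ^ 2 / (1 + s)))))) := by
  have hs : 0 ≤ s := hρ ▸ sq_nonneg ρ
  have h1s : (0 : ℝ) < 1 + s := by positivity
  set a : Fin (n + 1) → ℝ := fun c => if c = 0 then 1 + s else 1 with ha
  set m : Fin (n + 1) → ℂ := fun c => if c = 0 then z / ((1 + s : ℝ) : ℂ) else z with hm
  have hapos : ∀ c, 0 < a c := by intro c; simp only [ha]; split_ifs <;> positivity
  obtain ⟨hint, hval⟩ := integral_normSq_det_mul_gaussWeight hapos m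
  set v : Fin (n + 1) → Fin (n + 1) → ℂ :=
    fun i j => (z • (1 : Matrix (Fin (n + 1)) (Fin (n + 1)) ℂ)) i j with hv
  rw [weightedDetMoment, ← lintegral_sub_left_eq_self _ v]
  have hexp : ∀ B : Fin (n + 1) → Fin (n + 1) → ℂ,
      Real.exp (-∑ i, ∑ j, ‖(v - B) i j‖ ^ 2) *
        Real.exp (-∑ i, ‖(Matrix.of B).mulVec (Pi.single (0 : Fin (n + 1)) (ρ : ℂ)) i‖ ^ 2) =
      Real.exp (-(‖z‖ ^ 2 * s / (1 + s))) *
        ∏ r, ∏ c, gaussWeight (a c) (if r = c then m c else 0) (B r c) := by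
    intro B
    simp only [gaussWeight, ← Real.exp_sum, ← Real.exp_add]
    congr 1
    have e1 : ∑ i, ‖(Matrix.of B).mulVec (Pi.single (0 : Fin (n + 1)) (ρ : ℂ)) i‖ ^ 2
        = ∑ r, ∑ c, if c = 0 then s * ‖B r c‖ ^ 2 else 0 := by
      refine Finset.sum_congr rfl fun r _ => ?_
      rw [Finset.sum_ite_eq' Finset.univ (0 : Fin (n + 1)), if_pos (Finset.mem_univ _),
        Matrix.mulVec_single]
      simp [mul_pow, hρ, mul_comm]
    have e2 : ‖z‖ ^ 2 * s / (1 + s) = ∑ r : Fin (n + 1), ∑ c : Fin (n + 1),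
        if c = 0 then (if r = c then ‖z‖ ^ 2 * s / (1 + s) else 0) else 0 := by
      simp
    rw [e1, e2, ← Finset.sum_neg_distrib, ← Finset.sum_neg_distrib, ← Finset.sum_neg_distrib,
      ← Finset.sum_add_distrib, ← Finset.sum_add_distrib]
    refine Finset.sum_congr rfl fun r _ => ?_
    rw [← Finset.sum_neg_distrib, ← Finset.sum_neg_distrib, ← Finset.sum_neg_distrib,
      ← Finset.sum_add_distrib, ← Finset.sum_add_distrib]
    refine Finset.sum_congr rfl fun c _ => ?_
    simp only [ha, hm, hv, Pi.sub_apply, Matrix.smul_apply, Matrix.one_apply, smul_eq_mul]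
    by_cases hc : c = 0
    · by_cases hr : r = c
      · have := norm_sub_sq_add_mul_norm_sq hs z (B r c)
        simp only [if_pos hc, if_pos hr, mul_one]
        linarith
      · simp only [if_pos hc, if_neg hr, mul_zero, zero_sub, norm_neg, sub_zero]
        ring
    · simp only [if_neg hc]
      rw [norm_sub_rev]
      split_ifs <;> simp
  have hfun : ∀ B : Fin (n + 1) → Fin (n + 1) → ℂ, ENNReal.ofReal
      (‖(z • (1 : Matrix (Fin (n + 1)) (Fin (n + 1)) ℂ) - Matrix.of (v - B)).det‖ ^ 2 *
        Real.exp (-∑ i, ∑ j, ‖(v - B) i j‖ ^ 2) *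
        Real.exp (-∑ i, ‖(z • (1 : Matrix (Fin (n + 1)) (Fin (n + 1)) ℂ) -
          Matrix.of (v - B)).mulVec (Pi.single (0 : Fin (n + 1)) (ρ : ℂ)) i‖ ^ 2)) =
      ENNReal.ofReal (Real.exp (-(‖z‖ ^ 2 * s / (1 + s)))  * (‖(Matrix.of B).det‖ ^ 2 *
        ∏ r, ∏ c, gaussWeight (a c) (if r = c then m c else 0) (B r c))) := by
    intro B
    have : z • (1 : Matrix (Fin (n + 1)) (Fin (n + 1)) ℂ) - Matrix.of (v - B) = Matrix.of B := by
      ext i j; simp [hv]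
    rw [this, mul_assoc, hexp]
    congr 1
    ring
  simp_rw [hfun]
  rw [← ofReal_integral_eq_lintegral_ofReal (hint.const_mul _) (ae_of_all _ fun B => by
      have : ∀ r c, 0 ≤ gaussWeight (a c) (if r = c then m c else 0) (B r c) :=
        fun r c => (gaussWeight_pos _ _ _).le
      exact mul_nonneg (Real.exp_pos _).le (mul_nonneg (sq_nonneg _)
        (Finset.prod_nonneg fun r _ => Finset.prod_nonneg fun c _ => this r c))),
    integral_const_mul, hval]
  congr 3
  · congr 1
    simp [ha]
  · rw [← sum_perm_prod_one_add_ite_eq, Finset.mul_sum]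
    refine Finset.sum_congr rfl fun σ _ => ?_
    -- Pulling 1 / a c out of each column normalizes the matrix to 1 1ᵀ plus a diagonal; the first
    -- diagonal entry becomes |z / (1 + s)|² (1 + s) = |z|² / (1 + s).
    have e : ∀ c : Fin (n + 1), (1 / a c + if σ c = c then ‖m c‖ ^ 2 else 0) = (1 / a c) *
        (1 + if σ c = c then (if c = 0 then ‖z‖ ^ 2 / (1 + s) else ‖z‖ ^ 2) else 0) := by
      intro c
      simp only [ha, hm]
      split_ifs
      · rw [norm_div, Complex.norm_real, Real.norm_of_nonneg h1s.le]
        field_simp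
      · simp
      · simp
      · simp
    simp_rw [e]
    rw [Finset.prod_mul_distrib]
    congr 1
    simp [ha]

theorem weightedDetMoment_eq {n : ℕ} (z : ℂ) (y : Fin (n + 1) → ℂ) :
    weightedDetMoment z y =
      ENNReal.ofReal (Real.exp (-(‖z‖ ^ 2 * (∑ i, ‖y i‖ ^ 2) / (1 + ∑ i, ‖y i‖ ^ 2))) *
        ((Real.pi ^ (n + 1) / (1 + ∑ i, ‖y i‖ ^ 2)) ^ (n + 1) * ((1 + ∑ i, ‖y i‖ ^ 2)⁻¹ *
          (permCoeffZero n (‖z‖ ^ 2) +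
            permCoeffOne n (‖z‖ ^ 2) * (‖z‖ ^ 2 / (1 + ∑ i, ‖y i‖ ^ 2)))))) := by
  obtain ⟨U, hU, hy⟩ := exists_unitary_mulVec_eq y
  rw [← weightedDetMoment_mulVec_unitary z y U hU, hy]
  exact weightedDetMoment_single z (Real.sq_sqrt (Finset.sum_nonneg fun i _ => sq_nonneg _))

/-! ### The resolvent applied to a Gaussian vector -/

theorem lintegral_pow_mul_exp_neg_mul (k : ℕ) {A : ℝ} (hA : 0 < A) :
    ∫⁻ t in Set.Ioi (0 : ℝ), ENNReal.ofReal (t ^ k * Real.exp (-(A * t))) =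
      ENNReal.ofReal (k.factorial / A ^ (k + 1)) := by
  have h := Real.integral_rpow_mul_exp_neg_mul_Ioi (a := (k : ℝ) + 1) (r := A) (by positivity) hA
  rw [Real.Gamma_nat_eq_factorial] at h
  have e : (1 / A) ^ ((k : ℝ) + 1) * (k.factorial : ℝ) = k.factorial / A ^ (k + 1) := by
    have : ((k : ℝ) + 1) = ((k + 1 : ℕ) : ℝ) := by push_cast; ring
    rw [this, Real.rpow_natCast, one_div, inv_pow, inv_mul_eq_div]
  simp only [add_sub_cancel_right, Real.rpow_natCast] at h
  rw [e] at h
  have hint : IntegrableOn (fun t : ℝ => t ^ k * Real.exp (-(A * t))) (Set.Ioi 0) := by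
    by_contra hn
    rw [integral_undef hn] at h
    have : 0 < (k.factorial : ℝ) / A ^ (k + 1) := by positivity
    linarith
  rw [← h, ofReal_integral_eq_lintegral_ofReal hint]
  filter_upwards [ae_restrict_mem measurableSet_Ioi] with t ht
  have : (0 : ℝ) < t := ht
  positivity

theorem lintegral_exp_neg_mul_sum_norm_sq (d : ℕ) {t : ℝ} (ht : 0 < t) :
    ∫⁻ y : Fin d → ℂ, ENNReal.ofReal (Real.exp (-(t * ∑ i, ‖y i‖ ^ 2))) =
      ENNReal.ofReal ((Real.pi / t) ^ d) := by
  have e : ∀ y : Fin d → ℂ, ENNReal.ofReal (Real.exp (-(t * ∑ i, ‖y i‖ ^ 2)))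
      = ∏ i, ENNReal.ofReal (Real.exp (-t * ‖y i‖ ^ 2)) := by
    intro y
    rw [← ENNReal.ofReal_prod_of_nonneg fun i _ => (Real.exp_pos _).le, ← Real.exp_sum,
      ← Finset.mul_sum, neg_mul]
  simp_rw [e]
  rw [volume_pi, lintegral_fin_prod_eq_prod _ (fun _ z => ENNReal.ofReal (Real.exp (-t * ‖z‖ ^ 2)))
    fun _ => by fun_prop, Finset.prod_const, Finset.card_univ, Fintype.card_fin,
    ← ofReal_integral_eq_lintegral_ofReal (integrable_exp_neg_mul_norm_sq ht)
      (ae_of_all _ fun z => (Real.exp_pos _).le), integral_exp_neg_mul_norm_sq ht,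
    ENNReal.ofReal_pow (by positivity)]

/-- The power is written as a Gamma integral in t. The Gaussian integral over y then gives (π /
t)^d, and a second Gamma integral remains. -/
theorem lintegral_inv_one_add_sum_norm_sq_pow {d k : ℕ} (hdk : d ≤ k) :
    ∫⁻ y : Fin d → ℂ, ENNReal.ofReal (((1 + ∑ i, ‖y i‖ ^ 2) ^ (k + 1))⁻¹) =
      ENNReal.ofReal (Real.pi ^ d * ((k - d).factorial / k.factorial)) := by
  have hpos : ∀ y : Fin d → ℂ, 0 < 1 + ∑ i, ‖y i‖ ^ 2 := fun y =>
    add_pos_of_pos_of_nonneg one_pos (Finset.sum_nonneg fun i _ => sq_nonneg _)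
  have hk : (0 : ℝ) < k.factorial := by positivity
  have h1 : ∀ y : Fin d → ℂ, ENNReal.ofReal (((1 + ∑ i, ‖y i‖ ^ 2) ^ (k + 1))⁻¹)
      = ENNReal.ofReal (k.factorial : ℝ)⁻¹ * ∫⁻ t in Set.Ioi (0 : ℝ),
        ENNReal.ofReal (t ^ k * Real.exp (-((1 + ∑ i, ‖y i‖ ^ 2) * t))) := by
    intro y
    rw [lintegral_pow_mul_exp_neg_mul k (hpos y), ← ENNReal.ofReal_mul (by positivity)]
    congr 1
    field_simp
  simp_rw [h1]
  rw [lintegral_const_mul' _ _ ENNReal.ofReal_ne_top, lintegral_lintegral_swap (by fun_prop)]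
  have h2 : ∀ t ∈ Set.Ioi (0 : ℝ), ∫⁻ y : Fin d → ℂ,
      ENNReal.ofReal (t ^ k * Real.exp (-((1 + ∑ i, ‖y i‖ ^ 2) * t)))
      = ENNReal.ofReal (Real.pi ^ d) * ENNReal.ofReal (t ^ (k - d) * Real.exp (-(1 * t))) := by
    intro t ht
    have ht : 0 < t := ht
    have e : ∀ y : Fin d → ℂ,
        ENNReal.ofReal (t ^ k * Real.exp (-((1 + ∑ i, ‖y i‖ ^ 2) * t)))
        = ENNReal.ofReal (t ^ k * Real.exp (-t)) *
          ENNReal.ofReal (Real.exp (-(t * ∑ i, ‖y i‖ ^ 2))) := by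
      intro y
      rw [← ENNReal.ofReal_mul (by positivity), mul_assoc, ← Real.exp_add]
      congr 3
      ring
    simp_rw [e]
    rw [lintegral_const_mul' _ _ ENNReal.ofReal_ne_top, lintegral_exp_neg_mul_sum_norm_sq d ht,
      ← ENNReal.ofReal_mul (by positivity), ← ENNReal.ofReal_mul (by positivity), one_mul, div_pow]
    congr 1
    have : t ^ k = t ^ (k - d) * t ^ d := by rw [← pow_add, Nat.sub_add_cancel hdk]
    rw [this]
    field_simp
  rw [setLIntegral_congr_fun measurableSet_Ioi h2, lintegral_const_mul' _ _ ENNReal.ofReal_ne_top,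
    lintegral_pow_mul_exp_neg_mul _ one_pos, ← ENNReal.ofReal_mul (by positivity),
    ← ENNReal.ofReal_mul (by positivity)]
  congr 1
  field_simp
  simp

theorem measurable_inv_smul_one_sub_mulVec {n : ℕ} (z : ℂ) :
    Measurable fun p : (Fin n → ℂ) × (Fin n → Fin n → ℂ) =>
      (z • (1 : Matrix (Fin n) (Fin n) ℂ) - Matrix.of p.2)⁻¹.mulVec p.1 := by
  have hc : Continuous fun p : (Fin n → ℂ) × (Fin n → Fin n → ℂ) =>
      (z • (1 : Matrix (Fin n) (Fin n) ℂ) - Matrix.of p.2) :=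
    continuous_const.sub continuous_snd
  have h1 : Measurable fun p : (Fin n → ℂ) × (Fin n → Fin n → ℂ) =>
      (z • (1 : Matrix (Fin n) (Fin n) ℂ) - Matrix.of p.2).adjugate.mulVec p.1 :=
    (hc.matrix_adjugate.matrix_mulVec continuous_fst).measurable
  have h2 : Measurable fun p : (Fin n → ℂ) × (Fin n → Fin n → ℂ) =>
      (z • (1 : Matrix (Fin n) (Fin n) ℂ) - Matrix.of p.2).det := hc.matrix_det.measurable
  simp_rw [Matrix.inv_def, Ring.inverse_eq_inv', Matrix.smul_mulVec]
  exact h2.inv.smul h1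

theorem permCoeffZero_nonneg (n : ℕ) {x : ℝ} (hx : 0 ≤ x) : 0 ≤ permCoeffZero n x :=
  Finset.sum_nonneg fun k _ => by positivity

theorem permCoeffOne_nonneg (n : ℕ) {x : ℝ} (hx : 0 ≤ x) : 0 ≤ permCoeffOne n x :=
  Finset.sum_nonneg fun k _ => by positivity

theorem lintegral_gaussianVec {n : ℕ} {F : (Fin n → ℂ) → ℝ≥0∞} (hF : Measurable F) :
    ∫⁻ x, F x ∂gaussianVec n = ∫⁻ x : Fin n → ℂ,
      ENNReal.ofReal (Real.pi⁻¹ ^ n * Real.exp (-∑ i, ‖x i‖ ^ 2)) * F x := by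
  rw [gaussianVec_eq_withDensity,
    lintegral_withDensity_eq_lintegral_mul _ (measurable_gaussianVec_density n) hF]
  rfl

theorem lintegral_gaussianMat {m n : ℕ} {F : (Fin m → Fin n → ℂ) → ℝ≥0∞} (hF : Measurable F) :
    ∫⁻ x, F x ∂gaussianMat m n = ∫⁻ x : Fin m → Fin n → ℂ,
      ENNReal.ofReal (Real.pi⁻¹ ^ (n * m) * Real.exp (-∑ i, ∑ j, ‖x i j‖ ^ 2)) * F x := by
  rw [gaussianMat_eq_withDensity,
    lintegral_withDensity_eq_lintegral_mul _ (measurable_gaussianMat_density m n) hF]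
  rfl

/-- For fixed D the substitution c = (z - D) y replaces the resolvent vector by the free variable y,
at the cost of the Jacobian |det (z - D)|². Exchanging the integrals leaves the moment over D at
fixed y. -/
theorem lintegral_exp_eq_lintegral_weightedDetMoment (d : ℕ) (z : ℂ) :
    ∫⁻ p, ENNReal.ofReal (Real.exp (-(‖z‖ ^ 2 / (1 + ∑ i,
      ‖(z • (1 : Matrix (Fin d) (Fin d) ℂ) - Matrix.of p.2)⁻¹.mulVec p.1 i‖ ^ 2))))
        ∂((gaussianVec d).prod (gaussianMat d d)) =
    ∫⁻ y : Fin d → ℂ, ENNReal.ofReal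
      (Real.exp (-(‖z‖ ^ 2 / (1 + ∑ i, ‖y i‖ ^ 2))) * (Real.pi⁻¹ ^ d * Real.pi⁻¹ ^ (d * d))) *
        weightedDetMoment z y := by
  have hm0 := measurable_inv_smul_one_sub_mulVec (n := d) z
  have hm : Measurable fun p : (Fin d → ℂ) × (Fin d → Fin d → ℂ) =>
      ENNReal.ofReal (Real.exp (-(‖z‖ ^ 2 / (1 + ∑ i,
      ‖(z • (1 : Matrix (Fin d) (Fin d) ℂ) - Matrix.of p.2)⁻¹.mulVec p.1 i‖ ^ 2)))) := by
    fun_prop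
  set G : (Fin d → ℂ) → ℝ≥0∞ := fun y =>
    ENNReal.ofReal (Real.exp (-(‖z‖ ^ 2 / (1 + ∑ i, ‖y i‖ ^ 2)))) with hG
  have hGm : Measurable G := by fun_prop
  have hmi : Measurable fun D : Fin d → Fin d → ℂ =>
      ∫⁻ c, ENNReal.ofReal (Real.exp (-(‖z‖ ^ 2 / (1 + ∑ i,
      ‖(z • (1 : Matrix (Fin d) (Fin d) ℂ) - Matrix.of D)⁻¹.mulVec c i‖ ^ 2)))) ∂gaussianVec d :=
    hm.lintegral_prod_left'
  rw [lintegral_prod_symm _ hm.aemeasurable, lintegral_gaussianMat hmi]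
  have h1 : ∀ᵐ D : Fin d → Fin d → ℂ, ∫⁻ c, ENNReal.ofReal (Real.exp (-(‖z‖ ^ 2 / (1 + ∑ i,
      ‖(z • (1 : Matrix (Fin d) (Fin d) ℂ) - Matrix.of D)⁻¹.mulVec c i‖ ^ 2)))) ∂gaussianVec d
      = ∫⁻ y, ENNReal.ofReal (‖(z • (1 : Matrix (Fin d) (Fin d) ℂ) - Matrix.of D).det‖ ^ 2) *
        (ENNReal.ofReal (Real.pi⁻¹ ^ d * Real.exp (-∑ i,
          ‖(z • (1 : Matrix (Fin d) (Fin d) ℂ) - Matrix.of D).mulVec y i‖ ^ 2)) * G y) := by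
    filter_upwards [ae_det_smul_one_sub_ne_zero z] with D hD
    set M := z • (1 : Matrix (Fin d) (Fin d) ℂ) - Matrix.of D with hM
    have hcm : Measurable fun c : Fin d → ℂ => M⁻¹.mulVec c :=
      (continuous_const.matrix_mulVec continuous_id).measurable
    have hGc : Measurable fun c : Fin d → ℂ => G (M⁻¹.mulVec c) := hGm.comp hcm
    change ∫⁻ c, G (M⁻¹.mulVec c) ∂gaussianVec d = _
    rw [lintegral_gaussianVec hGc]
    refine (lintegral_comp_mulVec M hD ((measurable_gaussianVec_density d).mul hGc)).trans ?_
    refine lintegral_congr fun y => ?_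
    simp only [Pi.mul_apply]
    rw [Matrix.mulVec_mulVec, Matrix.nonsing_inv_mul _ (isUnit_iff_ne_zero.mpr hD),
      Matrix.one_mulVec]
  have h2 : ∀ᵐ D : Fin d → Fin d → ℂ,
      ENNReal.ofReal (Real.pi⁻¹ ^ (d * d) * Real.exp (-∑ i, ∑ j, ‖D i j‖ ^ 2)) *
        ∫⁻ c, ENNReal.ofReal (Real.exp (-(‖z‖ ^ 2 / (1 + ∑ i,
        ‖(z • (1 : Matrix (Fin d) (Fin d) ℂ) - Matrix.of D)⁻¹.mulVec c i‖ ^ 2)))) ∂gaussianVec d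
      = ∫⁻ y, ENNReal.ofReal
      (Real.exp (-(‖z‖ ^ 2 / (1 + ∑ i, ‖y i‖ ^ 2))) * (Real.pi⁻¹ ^ d * Real.pi⁻¹ ^ (d * d))) *
        ENNReal.ofReal
        (‖(z • (1 : Matrix (Fin d) (Fin d) ℂ) - Matrix.of D).det‖ ^ 2 *
          Real.exp (-∑ i, ∑ j, ‖D i j‖ ^ 2) *
          Real.exp (-∑ i, ‖(z • (1 : Matrix (Fin d) (Fin d) ℂ) - Matrix.of D).mulVec y i‖ ^ 2))
          := by
    filter_upwards [h1] with D hD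
    rw [hD, ← lintegral_const_mul' _ _ ENNReal.ofReal_ne_top]
    refine lintegral_congr fun y => ?_
    simp only [hG]
    rw [← ENNReal.ofReal_mul (by positivity), ← ENNReal.ofReal_mul (by positivity),
      ← ENNReal.ofReal_mul (by positivity), ← ENNReal.ofReal_mul (by positivity)]
    congr 1
    ring
  rw [lintegral_congr_ae h2, lintegral_lintegral_swap]
  · refine lintegral_congr fun y => ?_
    rw [lintegral_const_mul' _ _ ENNReal.ofReal_ne_top]
    rfl
  · refine Measurable.aemeasurable ?_
    have hc : Continuous fun p : (Fin d → Fin d → ℂ) × (Fin d → ℂ) =>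
        (z • (1 : Matrix (Fin d) (Fin d) ℂ) - Matrix.of p.1) :=
      continuous_const.sub continuous_fst
    have m1 : Measurable fun p : (Fin d → Fin d → ℂ) × (Fin d → ℂ) =>
        (z • (1 : Matrix (Fin d) (Fin d) ℂ) - Matrix.of p.1).mulVec p.2 :=
      (hc.matrix_mulVec continuous_snd).measurable
    have m2 : Measurable fun p : (Fin d → Fin d → ℂ) × (Fin d → ℂ) =>
        (z • (1 : Matrix (Fin d) (Fin d) ℂ) - Matrix.of p.1).det := hc.matrix_det.measurable
    fun_prop

theorem lintegral_exp_eq_permCoeff (n : ℕ) (z : ℂ) :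
    ∫⁻ p, ENNReal.ofReal (Real.exp (-(‖z‖ ^ 2 / (1 + ∑ i,
      ‖(z • (1 : Matrix (Fin (n + 1)) (Fin (n + 1)) ℂ) - Matrix.of p.2)⁻¹.mulVec p.1 i‖ ^ 2))))
        ∂((gaussianVec (n + 1)).prod (gaussianMat (n + 1) (n + 1))) =
    ENNReal.ofReal (Real.exp (-‖z‖ ^ 2) * (permCoeffZero n (‖z‖ ^ 2) / (n + 1).factorial +
      permCoeffOne n (‖z‖ ^ 2) * ‖z‖ ^ 2 / (n + 2).factorial)) := by
  set x := ‖z‖ ^ 2 with hx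
  have hx0 : 0 ≤ x := sq_nonneg _
  have hP := permCoeffZero_nonneg n hx0
  have hQ := permCoeffOne_nonneg n hx0
  rw [lintegral_exp_eq_lintegral_weightedDetMoment]
  have h : ∀ y : Fin (n + 1) → ℂ, ENNReal.ofReal
      (Real.exp (-(x / (1 + ∑ i, ‖y i‖ ^ 2))) *
        (Real.pi⁻¹ ^ (n + 1) * Real.pi⁻¹ ^ ((n + 1) * (n + 1)))) * weightedDetMoment z y =
      ENNReal.ofReal (Real.exp (-x) * Real.pi⁻¹ ^ (n + 1) * permCoeffZero n x) *
        ENNReal.ofReal (((1 + ∑ i, ‖y i‖ ^ 2) ^ (n + 1 + 1))⁻¹) +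
      ENNReal.ofReal (Real.exp (-x) * Real.pi⁻¹ ^ (n + 1) * (permCoeffOne n x * x)) *
        ENNReal.ofReal (((1 + ∑ i, ‖y i‖ ^ 2) ^ (n + 2 + 1))⁻¹) := by
    intro y
    rw [weightedDetMoment_eq]
    have hs : 0 ≤ ∑ i, ‖y i‖ ^ 2 := Finset.sum_nonneg fun i _ => sq_nonneg _
    generalize ∑ i, ‖y i‖ ^ 2 = s at hs
    have hs1 : 0 < 1 + s := by positivity
    rw [← ENNReal.ofReal_mul (by positivity), ← ENNReal.ofReal_mul (by positivity),
      ← ENNReal.ofReal_mul (by positivity), ← ENNReal.ofReal_add (by positivity) (by positivity)]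
    congr 1
    -- The decisive cancellation: the exponential being averaged and the one from completing the
    -- square multiply to exp(-x), free of y.
    have he : Real.exp (-x) = Real.exp (-(x / (1 + s))) * Real.exp (-(x * s / (1 + s))) := by
      rw [← Real.exp_add]; congr 1; field_simp; ring
    rw [he, ← hx, div_pow, ← pow_mul]
    have hpi := Real.pi_pos
    simp only [inv_pow]
    field_simp
    ring
  rw [lintegral_congr h, lintegral_add_left (by fun_prop), lintegral_const_mul' _ _ ENNReal.ofReal_ne_top,
    lintegral_const_mul' _ _ ENNReal.ofReal_ne_top,
    lintegral_inv_one_add_sum_norm_sq_pow (le_refl _),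
    lintegral_inv_one_add_sum_norm_sq_pow (Nat.le_succ (n + 1)),
    ← ENNReal.ofReal_mul (by positivity),
    ← ENNReal.ofReal_mul (by positivity), ← ENNReal.ofReal_add (by positivity) (by positivity)]
  congr 1
  have e1 : n + 2 - (n + 1) = 1 := by omega
  simp only [Nat.sub_self, Nat.factorial_zero, Nat.succ_eq_add_one, e1, Nat.factorial_one,
    inv_pow, show n + 1 + 1 = n + 2 from rfl]
  have hpi := Real.pi_pos
  have f1 : ((n + 1).factorial : ℝ) ≠ 0 := by positivity
  have f2 : ((n + 2).factorial : ℝ) ≠ 0 := by positivity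
  field_simp
  push_cast
  ring

/-- The expectation of `(1 - X / N)₊` for `X` Poisson with parameter `x`. -/
noncomputable def poissonDefect (N : ℕ) (x : ℝ) : ℝ :=
  Real.exp (-x) * ∑ j ∈ Finset.range N, (1 - j / N) * (x ^ j / j.factorial)

theorem permCoeff_eq_poissonDefect (n : ℕ) (x : ℝ) :
    Real.exp (-x) * (permCoeffZero n x / (n + 1).factorial +
      permCoeffOne n x * x / (n + 2).factorial) = poissonDefect (n + 2) x := by
  rw [poissonDefect]
  congr 1
  -- The term j = n + 1 is added with weight zero; in `h2` the factor x shifts the index and the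
  -- added term is j = 0. The two weights then sum to 1 - j / (n + 2).
  have h1 : permCoeffZero n x / (n + 1).factorial
      = ∑ j ∈ Finset.range (n + 2), (((n : ℝ) + 1 - j) / (n + 1)) * (x ^ j / j.factorial) := by
    rw [Finset.sum_range_succ _ (n + 1), permCoeffZero, Finset.sum_div]
    push_cast
    rw [sub_self, zero_div, zero_mul, add_zero]
    refine Finset.sum_congr rfl fun k hk => ?_
    have hk : k ≤ n := Nat.lt_succ_iff.mp (Finset.mem_range.mp hk)
    rw [Nat.cast_choose ℝ hk, Nat.factorial_succ n, Nat.succ_sub hk, Nat.factorial_succ]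
    have : (n - k).factorial ≠ 0 := by positivity
    push_cast [hk]
    field_simp
    ring
  have h2 : permCoeffOne n x * x / (n + 2).factorial
      = ∑ j ∈ Finset.range (n + 2), (j / (((n : ℝ) + 1) * (n + 2))) * (x ^ j / j.factorial) := by
    rw [Finset.sum_range_succ', permCoeffOne, Finset.sum_mul, Finset.sum_div]
    simp only [Nat.cast_zero, zero_div, zero_mul, add_zero]
    refine Finset.sum_congr rfl fun k hk => ?_
    have hk : k ≤ n := Nat.lt_succ_iff.mp (Finset.mem_range.mp hk)
    rw [Nat.cast_choose ℝ hk, Nat.factorial_succ (n + 1), Nat.factorial_succ n,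
      Nat.factorial_succ k]
    have : (n - k).factorial ≠ 0 := by positivity
    push_cast
    field_simp
    ring
  rw [h1, h2, ← Finset.sum_add_distrib]
  refine Finset.sum_congr rfl fun j _ => ?_
  rw [← add_mul]
  congr 1
  push_cast
  field_simp
  ring

/-- The expectation of `exp (-|z|² / (1 + |(z - D)⁻¹ c|²))` for Gaussian `c` and `D`. -/
theorem lintegral_exp_eq_poissonDefect (n : ℕ) (z : ℂ) :
    ∫⁻ p, ENNReal.ofReal (Real.exp (-(‖z‖ ^ 2 / (1 + ∑ i,
      ‖(z • (1 : Matrix (Fin (n + 1)) (Fin (n + 1)) ℂ) - Matrix.of p.2)⁻¹.mulVec p.1 i‖ ^ 2))))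
        ∂((gaussianVec (n + 1)).prod (gaussianMat (n + 1) (n + 1))) =
    ENNReal.ofReal (poissonDefect (n + 2) (‖z‖ ^ 2)) := by
  rw [lintegral_exp_eq_permCoeff, permCoeff_eq_poissonDefect]

/-! ### Diagonal entries of the resolvent -/

/-- Schur complement: adding to the first column of z - A the other columns with coefficients y
clears it below the corner, since M y is the first column of A there. If the bracket vanishes, z - A
is singular and both sides are 0 by convention. -/
theorem inv_smul_one_sub_zero_zero {d : ℕ} (z : ℂ) (A : Fin (d + 1) → Fin (d + 1) → ℂ)
    (h : (z • (1 : Matrix (Fin d) (Fin d) ℂ) -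
      Matrix.of fun i j => A (Fin.succ i) (Fin.succ j)).det ≠ 0) :
    (z • (1 : Matrix (Fin (d + 1)) (Fin (d + 1)) ℂ) - Matrix.of A)⁻¹ 0 0 =
      (z - ∑ j, (Fin.cons 1 ((z • (1 : Matrix (Fin d) (Fin d) ℂ) -
        Matrix.of fun i j => A (Fin.succ i) (Fin.succ j))⁻¹.mulVec fun i => A (Fin.succ i) 0) :
          Fin (d + 1) → ℂ) j * A 0 j)⁻¹ := by
  set M := z • (1 : Matrix (Fin d) (Fin d) ℂ) -
      Matrix.of fun i j => A (Fin.succ i) (Fin.succ j) with hM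
  set y := M⁻¹.mulVec fun i => A (Fin.succ i) 0 with hy
  set v : Fin (d + 1) → ℂ := Fin.cons 1 y with hv
  set B := z • (1 : Matrix (Fin (d + 1)) (Fin (d + 1)) ℂ) - Matrix.of A with hB
  have hMy : M.mulVec y = fun i => A (Fin.succ i) 0 := by
    rw [hy, Matrix.mulVec_mulVec, Matrix.mul_nonsing_inv _ (isUnit_iff_ne_zero.mpr h),
      Matrix.one_mulVec]
  have hsub : B.submatrix Fin.succ Fin.succ = M := by
    ext i j
    simp [hB, hM, Matrix.one_apply]
  have hdet : B.det = (z - ∑ j, v j * A 0 j) * M.det := by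
    have h1 := Matrix.det_updateCol_sum B 0 v
    have hv0 : v 0 = 1 := rfl
    rw [hv0, one_smul] at h1
    rw [← h1, Matrix.det_succ_column_zero, Fin.sum_univ_succ]
    have h0 : ∑ i, v i • B 0 i = z - ∑ j, v j * A 0 j := by
      simp only [hB, Matrix.sub_apply, Matrix.smul_apply, Matrix.of_apply, smul_eq_mul, mul_sub,
        Finset.sum_sub_distrib]
      congr 1
      rw [Finset.sum_eq_single 0]
      · simp [hv0]
      · intro b _ hb; simp [hb.symm]
      · simp
    have hs : ∀ i : Fin d, ∑ j, v j • B i.succ j = 0 := by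
      intro i
      have := congrFun hMy i
      rw [Fin.sum_univ_succ]
      simp only [hv, Fin.cons_zero, Fin.cons_succ, one_smul]
      have e : ∑ j : Fin d, y j • B i.succ j.succ = M.mulVec y i := by
        rw [Matrix.mulVec, dotProduct]
        refine Finset.sum_congr rfl fun j _ => ?_
        rw [← hsub, Matrix.submatrix_apply, smul_eq_mul, mul_comm]
      rw [e, this]
      simp [hB]
    have hsub' : (B.updateCol 0 fun k => ∑ i, v i • B k i).submatrix (Fin.succAbove 0) Fin.succ
        = M := by
      rw [← hsub]
      ext i j
      simp
    rw [hsub']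
    simp only [Matrix.updateCol_self, hs, h0]
    simp
  rw [Matrix.inv_def, Matrix.smul_apply, Ring.inverse_eq_inv', hdet,
    Matrix.adjugate_fin_succ_eq_det_submatrix]
  have : B.submatrix (Fin.succAbove 0) (Fin.succAbove 0) = M := by
    rw [← hsub]; ext i j; simp
  rw [this, mul_inv, smul_eq_mul]
  field_simp
  simp

/-- Matrices act on vectors from the left; the equivalence given by a unitary matrix. -/
noncomputable def mulVecUnitaryEquiv {n : ℕ} (U : Matrix (Fin n) (Fin n) ℂ)
    (hU : U.conjTranspose * U = 1) : (Fin n → ℂ) ≃ₗ[ℝ] (Fin n → ℂ) where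
  toFun x := U.mulVec x
  invFun x := U.conjTranspose.mulVec x
  map_add' x y := Matrix.mulVec_add _ _ _
  map_smul' r x := Matrix.mulVec_smul _ _ _
  left_inv x := by
    simp only [Matrix.mulVec_mulVec, hU, Matrix.one_mulVec]
  right_inv x := by
    simp only [Matrix.mulVec_mulVec, mul_eq_one_comm.mp hU, Matrix.one_mulVec]

/-- A linear combination of independent Gaussians is Gaussian. -/
theorem map_sum_mul_gaussianVec {n : ℕ} (v : Fin (n + 1) → ℂ) :
    (gaussianVec (n + 1)).map (fun g => ∑ j, v j * g j) =
      stdComplexGaussian.map fun g => ((Real.sqrt (∑ i, ‖v i‖ ^ 2) : ℝ) : ℂ) * g := by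
  obtain ⟨U, hU, hv⟩ := exists_unitary_mulVec_eq v
  -- The transpose is used because v pairs with g bilinearly: v · (Uᵀ g) = (U v) · g.
  have hUt : U.transpose.conjTranspose * U.transpose = 1 := by
    have h := congrArg Matrix.transpose (mul_eq_one_comm.mp hU)
    rw [Matrix.transpose_mul, Matrix.transpose_one] at h
    exact h
  have hL := measurePreserving_gaussianVec (mulVecUnitaryEquiv U.transpose hUt)
    fun x => sum_norm_sq_mulVec_unitary hUt x
  have h0 : MeasurePreserving (Function.eval (0 : Fin (n + 1))) (gaussianVec (n + 1))
      stdComplexGaussian := measurePreserving_eval (fun _ => stdComplexGaussian) 0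
  have hm : Measurable fun g : Fin (n + 1) → ℂ => ∑ j, v j * g j := by fun_prop
  conv_lhs => rw [← hL.map_eq]
  rw [Measure.map_map hm hL.measurable, ← h0.map_eq, Measure.map_map (by fun_prop) h0.measurable]
  congr 1
  ext g
  change v ⬝ᵥ (U.transpose.mulVec g) = _ * g 0
  rw [Matrix.dotProduct_mulVec, Matrix.vecMul_transpose, hv]
  simp

theorem integral_gaussianVec_resolvent {n : ℕ} (z : ℂ) (v : Fin (n + 1) → ℂ)
    (hv : 0 < ∑ i, ‖v i‖ ^ 2) :
    ∫ g, z * (z - ∑ j, v j * g j)⁻¹ ∂gaussianVec (n + 1) =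
      (1 - Real.exp (-(‖z‖ ^ 2 / ∑ i, ‖v i‖ ^ 2)) : ℝ) := by
  have h1 : ∫ g, z * (z - ∑ j, v j * g j)⁻¹ ∂gaussianVec (n + 1)
      = ∫ w, z * (z - w)⁻¹ ∂(gaussianVec (n + 1)).map (fun g => ∑ j, v j * g j) :=
    (integral_map (φ := fun g : Fin (n + 1) → ℂ => ∑ j, v j * g j) (f := fun w => z * (z - w)⁻¹)
      (Measurable.aemeasurable (by fun_prop)) (Measurable.aestronglyMeasurable (by fun_prop))).symm
  rw [h1, map_sum_mul_gaussianVec, integral_map (by fun_prop)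
    (Measurable.aestronglyMeasurable (by fun_prop))]
  set ρ := Real.sqrt (∑ i, ‖v i‖ ^ 2) with hρ
  have hρ0 : 0 < ρ := Real.sqrt_pos.mpr hv
  have hρ2 : ρ ^ 2 = ∑ i, ‖v i‖ ^ 2 := Real.sq_sqrt hv.le
  have hρc : (ρ : ℂ) ≠ 0 := by exact_mod_cast hρ0.ne'
  have e : ∀ g : ℂ, z * (z - ρ * g)⁻¹ = (z / ρ) / (z / ρ - g) := by
    intro g
    rw [← div_eq_mul_inv, div_sub' hρc, div_div_div_cancel_right₀ hρc]
  simp_rw [e]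
  rw [integral_div_sub_stdComplexGaussian, norm_div, Complex.norm_real, Real.norm_of_nonneg hρ0.le,
    div_pow, hρ2]

/-- Rescaling by ρ = |v| gives an extra factor 1/ρ, at most 1 because the first coordinate of the
vector used below is 1. -/
theorem lintegral_enorm_gaussianVec_resolvent_le {n : ℕ} {C : ℝ≥0∞}
    (hC : ∀ z : ℂ, ∫⁻ g, ‖(z - g)⁻¹‖ₑ ∂stdComplexGaussian ≤ C)
    (z : ℂ) (v : Fin (n + 1) → ℂ) (hv : 1 ≤ ∑ i, ‖v i‖ ^ 2) :
    ∫⁻ g, ‖(z - ∑ j, v j * g j)⁻¹‖ₑ ∂gaussianVec (n + 1) ≤ C := by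
  have h1 : ∫⁻ g, ‖(z - ∑ j, v j * g j)⁻¹‖ₑ ∂gaussianVec (n + 1)
      = ∫⁻ w, ‖(z - w)⁻¹‖ₑ ∂(gaussianVec (n + 1)).map (fun g => ∑ j, v j * g j) :=
    (lintegral_map (f := fun w : ℂ => ‖(z - w)⁻¹‖ₑ) (by fun_prop) (by fun_prop)).symm
  rw [h1, map_sum_mul_gaussianVec, lintegral_map (by fun_prop) (by fun_prop)]
  set ρ := Real.sqrt (∑ i, ‖v i‖ ^ 2) with hρ
  have hρ1 : 1 ≤ ρ := Real.one_le_sqrt.mpr hv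
  have hρ0 : 0 < ρ := by linarith
  have hρc : (ρ : ℂ) ≠ 0 := by exact_mod_cast hρ0.ne'
  refine le_trans (lintegral_mono fun g => ?_) (hC (z / ρ))
  have e : (z - ρ * g)⁻¹ = (ρ : ℂ)⁻¹ * (z / ρ - g)⁻¹ := by
    rw [← mul_inv, mul_sub, mul_div_cancel₀ _ hρc]
  rw [e, enorm_mul]
  refine mul_le_of_le_one_left zero_le ?_
  rw [← ofReal_norm, norm_inv, Complex.norm_real, Real.norm_of_nonneg hρ0.le, ← ENNReal.ofReal_one]
  exact ENNReal.ofReal_le_ofReal (inv_le_one_of_one_le₀ hρ1)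

/-! ### Splitting off the first row and column -/

theorem measurePreserving_splitFirstCol (d : ℕ) :
    MeasurePreserving (fun R : Fin d → Fin (d + 1) → ℂ =>
      ((fun i => R i 0, fun i j => R i (Fin.succ j)) : (Fin d → ℂ) × (Fin d → Fin d → ℂ)))
      (gaussianMat d (d + 1)) ((gaussianVec d).prod (gaussianMat d d)) := by
  have h1 : MeasurePreserving (MeasurableEquiv.piFinSuccAbove (fun _ : Fin (d + 1) => ℂ) 0)
      (gaussianVec (d + 1)) (stdComplexGaussian.prod (gaussianVec d)) :=
    measurePreserving_piFinSuccAbove (fun _ => stdComplexGaussian) 0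
  have h2 := measurePreserving_pi (fun _ : Fin d => gaussianVec (d + 1))
    (fun _ : Fin d => stdComplexGaussian.prod (gaussianVec d)) fun _ => h1
  have h3 := measurePreserving_arrowProdEquivProdArrow ℂ (Fin d → ℂ) (Fin d)
    (fun _ => stdComplexGaussian) (fun _ => gaussianVec d)
  exact h3.comp h2

theorem measurePreserving_splitFirstRowCol (d : ℕ) :
    MeasurePreserving (fun A : Fin (d + 1) → Fin (d + 1) → ℂ =>
      ((A 0, (fun i => A (Fin.succ i) 0, fun i j => A (Fin.succ i) (Fin.succ j))) :
        (Fin (d + 1) → ℂ) × (Fin d → ℂ) × (Fin d → Fin d → ℂ)))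
      (gaussianMat (d + 1) (d + 1))
      ((gaussianVec (d + 1)).prod ((gaussianVec d).prod (gaussianMat d d))) := by
  have h1 : MeasurePreserving
      (MeasurableEquiv.piFinSuccAbove (fun _ : Fin (d + 1) => Fin (d + 1) → ℂ) 0)
      (gaussianMat (d + 1) (d + 1)) ((gaussianVec (d + 1)).prod (gaussianMat d (d + 1))) :=
    measurePreserving_piFinSuccAbove (fun _ => gaussianVec (d + 1)) 0
  have : SFinite (gaussianVec (d + 1)) := inferInstance
  have : SFinite (gaussianMat d (d + 1)) := inferInstance
  exact ((MeasurePreserving.id (gaussianVec (d + 1))).prod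
    (measurePreserving_splitFirstCol d)).comp h1

/-- The resolvent entry as a function of the first row, the rest of the first column and the rest
of the matrix. -/
noncomputable def splitResolvent {d : ℕ} (z : ℂ)
    (p : (Fin (d + 1) → ℂ) × (Fin d → ℂ) × (Fin d → Fin d → ℂ)) : ℂ :=
  (z - ∑ j, (Fin.cons 1 ((z • (1 : Matrix (Fin d) (Fin d) ℂ) - Matrix.of p.2.2)⁻¹.mulVec p.2.1) :
    Fin (d + 1) → ℂ) j * p.1 j)⁻¹

theorem measurable_splitResolvent {d : ℕ} (z : ℂ) : Measurable (splitResolvent (d := d) z) := by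
  unfold splitResolvent
  have h := (measurable_inv_smul_one_sub_mulVec (n := d) z).comp
    (measurable_snd : Measurable fun p : (Fin (d + 1) → ℂ) × (Fin d → ℂ) × (Fin d → Fin d → ℂ) =>
      p.2)
  simp only [Fin.sum_univ_succ, Fin.cons_zero, Fin.cons_succ]
  have h' : ∀ j : Fin d, Measurable
      fun p : (Fin (d + 1) → ℂ) × (Fin d → ℂ) × (Fin d → Fin d → ℂ) =>
      (z • (1 : Matrix (Fin d) (Fin d) ℂ) - Matrix.of p.2.2)⁻¹.mulVec p.2.1 j :=
    fun j => (measurable_pi_apply j).comp h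
  fun_prop

theorem gaussianMat_absolutelyContinuous (m n : ℕ) : gaussianMat m n ≪ volume := by
  rw [gaussianMat_eq_withDensity]
  exact withDensity_absolutelyContinuous _ _

theorem ae_inv_smul_one_sub_eq_splitResolvent {d : ℕ} (z : ℂ) :
    ∀ᵐ A ∂gaussianMat (d + 1) (d + 1),
      (z • (1 : Matrix (Fin (d + 1)) (Fin (d + 1)) ℂ) - Matrix.of A)⁻¹ 0 0 =
        splitResolvent z (A 0, (fun i => A (Fin.succ i) 0, fun i j => A (Fin.succ i) (Fin.succ j)))
        := by
  have h1 := (gaussianMat_absolutelyContinuous d d).ae_le (ae_det_smul_one_sub_ne_zero (n := d) z)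
  have h2 : ∀ᵐ A ∂gaussianMat (d + 1) (d + 1), (z • (1 : Matrix (Fin d) (Fin d) ℂ) -
      Matrix.of fun i j => A (Fin.succ i) (Fin.succ j)).det ≠ 0 :=
    (measurePreserving_splitFirstRowCol d).quasiMeasurePreserving.ae
      (Measure.quasiMeasurePreserving_snd.ae (Measure.quasiMeasurePreserving_snd.ae h1))
  filter_upwards [h2] with A hA
  exact inv_smul_one_sub_zero_zero z A hA

theorem sum_norm_sq_cons_one {d : ℕ} (y : Fin d → ℂ) :
    ∑ i, ‖(Fin.cons 1 y : Fin (d + 1) → ℂ) i‖ ^ 2 = 1 + ∑ i, ‖y i‖ ^ 2 := by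
  simp [Fin.sum_univ_succ]

theorem one_le_sum_norm_sq_cons_one {d : ℕ} (y : Fin d → ℂ) :
    1 ≤ ∑ i, ‖(Fin.cons 1 y : Fin (d + 1) → ℂ) i‖ ^ 2 := by
  rw [sum_norm_sq_cons_one]
  exact le_add_of_nonneg_right (Finset.sum_nonneg fun i _ => sq_nonneg _)

theorem lintegral_enorm_splitResolvent_le {d : ℕ} {C : ℝ≥0∞}
    (hC : ∀ z : ℂ, ∫⁻ g, ‖(z - g)⁻¹‖ₑ ∂stdComplexGaussian ≤ C) (z : ℂ)
    (q : (Fin d → ℂ) × (Fin d → Fin d → ℂ)) :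
    ∫⁻ r, ‖splitResolvent z (r, q)‖ₑ ∂gaussianVec (d + 1) ≤ C :=
  lintegral_enorm_gaussianVec_resolvent_le hC z
    (Fin.cons 1 ((z • (1 : Matrix (Fin d) (Fin d) ℂ) - Matrix.of q.2)⁻¹.mulVec q.1))
    (one_le_sum_norm_sq_cons_one _)

theorem integral_splitResolvent {d : ℕ} (z : ℂ) (q : (Fin d → ℂ) × (Fin d → Fin d → ℂ)) :
    ∫ r, z * splitResolvent z (r, q) ∂gaussianVec (d + 1) =
      ((1 - Real.exp (-(‖z‖ ^ 2 / (1 + ∑ i,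
        ‖(z • (1 : Matrix (Fin d) (Fin d) ℂ) - Matrix.of q.2)⁻¹.mulVec q.1 i‖ ^ 2))) : ℝ) : ℂ) := by
  rw [← sum_norm_sq_cons_one]
  exact integral_gaussianVec_resolvent z
    (Fin.cons 1 ((z • (1 : Matrix (Fin d) (Fin d) ℂ) - Matrix.of q.2)⁻¹.mulVec q.1))
    (zero_lt_one.trans_le (one_le_sum_norm_sq_cons_one _))

attribute [irreducible] splitResolvent

theorem lintegral_enorm_splitResolvent_prod_le {d : ℕ} {C : ℝ≥0∞}
    (hC : ∀ z : ℂ, ∫⁻ g, ‖(z - g)⁻¹‖ₑ ∂stdComplexGaussian ≤ C) (z : ℂ) :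
    ∫⁻ p, ‖splitResolvent (d := d) z p‖ₑ
      ∂((gaussianVec (d + 1)).prod ((gaussianVec d).prod (gaussianMat d d))) ≤ C := by
  rw [lintegral_prod_symm _ (measurable_splitResolvent z).enorm.aemeasurable]
  exact (lintegral_mono (g := fun _ => C) fun q =>
    lintegral_enorm_splitResolvent_le hC z q).trans (by simp)

theorem lintegral_enorm_inv_smul_one_sub_zero_zero_le {d : ℕ} {C : ℝ≥0∞}
    (hC : ∀ z : ℂ, ∫⁻ g, ‖(z - g)⁻¹‖ₑ ∂stdComplexGaussian ≤ C) (z : ℂ) :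
    ∫⁻ A, ‖(z • (1 : Matrix (Fin (d + 1)) (Fin (d + 1)) ℂ) - Matrix.of A)⁻¹ 0 0‖ₑ
      ∂gaussianMat (d + 1) (d + 1) ≤ C := by
  have h1 : ∀ᵐ A ∂gaussianMat (d + 1) (d + 1),
      ‖(z • (1 : Matrix (Fin (d + 1)) (Fin (d + 1)) ℂ) - Matrix.of A)⁻¹ 0 0‖ₑ = ‖splitResolvent z
        (A 0, (fun i => A (Fin.succ i) 0, fun i j => A (Fin.succ i) (Fin.succ j)))‖ₑ := by
    filter_upwards [ae_inv_smul_one_sub_eq_splitResolvent z] with A hA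
    rw [hA]
  have hm := (measurable_splitResolvent (d := d) z).enorm
  rw [lintegral_congr_ae h1, (measurePreserving_splitFirstRowCol d).lintegral_comp hm]
  exact lintegral_enorm_splitResolvent_prod_le hC z

/-- The first row is integrated out first, with the rest of the matrix frozen, and the remaining
average is the Poisson expression. Size n + 2 makes the minor nonempty, as
`lintegral_exp_eq_poissonDefect` requires. -/
theorem integral_mul_inv_smul_one_sub_zero_zero (n : ℕ) (z : ℂ) :
    ∫ A, z * (z • (1 : Matrix (Fin (n + 2)) (Fin (n + 2)) ℂ) - Matrix.of A)⁻¹ 0 0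
      ∂gaussianMat (n + 2) (n + 2) = (1 - poissonDefect (n + 2) (‖z‖ ^ 2) : ℝ) := by
  have hm := (measurable_splitResolvent (d := n + 1) z).const_mul z
  have hmp := measurePreserving_splitFirstRowCol (n + 1)
  obtain ⟨C, hCt, hC⟩ := exists_lintegral_enorm_inv_sub_le
  have h1 : ∀ᵐ A ∂gaussianMat (n + 2) (n + 2),
      z * (z • (1 : Matrix (Fin (n + 2)) (Fin (n + 2)) ℂ) - Matrix.of A)⁻¹ 0 0 =
      z * splitResolvent z
        (A 0, (fun i => A (Fin.succ i) 0, fun i j => A (Fin.succ i) (Fin.succ j))) := by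
    filter_upwards [ae_inv_smul_one_sub_eq_splitResolvent z] with A hA
    rw [hA]
  have hint : Integrable (splitResolvent (d := n + 1) z)
      ((gaussianVec (n + 2)).prod ((gaussianVec (n + 1)).prod (gaussianMat (n + 1) (n + 1)))) := by
    exact ⟨(measurable_splitResolvent z).aestronglyMeasurable,
      (lintegral_enorm_splitResolvent_prod_le hC z).trans_lt hCt.lt_top⟩
  rw [integral_congr_ae h1]
  have h2 := integral_map (μ := gaussianMat (n + 2) (n + 2)) hmp.measurable.aemeasurable
    (f := fun p => z * splitResolvent z p) hm.aestronglyMeasurable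
  rw [← h2, hmp.map_eq, integral_prod_symm _ (hint.const_mul z)]
  simp_rw [integral_splitResolvent]
  rw [integral_complex_ofReal]
  congr 1
  have hm2 : Measurable fun q : (Fin (n + 1) → ℂ) × (Fin (n + 1) → Fin (n + 1) → ℂ) =>
      Real.exp (-(‖z‖ ^ 2 / (1 + ∑ i,
      ‖(z • (1 : Matrix (Fin (n + 1)) (Fin (n + 1)) ℂ) - Matrix.of q.2)⁻¹.mulVec q.1 i‖ ^ 2))) := by
    have := measurable_inv_smul_one_sub_mulVec (n := n + 1) z
    fun_prop
  have hle : ∀ q : (Fin (n + 1) → ℂ) × (Fin (n + 1) → Fin (n + 1) → ℂ),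
      Real.exp (-(‖z‖ ^ 2 / (1 + ∑ i,
      ‖(z • (1 : Matrix (Fin (n + 1)) (Fin (n + 1)) ℂ) - Matrix.of q.2)⁻¹.mulVec q.1 i‖ ^ 2)))
        ≤ 1 := by
    intro q
    rw [Real.exp_le_one_iff, neg_nonpos]
    exact div_nonneg (sq_nonneg _)
      (add_nonneg zero_le_one (Finset.sum_nonneg fun i _ => sq_nonneg _))
  have hint2 : Integrable (fun q : (Fin (n + 1) → ℂ) × (Fin (n + 1) → Fin (n + 1) → ℂ) =>
      Real.exp (-(‖z‖ ^ 2 / (1 + ∑ i,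
      ‖(z • (1 : Matrix (Fin (n + 1)) (Fin (n + 1)) ℂ) - Matrix.of q.2)⁻¹.mulVec q.1 i‖ ^ 2))))
      ((gaussianVec (n + 1)).prod (gaussianMat (n + 1) (n + 1))) := by
    refine Integrable.of_bound hm2.aestronglyMeasurable 1 (ae_of_all _ fun q => ?_)
    rw [Real.norm_of_nonneg (Real.exp_pos _).le]
    exact hle q
  rw [integral_sub (integrable_const _) hint2, integral_eq_lintegral_of_nonneg_ae
    (ae_of_all _ fun q => (Real.exp_pos _).le) hm2.aestronglyMeasurable,
    lintegral_exp_eq_poissonDefect, ENNReal.toReal_ofReal]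
  · simp
  · rw [poissonDefect]
    refine mul_nonneg (Real.exp_pos _).le (Finset.sum_nonneg fun j hj => ?_)
    have hj : (j : ℝ) ≤ (n + 2 : ℕ) := by exact_mod_cast (Finset.mem_range.mp hj).le
    have : (j : ℝ) / (n + 2 : ℕ) ≤ 1 := div_le_one_of_le₀ hj (by positivity)
    exact mul_nonneg (by linarith) (by positivity)

/-! ### The trace of the resolvent -/

/-- Simultaneous permutation of rows and columns, as a real linear equivalence. -/
noncomputable def permuteEquiv {n : ℕ} (e : Equiv.Perm (Fin n)) :
    (Fin n → Fin n → ℂ) ≃ₗ[ℝ] (Fin n → Fin n → ℂ) where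
  toFun A := fun i j => A (e i) (e j)
  invFun A := fun i j => A (e.symm i) (e.symm j)
  map_add' _ _ := rfl
  map_smul' _ _ := rfl
  left_inv A := by ext; simp
  right_inv A := by ext; simp

theorem measurePreserving_permuteEquiv {n : ℕ} (e : Equiv.Perm (Fin n)) :
    MeasurePreserving (permuteEquiv e) (gaussianMat n n) (gaussianMat n n) := by
  refine measurePreserving_gaussianMat _ fun A => ?_
  change ∑ i, ∑ j, ‖A (e i) (e j)‖ ^ 2 = _
  rw [Equiv.sum_comp e fun i => ∑ j, ‖A i (e j)‖ ^ 2]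
  exact Finset.sum_congr rfl fun i _ => Equiv.sum_comp e fun j => ‖A i j‖ ^ 2

/-- Swapping the indices 0 and i preserves the Gaussian law, so every diagonal entry of the
resolvent is distributed like the corner one. -/
theorem inv_smul_one_sub_permuteEquiv {n : ℕ} (z : ℂ) (i : Fin (n + 1))
    (A : Fin (n + 1) → Fin (n + 1) → ℂ) :
    (z • (1 : Matrix (Fin (n + 1)) (Fin (n + 1)) ℂ) -
      Matrix.of (permuteEquiv (Equiv.swap 0 i) A))⁻¹ 0 0 =
    (z • (1 : Matrix (Fin (n + 1)) (Fin (n + 1)) ℂ) - Matrix.of A)⁻¹ i i := by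
  have : z • (1 : Matrix (Fin (n + 1)) (Fin (n + 1)) ℂ) -
      Matrix.of (permuteEquiv (Equiv.swap 0 i) A) =
      (z • (1 : Matrix (Fin (n + 1)) (Fin (n + 1)) ℂ) - Matrix.of A).submatrix
        (Equiv.swap 0 i) (Equiv.swap 0 i) := by
    ext a b
    simp [Matrix.one_apply, permuteEquiv]
  rw [this, Matrix.inv_submatrix_equiv, Matrix.submatrix_apply, Equiv.swap_apply_left]

theorem measurable_inv_smul_one_sub_apply {n : ℕ} (i j : Fin n) :
    Measurable fun p : ℂ × (Fin n → Fin n → ℂ) =>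
      (p.1 • (1 : Matrix (Fin n) (Fin n) ℂ) - Matrix.of p.2)⁻¹ i j := by
  have hc : Continuous fun p : ℂ × (Fin n → Fin n → ℂ) =>
      (p.1 • (1 : Matrix (Fin n) (Fin n) ℂ) - Matrix.of p.2) :=
    (continuous_fst.smul continuous_const).sub continuous_snd
  have h1 : Measurable fun p : ℂ × (Fin n → Fin n → ℂ) =>
      (p.1 • (1 : Matrix (Fin n) (Fin n) ℂ) - Matrix.of p.2).adjugate i j :=
    (hc.matrix_adjugate.matrix_elem i j).measurable
  have h2 : Measurable fun p : ℂ × (Fin n → Fin n → ℂ) =>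
      (p.1 • (1 : Matrix (Fin n) (Fin n) ℂ) - Matrix.of p.2).det := hc.matrix_det.measurable
  simp_rw [Matrix.inv_def, Ring.inverse_eq_inv', Matrix.smul_apply]
  exact h2.inv.smul h1

/-- The trace of the resolvent. -/
noncomputable def resolventTrace {n : ℕ} (z : ℂ) (A : Fin n → Fin n → ℂ) : ℂ :=
  ((z • (1 : Matrix (Fin n) (Fin n) ℂ) - Matrix.of A)⁻¹).trace

theorem measurable_resolventTrace {n : ℕ} :
    Measurable fun p : ℂ × (Fin n → Fin n → ℂ) => resolventTrace p.1 p.2 := by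
  unfold resolventTrace Matrix.trace
  exact Finset.measurable_fun_sum _ fun i _ => measurable_inv_smul_one_sub_apply i i

theorem lintegral_enorm_inv_smul_one_sub_diag_le {d : ℕ} {C : ℝ≥0∞}
    (hC : ∀ z : ℂ, ∫⁻ g, ‖(z - g)⁻¹‖ₑ ∂stdComplexGaussian ≤ C) (z : ℂ) (i : Fin (d + 1)) :
    ∫⁻ A, ‖(z • (1 : Matrix (Fin (d + 1)) (Fin (d + 1)) ℂ) - Matrix.of A)⁻¹ i i‖ₑ
      ∂gaussianMat (d + 1) (d + 1) ≤ C := by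
  have hm : Measurable fun A : Fin (d + 1) → Fin (d + 1) → ℂ =>
      ‖(z • (1 : Matrix (Fin (d + 1)) (Fin (d + 1)) ℂ) - Matrix.of A)⁻¹ 0 0‖ₑ :=
    ((measurable_inv_smul_one_sub_apply 0 0).comp (measurable_const.prodMk measurable_id)).enorm
  simp_rw [← inv_smul_one_sub_permuteEquiv z i]
  rw [(measurePreserving_permuteEquiv (Equiv.swap 0 i)).lintegral_comp hm]
  exact lintegral_enorm_inv_smul_one_sub_zero_zero_le hC z

theorem integral_mul_inv_smul_one_sub_diag (n : ℕ) (z : ℂ) (i : Fin (n + 2)) :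
    ∫ A, z * (z • (1 : Matrix (Fin (n + 2)) (Fin (n + 2)) ℂ) - Matrix.of A)⁻¹ i i
      ∂gaussianMat (n + 2) (n + 2) = (1 - poissonDefect (n + 2) (‖z‖ ^ 2) : ℝ) := by
  rw [← integral_mul_inv_smul_one_sub_zero_zero n z]
  simp_rw [← inv_smul_one_sub_permuteEquiv z i]
  have hmp := measurePreserving_permuteEquiv (Equiv.swap (0 : Fin (n + 2)) i)
  have hm : Measurable fun A : Fin (n + 2) → Fin (n + 2) → ℂ =>
      z * (z • (1 : Matrix (Fin (n + 2)) (Fin (n + 2)) ℂ) - Matrix.of A)⁻¹ 0 0 :=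
    ((measurable_inv_smul_one_sub_apply 0 0).comp
      (measurable_const.prodMk measurable_id)).const_mul z
  have h := integral_map (μ := gaussianMat (n + 2) (n + 2)) hmp.measurable.aemeasurable
    hm.aestronglyMeasurable
  rw [hmp.map_eq] at h
  exact h.symm

theorem lintegral_enorm_resolventTrace_le {d : ℕ} {C : ℝ≥0∞}
    (hC : ∀ z : ℂ, ∫⁻ g, ‖(z - g)⁻¹‖ₑ ∂stdComplexGaussian ≤ C) (z : ℂ) :
    ∫⁻ A, ‖resolventTrace z A‖ₑ ∂gaussianMat (d + 1) (d + 1) ≤ (d + 1 : ℕ) * C := by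
  have hm : ∀ i, Measurable fun A : Fin (d + 1) → Fin (d + 1) → ℂ =>
      ‖(z • (1 : Matrix (Fin (d + 1)) (Fin (d + 1)) ℂ) - Matrix.of A)⁻¹ i i‖ₑ := fun i =>
    ((measurable_inv_smul_one_sub_apply i i).comp (measurable_const.prodMk measurable_id)).enorm
  calc ∫⁻ A, ‖resolventTrace z A‖ₑ ∂gaussianMat (d + 1) (d + 1)
      ≤ ∫⁻ A, ∑ i, ‖(z • (1 : Matrix (Fin (d + 1)) (Fin (d + 1)) ℂ) - Matrix.of A)⁻¹ i i‖ₑ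
          ∂gaussianMat (d + 1) (d + 1) := lintegral_mono fun A => enorm_sum_le _ _
    _ ≤ ∑ _i : Fin (d + 1), C := by
        rw [lintegral_finsetSum _ fun i _ => hm i]
        exact Finset.sum_le_sum fun i _ => lintegral_enorm_inv_smul_one_sub_diag_le hC z i
    _ = (d + 1 : ℕ) * C := by simp

theorem integral_mul_resolventTrace (n : ℕ) (z : ℂ) :
    ∫ A, z * resolventTrace z A ∂gaussianMat (n + 2) (n + 2) =
      ((n + 2 : ℕ) * (1 - poissonDefect (n + 2) (‖z‖ ^ 2)) : ℝ) := by
  obtain ⟨C, hCt, hC⟩ := exists_lintegral_enorm_inv_sub_le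
  have e : ∀ A : Fin (n + 2) → Fin (n + 2) → ℂ, z * resolventTrace z A =
      ∑ i, z * (z • (1 : Matrix (Fin (n + 2)) (Fin (n + 2)) ℂ) - Matrix.of A)⁻¹ i i := by
    intro A
    rw [resolventTrace, Matrix.trace, Finset.mul_sum]
    rfl
  simp_rw [e]
  rw [integral_finsetSum]
  · simp_rw [integral_mul_inv_smul_one_sub_diag]
    simp
    ring
  · intro i _
    refine Integrable.const_mul ⟨?_, ?_⟩ z
    · exact ((measurable_inv_smul_one_sub_apply i i).comp
        (measurable_const.prodMk measurable_id)).aestronglyMeasurable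
    · exact (lintegral_enorm_inv_smul_one_sub_diag_le hC z i).trans_lt hCt.lt_top

theorem resolventTrace_smul {n : ℕ} {c : ℂ} (hc : c ≠ 0) (z : ℂ) (A : Fin n → Fin n → ℂ)
    (h : ((z / c) • (1 : Matrix (Fin n) (Fin n) ℂ) - Matrix.of A).det ≠ 0) :
    resolventTrace z (c • A) = c⁻¹ * resolventTrace (z / c) A := by
  have e : z • (1 : Matrix (Fin n) (Fin n) ℂ) - Matrix.of (c • A)
      = c • ((z / c) • (1 : Matrix (Fin n) (Fin n) ℂ) - Matrix.of A) := by
    rw [smul_sub, smul_smul, mul_div_cancel₀ _ hc]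
    rfl
  have : Invertible c := invertibleOfNonzero hc
  rw [resolventTrace, resolventTrace, e, Matrix.inv_smul _ _ (isUnit_iff_ne_zero.mpr h),
    Matrix.trace_smul, invOf_eq_inv, smul_eq_mul]

theorem ae_resolventTrace_smul {n : ℕ} {c : ℂ} (hc : c ≠ 0) (z : ℂ) :
    ∀ᵐ A ∂gaussianMat n n, resolventTrace z (c • A) = c⁻¹ * resolventTrace (z / c) A := by
  filter_upwards [(gaussianMat_absolutelyContinuous n n).ae_le
    (ae_det_smul_one_sub_ne_zero (n := n) (z / c))] with A hA
  exact resolventTrace_smul hc z A hA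

/-! ### The resolvent trace as a logarithmic derivative -/

theorem eval_derivative_charpoly {n : ℕ} (M : Matrix (Fin n) (Fin n) ℂ) (z : ℂ)
    (h : (z • (1 : Matrix (Fin n) (Fin n) ℂ) - M).det ≠ 0) :
    M.charpoly.derivative.eval z = (z • (1 : Matrix (Fin n) (Fin n) ℂ) - M).det *
      ((z • (1 : Matrix (Fin n) (Fin n) ℂ) - M)⁻¹).trace := by
  set B := z • (1 : Matrix (Fin n) (Fin n) ℂ) - M with hB
  set q : Polynomial ℂ := (1 + (Polynomial.X : Polynomial ℂ) • B⁻¹.map Polynomial.C).det with hq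
  -- Shifted to z, the characteristic polynomial is det B · det (1 + t B⁻¹), whose derivative at t =
  -- 0 is det B · tr B⁻¹.
  have hcomp : M.charpoly.comp (Polynomial.X + Polynomial.C z) = Polynomial.C B.det * q := by
    refine Polynomial.funext fun t => ?_
    rw [Polynomial.eval_comp, Polynomial.eval_mul, Matrix.eval_charpoly, Polynomial.eval_C]
    have hqe : q.eval t = (1 + t • B⁻¹).det := by
      rw [hq, ← Polynomial.coe_evalRingHom, RingHom.map_det]
      congr 1
      ext i j
      simp [Matrix.one_apply, apply_ite, mul_comm t]
    rw [hqe, ← Matrix.det_mul, mul_add, mul_one, Matrix.mul_smul,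
      Matrix.mul_nonsing_inv _ (isUnit_iff_ne_zero.mpr h)]
    congr 1
    simp only [Polynomial.eval_add, Polynomial.eval_X, Polynomial.eval_C, Matrix.scalar_apply]
    rw [← Matrix.smul_one_eq_diagonal, add_smul, hB]
    abel
  have hd := congrArg (fun p => (Polynomial.derivative p).eval 0) hcomp
  simp only [Polynomial.derivative_comp, Polynomial.derivative_add, Polynomial.derivative_X,
    Polynomial.derivative_C, Polynomial.eval_mul, Polynomial.eval_comp, Polynomial.eval_add,
    Polynomial.eval_X, Polynomial.eval_C, zero_add, Polynomial.derivative_C_mul] at hd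
  rw [hq, Matrix.derivative_det_one_add_X_smul] at hd
  simpa using hd

theorem resolventTrace_eq_sum_roots {n : ℕ} (A : Fin n → Fin n → ℂ) (z : ℂ)
    (h : (z • (1 : Matrix (Fin n) (Fin n) ℂ) - Matrix.of A).det ≠ 0) :
    resolventTrace z A = ((Matrix.of A).charpoly.roots.map fun v => 1 / (z - v)).sum := by
  have heval : (Matrix.of A).charpoly.eval z
      = (z • (1 : Matrix (Fin n) (Fin n) ℂ) - Matrix.of A).det := by
    rw [Matrix.eval_charpoly, Matrix.scalar_apply, ← Matrix.smul_one_eq_diagonal]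
  rw [← (IsAlgClosed.splits (Matrix.of A).charpoly).eval_derivative_div_eval_of_ne_zero
    (by rw [heval]; exact h), eval_derivative_charpoly _ _ h, heval, mul_div_cancel_left₀ _ h]
  rfl

theorem setIntegral_multiset_sum_div_sub (s : Multiset ℂ) (w : ℂ) {r : ℝ} (hr : 0 ≤ r) :
    IntegrableOn (fun z => (z - w) * (s.map fun v => 1 / (z - v)).sum) (Metric.ball w r) ∧
    ∫ z in Metric.ball w r, (z - w) * (s.map fun v => 1 / (z - v)).sum =
      ((Real.pi * (s.map fun v => max (r ^ 2 - ‖v - w‖ ^ 2) 0).sum : ℝ) : ℂ) := by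
  induction s using Multiset.induction with
  | empty => simp
  | cons v s ih =>
    have h1 := integrableOn_div_sub w v w r
    simp only [Multiset.map_cons, Multiset.sum_cons, mul_add, mul_one_div]
    refine ⟨h1.add ih.1, ?_⟩
    rw [integral_add h1 ih.1, ih.2, setIntegral_ball_div_sub v w hr]
    push_cast
    rfl

/-- Off the finite spectrum the trace is ∑ 1 / (z - v), and each pole contributes one bump. -/
theorem setIntegral_resolventTrace {n : ℕ} (A : Fin n → Fin n → ℂ) (w : ℂ) {r : ℝ} (hr : 0 ≤ r) :
    ∫ z in Metric.ball w r, (z - w) * resolventTrace z A =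
      ((Real.pi * ((Matrix.of A).charpoly.roots.map fun v =>
        max (r ^ 2 - ‖v - w‖ ^ 2) 0).sum : ℝ) : ℂ) := by
  rw [← (setIntegral_multiset_sum_div_sub _ w hr).2]
  refine setIntegral_congr_ae Metric.isOpen_ball.measurableSet ?_
  have h := (finite_setOf_det_smul_one_sub_eq_zero (Matrix.of A)).measure_zero volume
  have h' : ∀ᵐ z : ℂ, (z • (1 : Matrix (Fin n) (Fin n) ℂ) - Matrix.of A).det ≠ 0 := by
    rw [ae_iff]; simpa using h
  filter_upwards [h'] with z hz _
  rw [resolventTrace_eq_sum_roots A z hz]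

attribute [irreducible] resolventTrace

theorem measurable_resolventTrace_smul {n : ℕ} (c : ℂ) :
    Measurable fun p : ℂ × (Fin n → Fin n → ℂ) => resolventTrace p.1 (c • p.2) := by
  have h : Measurable fun p : ℂ × (Fin n → Fin n → ℂ) => (p.1, c • p.2) :=
    measurable_fst.prodMk (measurable_snd.const_smul c)
  exact measurable_resolventTrace.comp h

/-- The expectation of a sum of test functions over the eigenvalues of a scaled Ginibre matrix. -/
theorem integral_sum_roots_smul (n : ℕ) {c : ℝ} (hc : 0 < c) (w : ℂ) {r : ℝ} (hr : 0 ≤ r) :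
    ∫ A, ((Real.pi * ((Matrix.of ((c : ℂ) • A)).charpoly.roots.map fun v =>
        max (r ^ 2 - ‖v - w‖ ^ 2) 0).sum : ℝ) : ℂ) ∂gaussianMat (n + 2) (n + 2) =
      ∫ z in Metric.ball w r, (z - w) / z *
        ((n + 2 : ℕ) * (1 - poissonDefect (n + 2) (‖z‖ ^ 2 / c ^ 2)) : ℝ) := by
  have hcc : (c : ℂ) ≠ 0 := by exact_mod_cast hc.ne'
  obtain ⟨C, hCt, hC⟩ := exists_lintegral_enorm_inv_sub_le
  have hbound : ∀ z : ℂ, ∫⁻ A, ‖resolventTrace z ((c : ℂ) • A)‖ₑ ∂gaussianMat (n + 2) (n + 2)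
      ≤ ‖(c : ℂ)⁻¹‖ₑ * ((n + 2 : ℕ) * C) := by
    intro z
    have : ∀ᵐ A ∂gaussianMat (n + 2) (n + 2), ‖resolventTrace z ((c : ℂ) • A)‖ₑ
        = ‖(c : ℂ)⁻¹‖ₑ * ‖resolventTrace (z / c) A‖ₑ := by
      filter_upwards [ae_resolventTrace_smul hcc z] with A hA
      rw [hA, enorm_mul]
    rw [lintegral_congr_ae this, lintegral_const_mul' _ _ (by simp)]
    gcongr
    exact lintegral_enorm_resolventTrace_le hC (z / c)
  have hmeas : Measurable fun p : ℂ × (Fin (n + 2) → Fin (n + 2) → ℂ) =>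
      (p.1 - w) * resolventTrace p.1 ((c : ℂ) • p.2) := by
    exact (measurable_fst.sub_const w).mul (measurable_resolventTrace_smul (c : ℂ))
  -- Joint integrability comes from the bound on the mean resolvent, uniform in z, over a disc of
  -- finite area.
  have hprod : Integrable (fun p : ℂ × (Fin (n + 2) → Fin (n + 2) → ℂ) =>
      (p.1 - w) * resolventTrace p.1 ((c : ℂ) • p.2))
      ((volume.restrict (Metric.ball w r)).prod (gaussianMat (n + 2) (n + 2))) := by
    refine ⟨hmeas.aestronglyMeasurable, ?_⟩
    rw [HasFiniteIntegral, lintegral_prod _ hmeas.enorm.aemeasurable]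
    have hle : ∫⁻ z in Metric.ball w r, ∫⁻ A, ‖(z - w) * resolventTrace z ((c : ℂ) • A)‖ₑ
        ∂gaussianMat (n + 2) (n + 2) ≤ ∫⁻ z in Metric.ball w r,
          ENNReal.ofReal r * (‖(c : ℂ)⁻¹‖ₑ * ((n + 2 : ℕ) * C)) := by
      refine setLIntegral_mono (by fun_prop) fun z hz => ?_
      simp_rw [enorm_mul]
      rw [lintegral_const_mul' _ _ (by simp)]
      refine mul_le_mul' ?_ (hbound z)
      rw [← ofReal_norm]
      exact ENNReal.ofReal_le_ofReal (mem_ball_iff_norm.mp hz).le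
    refine hle.trans_lt ?_
    rw [setLIntegral_const]
    refine ENNReal.mul_lt_top ?_ measure_ball_lt_top
    exact ENNReal.mul_lt_top ENNReal.ofReal_lt_top
      (ENNReal.mul_lt_top (by simp) (ENNReal.mul_lt_top (by simp) hCt.lt_top))
  simp_rw [← setIntegral_resolventTrace _ w hr]
  rw [← integral_integral_swap hprod]
  refine integral_congr_ae (ae_restrict_of_ae ?_)
  filter_upwards [ae_ne_complex 0] with z hz
  have h1 : ∀ᵐ A ∂gaussianMat (n + 2) (n + 2), (z - w) * resolventTrace z ((c : ℂ) • A)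
      = ((z - w) / z) * ((z / c) * resolventTrace (z / c) A) := by
    filter_upwards [ae_resolventTrace_smul hcc z] with A hA
    rw [hA]
    field_simp
  rw [integral_congr_ae h1, integral_const_mul, integral_mul_resolventTrace, norm_div,
    Complex.norm_real, Real.norm_of_nonneg hc.le, div_pow]

/-! ### Concentration of the Poisson distribution -/

theorem hasSum_pow_div_factorial (x : ℝ) :
    HasSum (fun j : ℕ => x ^ j / (j.factorial : ℝ)) (Real.exp x) := by
  rw [Real.exp_eq_exp_ℝ]
  exact NormedSpace.expSeries_div_hasSum_exp x

theorem hasSum_nat_mul_pow_div_factorial (x : ℝ) :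
    HasSum (fun j : ℕ => (j : ℝ) * (x ^ j / (j.factorial : ℝ))) (x * Real.exp x) := by
  rw [← hasSum_nat_add_iff' 1]
  have h := (hasSum_pow_div_factorial x).mul_left x
  have e : (fun j : ℕ => ((j + 1 : ℕ) : ℝ) * (x ^ (j + 1) / ((j + 1).factorial : ℝ))) =
      fun j : ℕ => x * (x ^ j / (j.factorial : ℝ)) := by
    ext j
    rw [Nat.factorial_succ]
    push_cast
    field_simp
    ring
  rw [e]
  simpa using h

theorem hasSum_nat_mul_sub_one_mul_pow_div_factorial (x : ℝ) :
    HasSum (fun j : ℕ => (j : ℝ) * (j - 1) * (x ^ j / (j.factorial : ℝ))) (x ^ 2 * Real.exp x) := by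
  rw [← hasSum_nat_add_iff' 1]
  have h := (hasSum_nat_mul_pow_div_factorial x).mul_left x
  have e : (fun j : ℕ => ((j + 1 : ℕ) : ℝ) * (((j + 1 : ℕ) : ℝ) - 1) *
      (x ^ (j + 1) / ((j + 1).factorial : ℝ))) =
      fun j : ℕ => x * ((j : ℝ) * (x ^ j / (j.factorial : ℝ))) := by
    ext j
    rw [Nat.factorial_succ]
    push_cast
    field_simp
    ring
  rw [e, sq, mul_assoc]
  simpa using h

/-- The Poisson variance, from (j - x)² = j (j - 1) + (1 - 2x) j + x² and the factorial moments. -/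
theorem hasSum_sq_sub_mul_pow_div_factorial (x : ℝ) :
    HasSum (fun j : ℕ => ((j : ℝ) - x) ^ 2 * (Real.exp (-x) * (x ^ j / (j.factorial : ℝ)))) x := by
  have h := (((hasSum_nat_mul_sub_one_mul_pow_div_factorial x).add
    ((hasSum_nat_mul_pow_div_factorial x).mul_left (1 - 2 * x))).add
    ((hasSum_pow_div_factorial x).mul_left (x ^ 2))).mul_left (Real.exp (-x))
  have he : Real.exp (-x) * Real.exp x = 1 := by rw [← Real.exp_add]; simp
  have e : Real.exp (-x) * (x ^ 2 * Real.exp x + (1 - 2 * x) * (x * Real.exp x) +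
      x ^ 2 * Real.exp x) = x := by
    linear_combination x * he
  rw [e] at h
  refine h.congr_fun ?_
  intro j
  ring

theorem hasSum_poissonDefect {N : ℕ} (hN : 0 < N) (x : ℝ) :
    HasSum (fun j : ℕ => max (1 - (j : ℝ) / N) 0 * (Real.exp (-x) * (x ^ j / (j.factorial : ℝ))))
      (poissonDefect N x) := by
  have hN' : (0 : ℝ) < N := by exact_mod_cast hN
  have h := hasSum_sum_of_ne_finset_zero (L := .unconditional ℕ) (s := Finset.range N)
    (f := fun j : ℕ => max (1 - (j : ℝ) / N) 0 * (Real.exp (-x) * (x ^ j / (j.factorial : ℝ))))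
    (fun j hj => by
      have : (N : ℝ) ≤ j := by exact_mod_cast Finset.mem_range.not.mp hj |> not_lt.mp
      rw [max_eq_right (by rw [sub_nonpos, le_div_iff₀ hN']; linarith), zero_mul])
  convert h using 1
  rw [poissonDefect, Finset.mul_sum]
  refine Finset.sum_congr rfl fun j hj => ?_
  have : (j : ℝ) ≤ N := by exact_mod_cast (Finset.mem_range.mp hj).le
  rw [max_eq_left (by rw [sub_nonneg, div_le_one hN']; exact this)]
  ring

/-- The map j ↦ (1 - j/N)₊ is 1/N-Lipschitz, so the error is at most E|X - Nt| / N. The bound |u| ≤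
(s² + u²) / (2s) with s = √N reduces this to the variance Nt. -/
theorem abs_poissonDefect_sub_le {N : ℕ} (hN : 0 < N) {t : ℝ} (ht : 0 ≤ t) :
    |poissonDefect N (N * t) - max (1 - t) 0| ≤ (1 + t) / (2 * Real.sqrt N) := by
  have hN' : (0 : ℝ) < N := by exact_mod_cast hN
  set s := Real.sqrt N with hs
  have hs0 : 0 < s := Real.sqrt_pos.mpr hN'
  have hss : s * s = N := Real.mul_self_sqrt hN'.le
  set x : ℝ := N * t with hx
  have hx0 : 0 ≤ x := by positivity
  have h1 : HasSum (fun j : ℕ => Real.exp (-x) * (x ^ j / (j.factorial : ℝ))) 1 := by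
    have h := (hasSum_pow_div_factorial x).mul_left (Real.exp (-x))
    rwa [← Real.exp_add, neg_add_cancel, Real.exp_zero] at h
  have hd := (hasSum_poissonDefect hN x).sub (h1.mul_left (max (1 - t) 0))
  have hb := (h1.mul_left (s / (2 * N))).add
    ((hasSum_sq_sub_mul_pow_div_factorial x).mul_left (1 / (2 * N * s)))
  rw [mul_one] at hd hb
  have hbe : s / (2 * N) + 1 / (2 * N * s) * x = (1 + t) / (2 * s) := by
    rw [hx, ← hss]
    field_simp
  rw [hbe] at hb
  have key : ∀ j : ℕ, |max (1 - (j : ℝ) / N) 0 - max (1 - t) 0| ≤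
      s / (2 * N) + 1 / (2 * N * s) * ((j : ℝ) - x) ^ 2 := by
    intro j
    refine (abs_max_sub_max_le_abs _ _ _).trans ?_
    have e : 1 - (j : ℝ) / N - (1 - t) = -(((j : ℝ) - x) / N) := by
      rw [hx]; field_simp; ring
    rw [e, abs_neg, abs_div, abs_of_pos hN']
    have e2 : s / (2 * N) + 1 / (2 * N * s) * ((j : ℝ) - x) ^ 2
        = ((s ^ 2 + |(j : ℝ) - x| ^ 2) / (2 * s)) / N := by
      rw [sq_abs]; field_simp
    rw [e2]
    gcongr
    rw [le_div_iff₀ (by positivity)]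
    nlinarith [sq_nonneg (s - |(j : ℝ) - x|)]
  have hw : ∀ j : ℕ, 0 ≤ Real.exp (-x) * (x ^ j / (j.factorial : ℝ)) := fun j => by positivity
  rw [abs_le]
  constructor
  · refine hasSum_le (fun j => ?_) hb.neg hd
    have := mul_le_mul_of_nonneg_right (abs_le.mp (key j)).1 (hw j)
    linarith
  · refine hasSum_le (fun j => ?_) hd hb
    have := mul_le_mul_of_nonneg_right (abs_le.mp (key j)).2 (hw j)
    linarith

/-! ### Smoothing by paraboloid bumps -/

/-- The paraboloid bump of radius `r` around `w`. -/
noncomputable def bump (r : ℝ) (w v : ℂ) : ℝ := max (r ^ 2 - ‖v - w‖ ^ 2) 0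

theorem continuous_bump (r : ℝ) : Continuous fun p : ℂ × ℂ => bump r p.1 p.2 := by
  unfold bump
  fun_prop

theorem bump_nonneg (r : ℝ) (w v : ℂ) : 0 ≤ bump r w v := le_max_right _ _

theorem bump_le (r : ℝ) (w v : ℂ) : bump r w v ≤ r ^ 2 :=
  max_le (by nlinarith [sq_nonneg ‖v - w‖]) (sq_nonneg r)

theorem bump_eq_zero {r : ℝ} (hr : 0 ≤ r) {w v : ℂ} (h : r ≤ ‖v - w‖) : bump r w v = 0 :=
  max_eq_right (by nlinarith)

theorem bump_eq_sub (r : ℝ) (w v : ℂ) : bump r w v = bump r 0 (v - w) := by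
  simp [bump]

theorem integrable_bump_mul {r : ℝ} (hr : 0 ≤ r) (v : ℂ) {f : ℂ → ℝ} (hf : Continuous f) :
    Integrable fun w => bump r w v * f w := by
  refine Continuous.integrable_of_hasCompactSupport ?_ ?_
  · exact ((continuous_bump r).comp (continuous_id.prodMk continuous_const)).mul hf
  · refine HasCompactSupport.intro (isCompact_closedBall v r) fun w hw => ?_
    rw [mem_closedBall_iff_norm, not_le, norm_sub_rev] at hw
    rw [bump_eq_zero hr hw.le, zero_mul]

theorem integrable_bump {r : ℝ} (hr : 0 ≤ r) (v : ℂ) : Integrable fun w => bump r w v := by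
  simpa using integrable_bump_mul hr v (continuous_const (y := (1 : ℝ)))

theorem integral_bump (r : ℝ) (v : ℂ) : ∫ w, bump r w v = ∫ w, bump r w 0 := by
  have h := integral_sub_left_eq_self (fun w => bump r 0 w) volume v
  have h0 := integral_sub_left_eq_self (fun w => bump r 0 w) volume (0 : ℂ)
  simp_rw [← bump_eq_sub] at h h0
  rw [h, h0]

theorem integral_bump_pos {r : ℝ} (hr : 0 < r) : 0 < ∫ w, bump r w 0 := by
  rw [integral_pos_iff_support_of_nonneg (fun w => bump_nonneg r w 0) (integrable_bump hr.le 0)]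
  have hc : Continuous fun w => bump r w 0 :=
    (continuous_bump r).comp (continuous_id.prodMk continuous_const)
  refine hc.isOpen_support.measure_pos volume ⟨0, ?_⟩
  have : 0 < r ^ 2 := by positivity
  simp [bump, hr.ne']

/-- The average of `f` against the paraboloid bump of radius `r`. -/
noncomputable def bumpAverage (r : ℝ) (f : ℂ → ℝ) (v : ℂ) : ℝ :=
  (∫ w, bump r w 0)⁻¹ * ∫ w, bump r w v * f w

theorem abs_bumpAverage_sub_le {r ε : ℝ} (hr : 0 < r) {f : ℂ → ℝ} (hf : Continuous f) {v : ℂ}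
    (h : ∀ w, ‖v - w‖ < r → |f w - f v| ≤ ε) : |bumpAverage r f v - f v| ≤ ε := by
  have hc := integral_bump_pos hr
  set c := ∫ w, bump r w 0 with hcdef
  have e : bumpAverage r f v - f v = c⁻¹ * ∫ w, bump r w v * (f w - f v) := by
    have h1 : ∫ w, bump r w v * (f w - f v) = (∫ w, bump r w v * f w) - c * f v := by
      simp_rw [mul_sub]
      rw [integral_sub (integrable_bump_mul hr.le v hf)
        ((integrable_bump hr.le v).mul_const _), integral_mul_const, integral_bump]
    rw [h1, bumpAverage, mul_sub, inv_mul_cancel_left₀ hc.ne']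
  rw [e, abs_mul, abs_of_pos (inv_pos.mpr hc), inv_mul_le_iff₀ hc, hcdef, ← integral_bump r v,
    ← integral_mul_const, ← Real.norm_eq_abs]
  refine norm_integral_le_of_norm_le ((integrable_bump hr.le v).mul_const _)
    (ae_of_all _ fun w => ?_)
  rw [norm_mul, Real.norm_of_nonneg (bump_nonneg r w v)]
  by_cases hw : ‖v - w‖ < r
  · exact mul_le_mul_of_nonneg_left (h w hw) (bump_nonneg r w v)
  · rw [bump_eq_zero hr.le (not_lt.mp hw), zero_mul, zero_mul]

theorem tendsto_bumpAverage {f : ℂ → ℝ} (hf : Continuous f) (v : ℂ) :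
    Tendsto (fun k : ℕ => bumpAverage (1 / ((k : ℝ) + 1)) f v) atTop (𝓝 (f v)) := by
  rw [Metric.tendsto_atTop]
  intro ε hε
  obtain ⟨δ, hδ, h⟩ := Metric.continuousAt_iff.mp hf.continuousAt (ε / 2) (half_pos hε)
  obtain ⟨K, hK⟩ := exists_nat_one_div_lt hδ
  refine ⟨K, fun k hk => ?_⟩
  rw [Real.dist_eq]
  refine (abs_bumpAverage_sub_le (by positivity) hf (ε := ε / 2) fun w hw => ?_).trans_lt
    (half_lt_self hε)
  refine (h ?_).le
  rw [dist_eq_norm, norm_sub_rev]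
  have : 1 / ((k : ℝ) + 1) ≤ 1 / ((K : ℝ) + 1) := by gcongr
  linarith

/-! ### Measurability of linear statistics of the eigenvalues -/

/-- Measurability without a measurable choice of eigenvalues: the statistic is an integral of the
resolvent trace, which is rational in the data. Recentring at w makes the domain of integration
independent of the parameter. -/
theorem measurable_sum_roots_bump {n : ℕ} {r : ℝ} (hr : 0 ≤ r) :
    Measurable fun p : ℂ × (Fin n → Fin n → ℂ) =>
      ((Matrix.of p.2).charpoly.roots.map (bump r p.1)).sum := by
  have hm : StronglyMeasurable fun q : (ℂ × (Fin n → Fin n → ℂ)) × ℂ =>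
      q.2 * resolventTrace (q.1.1 + q.2) q.1.2 := by
    have h : Measurable fun q : (ℂ × (Fin n → Fin n → ℂ)) × ℂ => (q.1.1 + q.2, q.1.2) :=
      ((measurable_fst.comp measurable_fst).add measurable_snd).prodMk
        (measurable_snd.comp measurable_fst)
    exact (measurable_snd.mul (measurable_resolventTrace.comp h)).stronglyMeasurable
  have h := (hm.integral_prod_right' (ν := volume.restrict (Metric.ball (0 : ℂ) r))).measurable
  have e : ∀ p : ℂ × (Fin n → Fin n → ℂ),
      ((Matrix.of p.2).charpoly.roots.map (bump r p.1)).sum =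
      Real.pi⁻¹ * (∫ u in Metric.ball 0 r, u * resolventTrace (p.1 + u) p.2).re := by
    intro p
    have h1 : ∫ u in Metric.ball 0 r, u * resolventTrace (p.1 + u) p.2 =
        ∫ z in Metric.ball p.1 r, (z - p.1) * resolventTrace z p.2 := by
      rw [← integral_indicator Metric.isOpen_ball.measurableSet,
        ← integral_indicator Metric.isOpen_ball.measurableSet,
        ← integral_add_left_eq_self (Set.indicator (Metric.ball p.1 r) _) p.1]
      refine integral_congr_ae (ae_of_all _ fun u => ?_)
      simp only [Set.indicator, Metric.mem_ball, dist_zero_right, dist_self_add_left,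
        add_sub_cancel_left]
    rw [h1, setIntegral_resolventTrace _ _ hr, Complex.ofReal_re,
      inv_mul_cancel_left₀ Real.pi_ne_zero]
    rfl
  simp_rw [e]
  exact (Complex.measurable_re.comp h).const_mul _

theorem sum_map_bumpAverage (s : Multiset ℂ) {r : ℝ} (hr : 0 ≤ r) {f : ℂ → ℝ}
    (hf : Continuous f) :
    Integrable (fun w => (s.map (bump r w)).sum * f w) ∧ (s.map (bumpAverage r f)).sum =
      (∫ w, bump r w 0)⁻¹ * ∫ w, (s.map (bump r w)).sum * f w := by
  induction s using Multiset.induction with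
  | empty => simp
  | cons v s ih =>
    have h1 := integrable_bump_mul hr v hf
    simp only [Multiset.map_cons, Multiset.sum_cons, add_mul]
    refine ⟨h1.add ih.1, ?_⟩
    rw [integral_add h1 ih.1, ih.2, bumpAverage, mul_add]

theorem tendsto_multiset_sum_map {f : ℕ → ℂ → ℝ} {g : ℂ → ℝ}
    (h : ∀ v, Tendsto (fun k => f k v) atTop (𝓝 (g v))) (s : Multiset ℂ) :
    Tendsto (fun k => (s.map (f k)).sum) atTop (𝓝 (s.map g).sum) := by
  induction s using Multiset.induction with
  | empty => simp
  | cons v s ih => simpa using (h v).add ih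

/-- Averages of f against shrinking bumps converge pointwise to f, and their eigenvalue sums are
integrals of the measurable bump sums. -/
theorem measurable_sum_roots {n : ℕ} {f : ℂ → ℝ} (hf : Continuous f) :
    Measurable fun A : Fin n → Fin n → ℂ => ((Matrix.of A).charpoly.roots.map f).sum := by
  refine measurable_of_tendsto_metrizable
    (f := fun k A => ((Matrix.of A).charpoly.roots.map (bumpAverage (1 / ((k : ℝ) + 1)) f)).sum)
    (fun k => ?_) (tendsto_pi_nhds.mpr fun A =>
      tendsto_multiset_sum_map (fun v => tendsto_bumpAverage hf v) _)
  have hr : 0 ≤ 1 / ((k : ℝ) + 1) := by positivity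
  simp_rw [(sum_map_bumpAverage _ hr hf).2]
  have hm : StronglyMeasurable fun q : (Fin n → Fin n → ℂ) × ℂ =>
      ((Matrix.of q.1).charpoly.roots.map (bump (1 / ((k : ℝ) + 1)) q.2)).sum * f q.2 :=
    (((measurable_sum_roots_bump hr).comp measurable_swap).mul
      (hf.measurable.comp measurable_snd)).stronglyMeasurable
  exact (hm.integral_prod_right' (ν := volume)).measurable.const_mul _

/-! ### Eigenvalue distributions as random measures -/

theorem lintegral_multiset_sum_dirac (s : Multiset ℂ) {f : ℂ → ℝ} (hf : ∀ v, 0 ≤ f v)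
    (hm : Measurable f) : ∫⁻ v, ENNReal.ofReal (f v) ∂(s.map fun z => Measure.dirac z).sum =
      ENNReal.ofReal (s.map f).sum := by
  induction s using Multiset.induction with
  | empty => simp
  | cons v s ih =>
    rw [Multiset.map_cons, Multiset.sum_cons, lintegral_add_measure, ih,
      lintegral_dirac' _ hm.ennreal_ofReal, Multiset.map_cons, Multiset.sum_cons,
      ENNReal.ofReal_add (hf v) (Multiset.sum_nonneg fun x hx => ?_)]
    obtain ⟨u, -, rfl⟩ := Multiset.mem_map.mp hx
    exact hf u

theorem lintegral_eigenvalueDistribution {n : ℕ} (A : Matrix (Fin n) (Fin n) ℂ) {f : ℂ → ℝ}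
    (hf : ∀ v, 0 ≤ f v) (hm : Measurable f) :
    ∫⁻ v, ENNReal.ofReal (f v) ∂eigenvalueDistribution A =
      (n : ℝ≥0∞)⁻¹ * ENNReal.ofReal (A.charpoly.roots.map f).sum := by
  rw [eigenvalueDistribution, lintegral_smul_measure, lintegral_multiset_sum_dirac _ hf hm,
    smul_eq_mul]

theorem card_roots_charpoly {n : ℕ} (A : Matrix (Fin n) (Fin n) ℂ) :
    Multiset.card A.charpoly.roots = n := by
  rw [← (IsAlgClosed.splits A.charpoly).natDegree_eq_card_roots, Matrix.charpoly_natDegree_eq_dim,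
    Fintype.card_fin]

theorem isProbabilityMeasure_eigenvalueDistribution {n : ℕ} (hn : n ≠ 0)
    (A : Matrix (Fin n) (Fin n) ℂ) : IsProbabilityMeasure (eigenvalueDistribution A) := by
  constructor
  have h := lintegral_eigenvalueDistribution A (f := fun _ => 1) (fun _ => zero_le_one)
    measurable_const
  have hn' : (n : ℝ≥0∞) ≠ 0 := by exact_mod_cast hn
  rw [ENNReal.ofReal_one, lintegral_one] at h
  rw [h, Multiset.map_const', Multiset.sum_replicate, card_roots_charpoly, nsmul_one,
    ENNReal.ofReal_natCast, ENNReal.inv_mul_cancel hn' (ENNReal.natCast_ne_top n)]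

/-- It suffices to test closed sets, whose indicators are limits of continuous thickened indicators.
-/
theorem measurable_eigenvalueDistribution {n : ℕ} (hn : n ≠ 0) :
    Measurable fun A : Fin n → Fin n → ℂ => eigenvalueDistribution (Matrix.of A) := by
  have hp : ∀ A : Fin n → Fin n → ℂ,
      IsProbabilityMeasure (eigenvalueDistribution (Matrix.of A)) :=
    fun A => isProbabilityMeasure_eigenvalueDistribution hn _
  refine Measurable.measure_of_isPiSystem_of_isProbabilityMeasure
    ((BorelSpace.measurable_eq (α := ℂ)).trans borel_eq_generateFrom_isClosed)
    isPiSystem_isClosed fun F hF => ?_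
  have hδ : ∀ k : ℕ, (0 : ℝ) < 1 / ((k : ℝ) + 1) := fun k => by positivity
  refine measurable_of_tendsto_metrizable (fun k => ?_) (tendsto_pi_nhds.mpr fun A =>
    tendsto_lintegral_thickenedIndicator_of_isClosed _ hF hδ tendsto_one_div_add_atTop_nhds_zero_nat)
  have hc : Continuous fun v => ((thickenedIndicator (hδ k) F v : NNReal) : ℝ) :=
    NNReal.continuous_coe.comp (thickenedIndicator (hδ k) F).continuous
  have e : ∀ A : Fin n → Fin n → ℂ, ∫⁻ v, (thickenedIndicator (hδ k) F v : ℝ≥0∞)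
      ∂eigenvalueDistribution (Matrix.of A) = (n : ℝ≥0∞)⁻¹ * ENNReal.ofReal
        ((Matrix.of A).charpoly.roots.map
          fun v => ((thickenedIndicator (hδ k) F v : NNReal) : ℝ)).sum := by
    intro A
    rw [← lintegral_eigenvalueDistribution _ (fun v => NNReal.coe_nonneg _) hc.measurable]
    simp_rw [ENNReal.ofReal_coe_nnreal]
  simp_rw [e]
  exact (measurable_sum_roots hc).ennreal_ofReal.const_mul _

/-- The mean eigenvalue distribution of a Ginibre matrix scaled by `c`. -/
noncomputable def meanEigenvalueDistribution (n : ℕ) (c : ℂ) : Measure ℂ :=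
  (gaussianMat n n).bind fun A => eigenvalueDistribution (Matrix.of (c • A))

theorem measurable_eigenvalueDistribution_smul {n : ℕ} (hn : n ≠ 0) (c : ℂ) :
    Measurable fun A : Fin n → Fin n → ℂ => eigenvalueDistribution (Matrix.of (c • A)) :=
  (measurable_eigenvalueDistribution hn).comp (measurable_id.const_smul c)

theorem isProbabilityMeasure_meanEigenvalueDistribution {n : ℕ} (hn : n ≠ 0) (c : ℂ) :
    IsProbabilityMeasure (meanEigenvalueDistribution n c) :=
  isProbabilityMeasure_bind (measurable_eigenvalueDistribution_smul hn c).aemeasurable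
    (ae_of_all _ fun _ => isProbabilityMeasure_eigenvalueDistribution hn _)

theorem integral_meanEigenvalueDistribution {n : ℕ} (hn : n ≠ 0) (c : ℂ) {f : ℂ → ℝ}
    (hf : ∀ v, 0 ≤ f v) (hc : Continuous f) :
    ∫ v, f v ∂meanEigenvalueDistribution n c =
      ∫ A, (n : ℝ)⁻¹ * ((Matrix.of (c • A)).charpoly.roots.map f).sum ∂gaussianMat n n := by
  have hnn : ∀ A : Fin n → Fin n → ℂ,
      0 ≤ ((Matrix.of (c • A)).charpoly.roots.map f).sum := fun A =>
    Multiset.sum_nonneg fun x hx => by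
      obtain ⟨u, -, rfl⟩ := Multiset.mem_map.mp hx
      exact hf u
  have hm : Measurable fun A : Fin n → Fin n → ℂ =>
      ((Matrix.of (c • A)).charpoly.roots.map f).sum :=
    (measurable_sum_roots hc).comp (measurable_id.const_smul c)
  rw [integral_eq_lintegral_of_nonneg_ae (ae_of_all _ hf) hc.aestronglyMeasurable,
    integral_eq_lintegral_of_nonneg_ae (ae_of_all _ fun A => mul_nonneg (by positivity) (hnn A))
      (hm.const_mul _).aestronglyMeasurable, meanEigenvalueDistribution,
    Measure.lintegral_bind (measurable_eigenvalueDistribution_smul hn c).aemeasurable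
      hc.measurable.ennreal_ofReal.aemeasurable]
  congr 1
  refine lintegral_congr fun A => ?_
  rw [lintegral_eigenvalueDistribution _ hf hc.measurable, ENNReal.ofReal_mul (by positivity),
    ENNReal.ofReal_inv_of_pos (by positivity), ENNReal.ofReal_natCast]

theorem averagedEigenvalueDistribution_eq {Ω : Type*} [MeasurableSpace Ω] {P : Measure Ω} {n : ℕ}
    (hn : n ≠ 0) {A : Ω → Matrix (Fin n) (Fin n) ℂ} (hA : HasLaw A (ginibreMeasure n) P) (c : ℂ) :
    averagedEigenvalueDistribution P (fun ω => c • A ω) = meanEigenvalueDistribution n c := by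
  have hk : Measurable fun M : Matrix (Fin n) (Fin n) ℂ => eigenvalueDistribution (c • M) :=
    measurable_eigenvalueDistribution_smul hn c
  have hof : Measurable fun a : Fin n → Fin n → ℂ =>
      (Matrix.of a : Matrix (Fin n) (Fin n) ℂ) := measurable_id
  rw [averagedEigenvalueDistribution, meanEigenvalueDistribution, Measure.bind, Measure.bind]
  congr 1
  have h1 : P.map (fun ω => eigenvalueDistribution (c • A ω)) =
      (P.map A).map fun M => eigenvalueDistribution (c • M) :=
    (AEMeasurable.map_map_of_aemeasurable hk.aemeasurable hA.aemeasurable).symm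
  rw [h1, hA.map_eq, ginibreMeasure_eq_gaussianMat, Measure.map_map hk hof]
  rfl

/-! ### Convergence of the mean eigenvalue distributions against bumps -/

/-- The limit of the integrals of the paraboloid bumps. -/
noncomputable def bumpLimit (w : ℂ) (r : ℝ) : ℂ :=
  ∫ z in Metric.ball w r, (z - w) / z * (min (‖z‖ ^ 2) 1 : ℝ)

theorem integral_bump_meanEigenvalueDistribution (n : ℕ) (w : ℂ) {r : ℝ} (hr : 0 ≤ r) :
    ((Real.pi * ∫ v, bump r w v ∂meanEigenvalueDistribution (n + 2)
        ((Real.sqrt (n + 2 : ℕ) : ℂ)⁻¹) : ℝ) : ℂ) =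
      ∫ z in Metric.ball w r, (z - w) / z *
        (1 - poissonDefect (n + 2) ((n + 2 : ℕ) * ‖z‖ ^ 2) : ℝ) := by
  have hN : (0 : ℝ) < (n + 2 : ℕ) := by positivity
  have hc : 0 < (Real.sqrt (n + 2 : ℕ))⁻¹ := by positivity
  have hcont : Continuous (bump r w) :=
    (continuous_bump r).comp (continuous_const.prodMk continuous_id)
  have h := integral_sum_roots_smul n hc w hr
  rw [integral_complex_ofReal, integral_const_mul] at h
  rw [integral_meanEigenvalueDistribution (by omega) _ (bump_nonneg r w) hcont, integral_const_mul,
    mul_left_comm, Complex.ofReal_mul]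
  simp only [Complex.ofReal_inv] at h
  refine (congrArg (fun t : ℂ => (((n + 2 : ℕ) : ℝ)⁻¹ : ℝ) * t) h).trans ?_
  rw [← integral_const_mul]
  refine integral_congr_ae (ae_of_all _ fun z => ?_)
  have e : ‖z‖ ^ 2 / (Real.sqrt (n + 2 : ℕ))⁻¹ ^ 2 = (n + 2 : ℕ) * ‖z‖ ^ 2 := by
    rw [inv_pow, Real.sq_sqrt hN.le, div_inv_eq_mul, mul_comm]
  have hN' : ((n + 2 : ℕ) : ℂ) ≠ 0 := by exact_mod_cast hN.ne'
  simp only [e, Complex.ofReal_mul, Complex.ofReal_inv, Complex.ofReal_natCast]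
  field_simp

theorem continuous_poissonDefect (N : ℕ) : Continuous (poissonDefect N) := by
  unfold poissonDefect
  fun_prop

theorem tendsto_setIntegral_poissonDefect (w : ℂ) (r : ℝ) :
    Tendsto (fun n : ℕ => ∫ z in Metric.ball w r, (z - w) / z *
        (1 - poissonDefect (n + 2) ((n + 2 : ℕ) * ‖z‖ ^ 2) : ℝ)) atTop (𝓝 (bumpLimit w r)) := by
  have hint : IntegrableOn (fun z : ℂ => (z - w) / z) (Metric.ball w r) := by
    simpa using integrableOn_div_sub w 0 w r
  have hb : ∀ (n : ℕ) (z : ℂ), |poissonDefect (n + 2) ((n + 2 : ℕ) * ‖z‖ ^ 2) -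
      max (1 - ‖z‖ ^ 2) 0| ≤ (1 + ‖z‖ ^ 2) / (2 * Real.sqrt (n + 2 : ℕ)) := fun n z =>
    abs_poissonDefect_sub_le (by omega) (sq_nonneg _)
  have hmin : ∀ z : ℂ, min (‖z‖ ^ 2) 1 = 1 - max (1 - ‖z‖ ^ 2) 0 := fun z => by
    rcases le_total (‖z‖ ^ 2) 1 with h | h
    · rw [min_eq_left h, max_eq_left (by linarith)]; ring
    · rw [min_eq_right h, max_eq_right (by linarith)]; ring
  refine tendsto_integral_of_dominated_convergence
    -- The second factor is within 1 + |z|² of min(|z|², 1), which is at most 1, and |z| ≤ |w| + r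
    -- on the disc.
    (fun z => ‖(z - w) / z‖ * (2 + (‖w‖ + r) ^ 2)) (fun n => ?_) (hint.norm.mul_const _)
    (fun n => ?_) (ae_of_all _ fun z => ?_)
  · refine hint.aestronglyMeasurable.mul (Continuous.aestronglyMeasurable ?_)
    exact Complex.continuous_ofReal.comp (continuous_const.sub
      ((continuous_poissonDefect _).comp (continuous_const.mul (continuous_norm.pow 2))))
  · filter_upwards [ae_restrict_mem Metric.isOpen_ball.measurableSet] with z hz
    rw [norm_mul, Complex.norm_real, Real.norm_eq_abs]
    refine mul_le_mul_of_nonneg_left ?_ (norm_nonneg _)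
    have hz' : ‖z‖ ≤ ‖w‖ + r := by
      have h1 := norm_add_le w (z - w)
      rw [add_sub_cancel] at h1
      linarith [(mem_ball_iff_norm.mp hz).le]
    have hz2 : ‖z‖ ^ 2 ≤ (‖w‖ + r) ^ 2 := by gcongr
    have hs : 1 ≤ Real.sqrt (n + 2 : ℕ) := by
      rw [Real.one_le_sqrt]; push_cast; linarith [(Nat.cast_nonneg n : (0 : ℝ) ≤ n)]
    have h2 : (1 + ‖z‖ ^ 2) / (2 * Real.sqrt (n + 2 : ℕ)) ≤ 1 + ‖z‖ ^ 2 :=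
      div_le_self (by positivity) (by linarith)
    have h3 := abs_le.mp (hb n z)
    have h4 : 0 ≤ min (‖z‖ ^ 2) 1 := by positivity
    have h5 : min (‖z‖ ^ 2) 1 ≤ 1 := min_le_right _ _
    have h6 := hmin z
    rw [abs_le]
    constructor <;> linarith [h3.1, h3.2]
  · refine Tendsto.const_mul _ (Tendsto.comp (Complex.continuous_ofReal.tendsto _) ?_)
    rw [hmin]
    refine Tendsto.const_sub _ (tendsto_iff_norm_sub_tendsto_zero.mpr ?_)
    have hs : Tendsto (fun n : ℕ => (1 + ‖z‖ ^ 2) / (2 * Real.sqrt (n + 2 : ℕ))) atTop (𝓝 0) := by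
      refine tendsto_const_nhds.div_atTop (Tendsto.const_mul_atTop two_pos ?_)
      exact Real.tendsto_sqrt_atTop.comp
        (tendsto_natCast_atTop_atTop.comp (tendsto_add_atTop_nat 2))
    exact squeeze_zero (fun _ => norm_nonneg _) (fun n => hb n z) hs

theorem integral_uniformUnitDisc (f : ℂ → ℝ) :
    ∫ v, f v ∂uniformUnitDisc = Real.pi⁻¹ * ∫ v in Metric.closedBall 0 1, f v := by
  have hset : {z : ℂ | ‖z‖ ≤ 1} = Metric.closedBall 0 1 := by ext; simp
  rw [uniformUnitDisc, hset, withDensity_indicator Metric.isClosed_closedBall.measurableSet,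
    withDensity_const, integral_smul_measure, ENNReal.toReal_ofReal (by positivity), one_div,
    smul_eq_mul]

theorem isProbabilityMeasure_uniformUnitDisc : IsProbabilityMeasure uniformUnitDisc := by
  have hset : {z : ℂ | ‖z‖ ≤ 1} = Metric.closedBall 0 1 := by ext; simp
  constructor
  rw [uniformUnitDisc, hset, withDensity_indicator Metric.isClosed_closedBall.measurableSet,
    withDensity_const, Measure.smul_apply, Measure.restrict_apply_univ, Complex.volume_closedBall,
    smul_eq_mul, ENNReal.ofReal_one, one_pow, one_mul, one_div,
    ENNReal.ofReal_inv_of_pos Real.pi_pos]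
  have : (NNReal.pi : ℝ≥0∞) = ENNReal.ofReal Real.pi := by
    rw [← NNReal.coe_real_pi, ENNReal.ofReal_coe_nnreal]
  rw [this]
  exact ENNReal.inv_mul_cancel (by simpa using Real.pi_pos) ENNReal.ofReal_ne_top

/-- The kernel is dominated by a convolution integrand of two integrable functions, the indicator of
the unit disc and 1/u cut off at R, since |z - v| ≤ R on the product. -/
theorem integrable_prod_div_sub (w : ℂ) (r : ℝ) :
    Integrable (fun p : ℂ × ℂ => (p.1 - w) / (p.1 - p.2))
      ((volume.restrict (Metric.ball w r)).prod (volume.restrict (Metric.closedBall 0 1))) := by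
  set R := ‖w‖ + r + 1 with hR
  have hf : Integrable ((Metric.closedBall (0 : ℂ) 1).indicator fun _ => (1 : ℂ)) :=
    (integrable_indicator_iff Metric.isClosed_closedBall.measurableSet).mpr
      (integrableOn_const (isCompact_closedBall _ _).measure_lt_top.ne)
  have hg : Integrable ((Metric.closedBall (0 : ℂ) R).indicator fun u => u⁻¹) := by
    rw [integrable_indicator_iff Metric.isClosed_closedBall.measurableSet]
    simpa using integrableOn_inv_sub 0 0 R
  have h := Integrable.convolution_integrand (ContinuousLinearMap.mul ℝ ℂ) hf hg
  have h2 := h.mono_measure (Measure.prod_mono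
    (Measure.restrict_le_self (μ := volume) (s := Metric.ball w r))
    (Measure.restrict_le_self (μ := volume) (s := Metric.closedBall (0 : ℂ) 1)))
  rw [Measure.prod_restrict] at h2 ⊢
  have hms : MeasurableSet (Metric.ball w r ×ˢ Metric.closedBall (0 : ℂ) 1) :=
    Metric.isOpen_ball.measurableSet.prod Metric.isClosed_closedBall.measurableSet
  have hm : Measurable fun p : ℂ × ℂ => (p.1 - w) / (p.1 - p.2) :=
    (measurable_fst.sub_const w).div (measurable_fst.sub measurable_snd)
  refine (h2.norm.const_mul r).mono' hm.aestronglyMeasurable ?_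
  filter_upwards [ae_restrict_mem hms] with p hp
  have hp1 := mem_ball_iff_norm.mp hp.1
  have hp2 := mem_closedBall_zero_iff.mp hp.2
  have hp3 : p.1 - p.2 ∈ Metric.closedBall (0 : ℂ) R := by
    rw [mem_closedBall_zero_iff]
    have h1 : p.1 - p.2 = (p.1 - w) + w - p.2 := by ring
    have h2 := norm_sub_le ((p.1 - w) + w) p.2
    have h3 := norm_add_le (p.1 - w) w
    rw [h1]
    linarith
  rw [Set.indicator_of_mem hp.2, Set.indicator_of_mem hp3, norm_div]
  simp only [ContinuousLinearMap.mul_apply', one_mul, norm_inv, div_eq_mul_inv]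
  gcongr

/-- Fubini turns the integral of a bump into the Cauchy transform of the disc, integrated over the
ball; this identifies the limit. -/
theorem integral_bump_uniformUnitDisc (w : ℂ) {r : ℝ} (hr : 0 ≤ r) :
    ((Real.pi * ∫ v, bump r w v ∂uniformUnitDisc : ℝ) : ℂ) = bumpLimit w r := by
  have hpi : (Real.pi : ℂ) ≠ 0 := by exact_mod_cast Real.pi_ne_zero
  rw [integral_uniformUnitDisc, mul_inv_cancel_left₀ Real.pi_ne_zero, ← integral_complex_ofReal]
  have h1 : ∀ v, ((bump r w v : ℝ) : ℂ) =
      (Real.pi : ℂ)⁻¹ * ∫ z in Metric.ball w r, (z - w) / (z - v) := fun v => by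
    rw [setIntegral_ball_div_sub v w hr, Complex.ofReal_mul, inv_mul_cancel_left₀ hpi, bump]
  simp_rw [h1]
  rw [integral_const_mul, ← integral_integral_swap (integrable_prod_div_sub w r), bumpLimit,
    ← integral_const_mul]
  refine integral_congr_ae (ae_restrict_of_ae ?_)
  filter_upwards [ae_ne_complex 0] with z hz
  have h2 : ∀ v : ℂ, (z - w) / (z - v) = (z - w) / z * (z / (z - v)) := fun v => by
    field_simp
  simp_rw [h2]
  rw [integral_const_mul, setIntegral_unitDisc_div_sub, Complex.ofReal_mul]
  field_simp

theorem tendsto_integral_bump (w : ℂ) {r : ℝ} (hr : 0 ≤ r) :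
    Tendsto (fun n : ℕ => ∫ v, bump r w v ∂meanEigenvalueDistribution (n + 2)
        ((Real.sqrt (n + 2 : ℕ) : ℂ)⁻¹)) atTop (𝓝 (∫ v, bump r w v ∂uniformUnitDisc)) := by
  have h := tendsto_setIntegral_poissonDefect w r
  simp_rw [← integral_bump_meanEigenvalueDistribution _ w hr,
    ← integral_bump_uniformUnitDisc w hr] at h
  have h2 := ((Complex.continuous_re.tendsto _).comp h).const_mul Real.pi⁻¹
  simpa [Function.comp_def, inv_mul_cancel_left₀ Real.pi_ne_zero] using h2

/-! ### From bumps to weak convergence -/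

/-- Fubini moves the smoothing from f to the measure, so convergence on bumps alone controls every
smoothed test function. -/
theorem integral_bumpAverage (μ : Measure ℂ) [IsProbabilityMeasure μ] (r : ℝ)
    {f : ℂ → ℝ} (hf : Continuous f) (hfs : HasCompactSupport f) :
    ∫ v, bumpAverage r f v ∂μ =
      (∫ w, bump r w 0)⁻¹ * ∫ w, (∫ v, bump r w v ∂μ) * f w := by
  have hfi : Integrable f := hf.integrable_of_hasCompactSupport hfs
  have hint : Integrable (fun p : ℂ × ℂ => bump r p.2 p.1 * f p.2) (μ.prod volume) := by
    have h1 : Integrable (fun p : ℂ × ℂ => f p.2) (μ.prod volume) := by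
      simpa using (integrable_const (μ := μ) (1 : ℝ)).mul_prod hfi
    refine (h1.norm.const_mul (r ^ 2)).mono' ?_ (ae_of_all _ fun p => ?_)
    · exact (((continuous_bump r).comp continuous_swap).mul
        (hf.comp continuous_snd)).aestronglyMeasurable
    · rw [norm_mul, Real.norm_of_nonneg (bump_nonneg _ _ _)]
      exact mul_le_mul_of_nonneg_right (bump_le _ _ _) (norm_nonneg _)
  unfold bumpAverage
  rw [integral_const_mul, integral_integral_swap hint]
  simp_rw [integral_mul_const]

theorem tendsto_integral_bumpAverage {μ : ℕ → Measure ℂ} {ν : Measure ℂ}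
    [∀ n, IsProbabilityMeasure (μ n)] [IsProbabilityMeasure ν] {r : ℝ}
    (h : ∀ w, Tendsto (fun n => ∫ v, bump r w v ∂μ n) atTop (𝓝 (∫ v, bump r w v ∂ν)))
    {f : ℂ → ℝ} (hf : Continuous f) (hfs : HasCompactSupport f) :
    Tendsto (fun n => ∫ v, bumpAverage r f v ∂μ n) atTop (𝓝 (∫ v, bumpAverage r f v ∂ν)) := by
  simp_rw [integral_bumpAverage _ r hf hfs]
  refine Tendsto.const_mul _ (tendsto_integral_of_dominated_convergence (fun w => r ^ 2 * ‖f w‖)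
    (fun n => ?_) ((hf.integrable_of_hasCompactSupport hfs).norm.const_mul _)
    (fun n => ae_of_all _ fun w => ?_) (ae_of_all _ fun w => (h w).mul_const _))
  · exact ((continuous_bump r).stronglyMeasurable.integral_prod_right'
      (ν := μ n)).aestronglyMeasurable.mul hf.aestronglyMeasurable
  · rw [norm_mul]
    refine mul_le_mul_of_nonneg_right ?_ (norm_nonneg _)
    refine (norm_integral_le_of_norm_le_const (C := r ^ 2) (ae_of_all _ fun v => ?_)).trans_eq
      (by simp)
    rw [Real.norm_of_nonneg (bump_nonneg _ _ _)]
    exact bump_le _ _ _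

theorem abs_integral_bumpAverage_sub_le (μ : Measure ℂ) [IsProbabilityMeasure μ] {r ε : ℝ}
    (hr : 0 < r) {f : ℂ → ℝ} (hf : Continuous f) (hfs : HasCompactSupport f)
    (h : ∀ v w, ‖v - w‖ < r → |f w - f v| ≤ ε) :
    |∫ v, bumpAverage r f v ∂μ - ∫ v, f v ∂μ| ≤ ε := by
  obtain ⟨C, hC⟩ := hfs.exists_bound_of_continuous hf
  have h0 : ∀ v, |bumpAverage r f v - f v| ≤ ε := fun v => abs_bumpAverage_sub_le hr hf (h v)
  have hfi : Integrable f μ := hf.integrable_of_hasCompactSupport hfs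
  have hm : StronglyMeasurable (bumpAverage r f) :=
    ((((continuous_bump r).comp continuous_swap).mul
      (hf.comp continuous_snd)).stronglyMeasurable.integral_prod_right' (ν := volume)).const_mul _
  have hbi : Integrable (bumpAverage r f) μ := by
    refine Integrable.of_bound hm.aestronglyMeasurable (C + ε) (ae_of_all _ fun v => ?_)
    have h1 := abs_add_le (f v) (bumpAverage r f v - f v)
    rw [add_sub_cancel] at h1
    exact h1.trans (add_le_add (hC v) (h0 v))
  rw [← integral_sub hbi hfi, ← Real.norm_eq_abs]
  exact (norm_integral_le_of_norm_le_const (ae_of_all _ h0)).trans_eq (by simp)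

theorem tendsto_integral_of_hasCompactSupport {μ : ℕ → Measure ℂ} {ν : Measure ℂ}
    [∀ n, IsProbabilityMeasure (μ n)] [IsProbabilityMeasure ν]
    (h : ∀ w r, 0 ≤ r → Tendsto (fun n => ∫ v, bump r w v ∂μ n) atTop (𝓝 (∫ v, bump r w v ∂ν)))
    {f : ℂ → ℝ} (hf : Continuous f) (hfs : HasCompactSupport f) :
    Tendsto (fun n => ∫ v, f v ∂μ n) atTop (𝓝 (∫ v, f v ∂ν)) := by
  rw [Metric.tendsto_atTop]
  intro ε hε
  -- Uniform continuity fixes one radius at which smoothing costs at most ε/4 against every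
  -- probability measure, hence uniformly in n.
  obtain ⟨r, hr, hfr⟩ := Metric.uniformContinuous_iff.mp
    (hfs.uniformContinuous_of_continuous hf) (ε / 4) (by positivity)
  have hfr' : ∀ v w, ‖v - w‖ < r → |f w - f v| ≤ ε / 4 := fun v w hvw => by
    rw [abs_sub_comm, ← Real.dist_eq]
    exact (hfr (by rwa [dist_eq_norm])).le
  obtain ⟨N, hN⟩ := Metric.tendsto_atTop.mp
    (tendsto_integral_bumpAverage (fun w => h w r hr.le) hf hfs) (ε / 4) (by positivity)
  refine ⟨N, fun n hn => ?_⟩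
  have h1 := abs_le.mp (abs_integral_bumpAverage_sub_le (μ n) hr hf hfs hfr')
  have h2 := abs_le.mp (abs_integral_bumpAverage_sub_le ν hr hf hfs hfr')
  have h3 := abs_lt.mp (hN n hn)
  rw [Real.dist_eq, abs_lt]
  constructor <;> linarith [h1.1, h1.2, h2.1, h2.2, h3.1, h3.2]

/-- Inner regularity of ν and a Urysohn function between a compact set and G. This lower bound on
open sets is a portmanteau criterion for probability measures, so no separate tightness argument is
needed. -/
theorem le_liminf_measure_of_isOpen {μ : ℕ → Measure ℂ} {ν : Measure ℂ}
    [∀ n, IsProbabilityMeasure (μ n)] [IsProbabilityMeasure ν]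
    (h : ∀ f : ℂ → ℝ, Continuous f → HasCompactSupport f →
      Tendsto (fun n => ∫ v, f v ∂μ n) atTop (𝓝 (∫ v, f v ∂ν)))
    {G : Set ℂ} (hG : IsOpen G) : ν G ≤ liminf (fun n => μ n G) atTop := by
  rw [hG.measure_eq_iSup_isCompact]
  refine iSup_le fun K => iSup_le fun hKG => iSup_le fun hK => ?_
  obtain ⟨f, hf1, hf0, hfs, hf01⟩ := exists_continuous_one_zero_of_isCompact hK hG.isClosed_compl
    (Set.disjoint_compl_right_iff_subset.mpr hKG)
  have hle : ∀ (ρ : Measure ℂ) [IsProbabilityMeasure ρ],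
      ENNReal.ofReal (∫ v, f v ∂ρ) = ∫⁻ v, ENNReal.ofReal (f v) ∂ρ := fun ρ _ =>
    ofReal_integral_eq_lintegral_ofReal (f.continuous.integrable_of_hasCompactSupport hfs)
      (ae_of_all _ fun v => (hf01 v).1)
  have ht := (ENNReal.continuous_ofReal.tendsto _).comp (h f f.continuous hfs)
  calc ν K ≤ ENNReal.ofReal (∫ v, f v ∂ν) := by
        rw [hle ν, ← lintegral_indicator_one hK.measurableSet]
        refine lintegral_mono fun v => ?_
        by_cases hv : v ∈ K
        · simp [hv, hf1 hv]
        · simp [hv]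
    _ = liminf (fun n => ENNReal.ofReal (∫ v, f v ∂μ n)) atTop := ht.liminf_eq.symm
    _ ≤ liminf (fun n => μ n G) atTop := by
        refine liminf_le_liminf (Eventually.of_forall fun n => ?_)
        rw [hle (μ n), ← lintegral_indicator_one hG.measurableSet]
        refine lintegral_mono fun v => ?_
        by_cases hv : v ∈ G
        · simpa [hv] using (hf01 v).2
        · simp [hf0 hv]

theorem tendsto_integral_of_tendsto_integral_bump {μ : ℕ → Measure ℂ} {ν : Measure ℂ}
    (hμ : ∀ n, IsProbabilityMeasure (μ n)) (hν : IsProbabilityMeasure ν)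
    (h : ∀ w r, 0 ≤ r → Tendsto (fun n => ∫ v, bump r w v ∂μ n) atTop (𝓝 (∫ v, bump r w v ∂ν)))
    (f : ℂ →ᵇ ℝ) : Tendsto (fun n => ∫ v, f v ∂μ n) atTop (𝓝 (∫ v, f v ∂ν)) := by
  let μ' : ℕ → ProbabilityMeasure ℂ := fun n => ⟨μ n, hμ n⟩
  let ν' : ProbabilityMeasure ℂ := ⟨ν, hν⟩
  have ht : Tendsto μ' atTop (𝓝 ν') :=
    tendsto_of_forall_isOpen_le_liminf' fun G hG => le_liminf_measure_of_isOpen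
      (fun f hf hfs => tendsto_integral_of_hasCompactSupport h hf hfs) hG
  exact ProbabilityMeasure.tendsto_iff_forall_integral_tendsto.mp ht f

theorem mainTheorem11 {Ω : ℕ → Type*} [∀ N, MeasurableSpace (Ω N)] (P : ∀ N, Measure (Ω N))
    (A : ∀ N, Ω N → Matrix (Fin N) (Fin N) ℂ)
    (hA : ∀ N, 1 ≤ N → HasLaw (A N) (ginibreMeasure N) (P N)) :
    (∀ N, 1 ≤ N → IsProbabilityMeasure
      (averagedEigenvalueDistribution (P N) fun ω => ((Real.sqrt N : ℂ)⁻¹) • A N ω)) ∧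
    IsProbabilityMeasure uniformUnitDisc ∧
    WeaklyConverges
      (fun N => averagedEigenvalueDistribution (P N) fun ω => ((Real.sqrt N : ℂ)⁻¹) • A N ω)
      uniformUnitDisc := by
  have e : ∀ N, 1 ≤ N → averagedEigenvalueDistribution (P N)
      (fun ω => ((Real.sqrt N : ℂ)⁻¹) • A N ω) =
      meanEigenvalueDistribution N ((Real.sqrt N : ℂ)⁻¹) := fun N hN =>
    averagedEigenvalueDistribution_eq (by omega) (hA N hN) _
  refine ⟨fun N hN => ?_, isProbabilityMeasure_uniformUnitDisc, fun f => ?_⟩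
  · rw [e N hN]
    exact isProbabilityMeasure_meanEigenvalueDistribution (by omega) _
  -- The exact formula needs a nonempty minor, that is N ≥ 2; the first two terms do not affect the
  -- limit.
  · rw [← tendsto_add_atTop_iff_nat 2]
    refine Tendsto.congr (fun n => by simp only [e (n + 2) (by omega)])
      (tendsto_integral_of_tendsto_integral_bump
        (fun n => isProbabilityMeasure_meanEigenvalueDistribution (n := n + 2) (by omega) _)
        isProbabilityMeasure_uniformUnitDisc (fun w r hr => tendsto_integral_bump w hr) f)
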